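/- Let $\mathbb K\in\{\mathbb R,\mathbb C\}$, with $\beta=1$ if $\mathbb K=\mathbb R$ and $\beta=2$ if $\mathbb K=\mathbb C$. Let $\mathcal N_\beta(0,1)$ be the law on $\mathbb K$ with density $(\beta/2\pi)^{\beta/2}e^{-\beta|z|^2/2}$, let $z,\xi$ denote variables with this law, and write $b\cdot x=\mathrm{Re}(\bar b x)$. **Model.** Let $m=m_n$, $p=p_n$ with $m/n\to\alpha>0$ and $p/n\to\delta>0$. The signal $X^\star\in\mathbb K^n$ has i.i.d. entries of law $P_0$, the noise $(A_\mu)_{\mu\le m}$ is i.i.d. in $\mathbb K$ with law $P_A$, the sensing matrix $\Phi\in\mathbb K^{m\times n}$ is random, these three are independent, and $Y_\mu=\varphi_{\rm out}\big(\tfrac1{\sqrt n}(\Phi X^\star)_\mu,A_\mu\big)$. The law of $\varphi_{\rm out}(z,A)$, $A\sim P_A$, has density $P_{\rm out}(\cdot|z)$ on $\mathbb R$ for every $z\in\mathbb K$, with $(y,z)\mapsto P_{\rm out}(y|z)$ measurable. The partition function is $\mathcal Z_n(Y)=\int\prod_{i}P_0(dx_i)\prod_\mu P_{\rm out}\big(Y_\mu\,\big|\,\tfrac1{\sqrt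 n}(\Phi x)_\mu\big)$ and the free entropy is $f_n=\frac1n\mathbb E\ln\mathcal Z_n(Y)$. **Hypotheses.** 1. $\varphi_{\rm out}:\mathbb K^2\to\mathbb R$ is $C^2$ (in the real sense), and $\varphi_{\rm out}$ and its first and second derivatives in $z$ are bounded. 2. $P_0=\mathcal N_\beta(0,1)$, so that $\rho:=\mathbb E_{P_0}|x|^2=1$. 3. $\Phi\overset d=WB/\sqrt p$, where $W\in\mathbb K^{m\times p}$ has i.i.d. $\mathcal N_\beta(0,1)$ entries and $B\in\mathbb K^{p\times n}$ is an arbitrary random matrix independent of $W$. 4. Almost surely the empirical spectral distribution of $B^\dagger B/n$ converges weakly to a compactly supported probability measure $\nu_B\ne\delta_0$, and the largest eigenvalue of $B^\dagger B/n$ converges to a constant $\lambda_{\max}\ge0$. 5. $\nu$ is the limiting spectral distribution of $\Phi^\dagger\Phi/n$: almost surely the empirical spectral distribution of $\Phi^\dagger\Phi/n$ converges weakly to $\nu$, a probability measure with compact support in $[0,\infty)$. **Replica formula.** Put $Q_z=\rho\int\lambda\,d\nu(\lambda)/\alpha$, $\hat Q_z=1/Q_z$, $$\mathcal Z_0(b,a)=\int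 P_0(dx)\,e^{-\frac\beta2a|x|^2+\beta b\cdot x},\qquad \mathcal Z_{\rm out}(y;\omega,v)=\mathbb E_zP_{\rm out}(y|\sqrt v z+\omega),$$ $$I_0(q_x)=\inf_{\hat q_x\ge0}\Big[-\tfrac{\beta\hat q_xq_x}2+\mathbb E_\xi\,\mathcal Z_0(\sqrt{\hat q_x}\xi,\hat q_x)\ln\mathcal Z_0(\sqrt{\hat q_x}\xi,\hat q_x)\Big],$$ $$I_{\rm out}(q_z)=\inf_{\hat q_z\ge0}\Big[-\tfrac{\beta\hat q_zq_z}2-\tfrac\beta2\ln(\hat Q_z+\hat q_z)+\tfrac{\beta\hat q_z}{2\hat Q_z}+\mathbb E_\xi\int_{\mathbb R}dy\,(\mathcal Z_{\rm out}\ln\mathcal Z_{\rm out})\Big(y;\sqrt{\tfrac{\hat q_z}{\hat Q_z(\hat Q_z+\hat q_z)}}\,\xi,\tfrac1{\hat Q_z+\hat q_z}\Big)\Big],$$ $$I_{\rm int}(q_x,q_z)=\inf_{\gamma_x,\gamma_z\ge0}\Big[\tfrac\beta2(\rho-q_x)\gamma_x+\tfrac{\alpha\beta}2(Q_z-q_z)\gamma_z-\tfrac\beta2\int\ln(\rho^{-1}+\gamma_x+\lambda\gamma_z)\,d\nu(\lambda)\Big]-\tfrac\beta2\ln(\rho-q_x)-\tfrac{\beta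 q_x}{2\rho}-\tfrac{\alpha\beta}2\ln(Q_z-q_z)-\tfrac{\alpha\beta q_z}{2Q_z},$$ $$f_{\rm RS}=\sup_{q_x\in[0,\rho]}\ \sup_{q_z\in[0,Q_z]}\big[I_0(q_x)+\alpha I_{\rm out}(q_z)+I_{\rm int}(q_x,q_z)\big].$$ All these quantities take values in $[-\infty,+\infty]$, with $\ln 0=-\infty$ and $-\infty+\infty=-\infty$ (so the edges $q_x=\rho$ and $q_z=Q_z$ do not contribute to the supremum). The integrals of $\mathcal Z\ln\mathcal Z$ and of $\ln\mathcal Z_n(Y)$ are well defined in $(-\infty,+\infty]$. **Claim.** Under hypotheses 1–5, $Q_z=\mathbb E_{\nu_B}[X]/\delta$ and $$f_{\rm RS}=\sup_{\hat q\ge0}\ \inf_{q\in[0,Q_z]}\Big[\tfrac{\beta\hat q}2\big(\mathbb E_{\nu_B}[X]-\delta q\big)-\tfrac\beta2\mathbb E_{\nu_B}\ln(1+\hat qX)+\alpha\Psi_{\rm out}(q)\Big],$$ where $\Psi_{\rm out}(q)=\mathbb E_\xi\int_{\mathbb R}dy\,\mathcal Z_{\rm out}(y;\sqrt q\,\xi,Q_z-q)\ln\mathcal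 Z_{\rm out}(y;\sqrt q\,\xi,Q_z-q)$. Consequently the replica prediction $\lim_nf_n=f_{\rm RS}$ is equivalent to the statement that $\lim_nf_n$ is the right-hand side above. -/

import Mathlib

open MeasureTheory ProbabilityTheory Filter Topology
open scoped ENNReal Matrix BoundedContinuousFunction

namespace ReplicaGLM

noncomputable section

/-- Measurable structure on matrices: the product one, entry by entry. -/
instance matrixMeasurableSpace {a b R : Type*} [MeasurableSpace R] :
    MeasurableSpace (Matrix a b R) :=
  inferInstanceAs (MeasurableSpace (a → b → R))

/-! ### Scalars, Gaussian laws and extended integrals -/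

/-- `β = 1` for the real field and `β = 2` for the complex field. -/
def betaDim (𝕜 : Type*) [RCLike 𝕜] : ℝ := (Module.finrank ℝ 𝕜 : ℝ)

/-- The standard Gaussian law `N_β(0,1)` on `𝕜`, with density proportional to
`exp (-β |z|² / 2)`: each real coordinate is an independent centred Gaussian of variance `1 / β`.
(Over the reals `RCLike.I = 0`, so that only the first coordinate is left.) -/
def betaGaussian (𝕜 : Type*) [RCLike 𝕜] : Measure 𝕜 :=
  ((gaussianReal 0 (Real.toNNReal (1 / betaDim 𝕜))).prod
      (gaussianReal 0 (Real.toNNReal (1 / betaDim 𝕜)))).map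
    (fun t : ℝ × ℝ => (t.1 : 𝕜) + (t.2 : 𝕜) * RCLike.I)

/-- The dot product `z · z' = Re (conj z * z')` of `ℝ^β`. -/
def dot {𝕜 : Type*} [RCLike 𝕜] (z w : 𝕜) : ℝ := RCLike.re (starRingEnd 𝕜 z * w)

/-- The integral of a real function, with values in `[-∞, +∞]`: integral of the positive part minus
integral of the negative part. It is only used for functions whose negative part is integrable, so
that the value lies in `(-∞, +∞]`. -/
def eintegral {X : Type*} [MeasurableSpace X] (μ : Measure X) (f : X → ℝ) : EReal :=
  ((∫⁻ x, ENNReal.ofReal (f x) ∂μ : ℝ≥0∞) : EReal)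
    - ((∫⁻ x, ENNReal.ofReal (-f x) ∂μ : ℝ≥0∞) : EReal)

/-- Logarithm with `ln 0 = -∞`. -/
def elog (x : ℝ) : EReal := ENNReal.log (ENNReal.ofReal x)

/-- The second moment `ρ = E |x|²` of a prior. -/
def secondMoment {𝕜 : Type*} [RCLike 𝕜] (P0 : Measure 𝕜) : ℝ := ∫ x, ‖x‖ ^ 2 ∂P0

/-! ### The auxiliary functions -/

/-- `Z_0(b, a) = ∫ P_0(dx) exp (-β a |x|² / 2 + β b · x)`. -/
def Zprior {𝕜 : Type*} [RCLike 𝕜] (P0 : Measure 𝕜) (b : 𝕜) (a : ℝ) : ℝ :=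
  ∫ x, Real.exp (-(betaDim 𝕜 / 2) * a * ‖x‖ ^ 2 + betaDim 𝕜 * dot b x) ∂P0

/-- `Z_out(y; ω, v) = E_z P_out(y | √v z + ω)` with `z ~ N_β(0,1)`. -/
def Zout {𝕜 : Type*} [RCLike 𝕜] (Pout : ℝ → 𝕜 → ℝ) (y : ℝ) (ω : 𝕜) (v : ℝ) : ℝ :=
  ∫ z, Pout y (((Real.sqrt v : ℝ) : 𝕜) * z + ω) ∂(betaGaussian 𝕜)

/-- `E_ξ Z_0(√q ξ, q) ln Z_0(√q ξ, q)` with `ξ ~ N_β(0,1)`. -/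
def priorEntropy {𝕜 : Type*} [RCLike 𝕜] (P0 : Measure 𝕜) (q : ℝ) : EReal :=
  eintegral (betaGaussian 𝕜) fun ξ =>
    Zprior P0 (((Real.sqrt q : ℝ) : 𝕜) * ξ) q
      * Real.log (Zprior P0 (((Real.sqrt q : ℝ) : 𝕜) * ξ) q)

/-- `E_ξ ∫ dy Z_out(y; √s ξ, v) ln Z_out(y; √s ξ, v)` with `ξ ~ N_β(0,1)`. -/
def channelEntropy {𝕜 : Type*} [RCLike 𝕜] (Pout : ℝ → 𝕜 → ℝ) (s v : ℝ) : EReal :=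
  eintegral ((betaGaussian 𝕜).prod (volume : Measure ℝ)) fun w =>
    Zout Pout w.2 (((Real.sqrt s : ℝ) : 𝕜) * w.1) v
      * Real.log (Zout Pout w.2 (((Real.sqrt s : ℝ) : 𝕜) * w.1) v)

/-! ### The replica-symmetric formula -/

/-- `I_0(q_x)`. -/
def I0 {𝕜 : Type*} [RCLike 𝕜] (P0 : Measure 𝕜) (qx : ℝ) : EReal :=
  ⨅ qhx ∈ Set.Ici (0 : ℝ), ((-(betaDim 𝕜 * qhx * qx / 2) : ℝ) : EReal) + priorEntropy P0 qhx

/-- `I_out(q_z)`, where `Q̂_z = 1 / Q_z`. -/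
def Iout {𝕜 : Type*} [RCLike 𝕜] (Pout : ℝ → 𝕜 → ℝ) (Qz qz : ℝ) : EReal :=
  ⨅ qhz ∈ Set.Ici (0 : ℝ),
    ((-(betaDim 𝕜 * qhz * qz / 2) - betaDim 𝕜 / 2 * Real.log (1 / Qz + qhz)
        + betaDim 𝕜 * qhz / (2 * (1 / Qz)) : ℝ) : EReal)
      + channelEntropy Pout (qhz / ((1 / Qz) * (1 / Qz + qhz))) (1 / (1 / Qz + qhz))

/-- `I_int(q_x, q_z)`. On the edges `q_x = ρ` and `q_z = Q_z` the infimum is `-∞` and a logarithm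
is `-∞` as well; since `-∞ + ∞ = -∞` in `EReal`, these edges do not contribute to a supremum. -/
def Iint (𝕜 : Type*) [RCLike 𝕜] (ρ α Qz : ℝ) (ν : Measure ℝ) (qx qz : ℝ) : EReal :=
  (⨅ γx ∈ Set.Ici (0 : ℝ), ⨅ γz ∈ Set.Ici (0 : ℝ),
      ((betaDim 𝕜 / 2 * (ρ - qx) * γx + α * betaDim 𝕜 / 2 * (Qz - qz) * γz
          - betaDim 𝕜 / 2 * ∫ l, Real.log (ρ⁻¹ + γx + l * γz) ∂ν : ℝ) : EReal))
    - ((betaDim 𝕜 / 2 : ℝ) : EReal) * elog (ρ - qx) - ((betaDim 𝕜 * qx / (2 * ρ) : ℝ) : EReal)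
    - ((α * betaDim 𝕜 / 2 : ℝ) : EReal) * elog (Qz - qz)
    - ((α * betaDim 𝕜 * qz / (2 * Qz) : ℝ) : EReal)

/-- `Q_z = ρ ⟨λ⟩_ν / α`. -/
def replicaQz (ρ α : ℝ) (ν : Measure ℝ) : ℝ := ρ * (∫ l, l ∂ν) / α

/-- The replica formula for a prior `P0`, a channel `Pout`, a ratio `α` and a spectral law `ν`:
`sup_{q_x ∈ [0, ρ]} sup_{q_z ∈ [0, Q_z]} [I_0(q_x) + α I_out(q_z) + I_int(q_x, q_z)]`. -/
def replicaFormula {𝕜 : Type*} [RCLike 𝕜] (P0 : Measure 𝕜) (Pout : ℝ → 𝕜 → ℝ) (α : ℝ)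
    (ν : Measure ℝ) : EReal :=
  ⨆ qx ∈ Set.Icc (0 : ℝ) (secondMoment P0),
    ⨆ qz ∈ Set.Icc (0 : ℝ) (replicaQz (secondMoment P0) α ν),
      I0 P0 qx + (α : EReal) * Iout Pout (replicaQz (secondMoment P0) α ν) qz
        + Iint 𝕜 (secondMoment P0) α (replicaQz (secondMoment P0) α ν) ν qx qz

/-! ### The two-variable formula -/

/-- `Ψ_out(q) = E_ξ ∫ dy Z_out(y; √q ξ, Q_z - q) ln Z_out(y; √q ξ, Q_z - q)`. -/
def PsiOut {𝕜 : Type*} [RCLike 𝕜] (Pout : ℝ → 𝕜 → ℝ) (Qz q : ℝ) : EReal :=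
  channelEntropy Pout q (Qz - q)

/-- `Q_z = E_{ν_B}[X] / δ`. -/
def productQz (δ : ℝ) (νB : Measure ℝ) : ℝ := (∫ x, x ∂νB) / δ

/-- `sup_{q̂ ≥ 0} inf_{q ∈ [0, Q_z]} [β q̂ (E X - δ q) / 2 - (β / 2) E ln (1 + q̂ X) + α Ψ_out(q)]`,
with `X ~ ν_B` and `Q_z = E X / δ`. -/
def supInfFormula {𝕜 : Type*} [RCLike 𝕜] (Pout : ℝ → 𝕜 → ℝ) (α δ : ℝ) (νB : Measure ℝ) : EReal :=
  ⨆ qh ∈ Set.Ici (0 : ℝ), ⨅ q ∈ Set.Icc (0 : ℝ) (productQz δ νB),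
    ((betaDim 𝕜 * qh / 2 * ((∫ x, x ∂νB) - δ * q)
        - betaDim 𝕜 / 2 * ∫ x, Real.log (1 + qh * x) ∂νB : ℝ) : EReal)
      + (α : EReal) * PsiOut Pout (productQz δ νB) q

/-! ### The generalized linear model and its free entropy -/

/-- The noiseless projections `(1 / √n) Φ x`. -/
def projections {𝕜 : Type*} [RCLike 𝕜] {m n : ℕ} (Φ : Matrix (Fin m) (Fin n) 𝕜)
    (x : Fin n → 𝕜) : Fin m → 𝕜 :=
  fun μ => ((Real.sqrt n)⁻¹ : ℝ) • (Φ *ᵥ x) μ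

/-- The observations `Y_μ = φ_out((Φ x)_μ / √n, a_μ)`. -/
def observations {𝕜 : Type*} [RCLike 𝕜] {m n : ℕ} (φ : 𝕜 → 𝕜 → ℝ)
    (Φ : Matrix (Fin m) (Fin n) 𝕜) (x : Fin n → 𝕜) (a : Fin m → 𝕜) : Fin m → ℝ :=
  fun μ => φ (projections Φ x μ) (a μ)

/-- The partition function `Z_n(Y) = ∫ ∏ P_0(dx_i) ∏ P_out(Y_μ | (Φ x)_μ / √n)`. -/
def partitionFunction {𝕜 : Type*} [RCLike 𝕜] {m n : ℕ} (P0 : Measure 𝕜) (Pout : ℝ → 𝕜 → ℝ)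
    (Φ : Matrix (Fin m) (Fin n) 𝕜) (y : Fin m → ℝ) : ℝ :=
  ∫ x, ∏ μ, Pout (y μ) (projections Φ x μ) ∂(Measure.pi fun _ : Fin n => P0)

/-- The free entropy `f_n = (1 / n) E ln Z_n(Y)`: the expectation is over the sensing matrix
`Φ : Ω → 𝕜^{m × n}`, the signal with i.i.d. entries of law `P0` and the noise with i.i.d. entries
of law `PA`, these three being independent. -/
def freeEntropy {Ω : Type*} [MeasurableSpace Ω] (P : Measure Ω) {𝕜 : Type*} [RCLike 𝕜] {m n : ℕ}
    (P0 PA : Measure 𝕜) (φ : 𝕜 → 𝕜 → ℝ) (Pout : ℝ → 𝕜 → ℝ)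
    (Φ : Ω → Matrix (Fin m) (Fin n) 𝕜) : EReal :=
  ((1 / n : ℝ) : EReal) *
    eintegral (P.prod ((Measure.pi fun _ : Fin n => P0).prod (Measure.pi fun _ : Fin m => PA)))
      fun w => Real.log (partitionFunction P0 Pout (Φ w.1)
        (observations φ (Φ w.1) w.2.1 w.2.2))

/-! ### Hypotheses -/

/-- `φ_out` is of class `C²`, bounded, with bounded first and second derivatives in `z`. -/
structure ChannelRegular {𝕜 : Type*} [RCLike 𝕜] (φ : 𝕜 → 𝕜 → ℝ) : Prop where
  contDiff : ContDiff ℝ 2 (fun t : 𝕜 × 𝕜 => φ t.1 t.2)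
  bounded : ∃ C : ℝ, ∀ z a : 𝕜, |φ z a| ≤ C
  bounded_fst : ∃ C : ℝ, ∀ z a : 𝕜, ‖fderiv ℝ (fun w : 𝕜 => φ w a) z‖ ≤ C
  bounded_snd : ∃ C : ℝ, ∀ z a : 𝕜, ‖iteratedFDeriv ℝ 2 (fun w : 𝕜 => φ w a) z‖ ≤ C

/-- `P_out(· | z)` is the probability density of `φ_out(z, A)`, `A ~ P_A`, for every `z`. -/
structure IsChannelDensity {𝕜 : Type*} [RCLike 𝕜] (φ : 𝕜 → 𝕜 → ℝ) (PA : Measure 𝕜)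
    (Pout : ℝ → 𝕜 → ℝ) : Prop where
  measurable : Measurable (fun t : ℝ × 𝕜 => Pout t.1 t.2)
  nonneg : ∀ y z, 0 ≤ Pout y z
  law : ∀ z, PA.map (φ z) = (volume : Measure ℝ).withDensity fun y => ENNReal.ofReal (Pout y z)

/-- The matrix `M† M / n`, for `M` with `n` columns. -/
def gram {𝕜 : Type*} [RCLike 𝕜] {k n : ℕ} (M : Matrix (Fin k) (Fin n) 𝕜) :
    Matrix (Fin n) (Fin n) 𝕜 :=
  ((n : ℝ)⁻¹) • (Mᴴ * M)

theorem gram_isHermitian {𝕜 : Type*} [RCLike 𝕜] {k n : ℕ} (M : Matrix (Fin k) (Fin n) 𝕜) :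
    (gram M).IsHermitian := by
  unfold gram Matrix.IsHermitian
  rw [Matrix.conjTranspose_smul, (Matrix.isHermitian_conjTranspose_mul_self M).eq]
  simp

/-- The eigenvalues of `M† M / n`, with multiplicity. -/
def gramEigenvalues {𝕜 : Type*} [RCLike 𝕜] {k n : ℕ} (M : Matrix (Fin k) (Fin n) 𝕜) :
    Fin n → ℝ :=
  (gram_isHermitian M).eigenvalues

/-- The empirical spectral distribution of `M† M / n`. -/
def empiricalSpectrum {𝕜 : Type*} [RCLike 𝕜] {k n : ℕ} (M : Matrix (Fin k) (Fin n) 𝕜) :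
    Measure ℝ :=
  ((n : ℝ≥0∞)⁻¹) • ∑ i, Measure.dirac (gramEigenvalues M i)

/-- Almost surely, the empirical spectral distribution of `M_n† M_n / n` converges weakly
to `ν`. -/
def HasLimitingSpectrum {Ω : Type*} [MeasurableSpace Ω] (P : Measure Ω) {𝕜 : Type*} [RCLike 𝕜]
    {k : ℕ → ℕ} (M : (n : ℕ) → Ω → Matrix (Fin (k n)) (Fin n) 𝕜) (ν : Measure ℝ) : Prop :=
  ∀ᵐ ω ∂P, ∀ f : ℝ →ᵇ ℝ,
    Tendsto (fun n => ∫ x, f x ∂(empiricalSpectrum (M n ω))) atTop (𝓝 (∫ x, f x ∂ν))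

/-- `W` is a random matrix with i.i.d. entries of law `N_β(0,1)`. -/
structure IsGaussianMatrix {Ω : Type*} [MeasurableSpace Ω] (P : Measure Ω) {𝕜 : Type*} [RCLike 𝕜]
    {m p : ℕ} (W : Ω → Matrix (Fin m) (Fin p) 𝕜) : Prop where
  indep : iIndepFun (fun (ij : Fin m × Fin p) ω => W ω ij.1 ij.2) P
  law : ∀ i j, HasLaw (fun ω => W ω i j) (betaGaussian 𝕜) P

/-- The product structure of the sensing matrices: `Φ_n` has the law of `W_n B_n / √p_n`, where
`W_n` is an i.i.d. standard Gaussian matrix and `B_n` an arbitrary random matrix independent of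
`W_n`, and `m_n / n → α`, `p_n / n → δ`. -/
structure ProductStructure {Ω : Type*} [MeasurableSpace Ω] (P : Measure Ω) {𝕜 : Type*} [RCLike 𝕜]
    (α δ : ℝ) (m p : ℕ → ℕ)
    (Φ : (n : ℕ) → Ω → Matrix (Fin (m n)) (Fin n) 𝕜)
    (W : (n : ℕ) → Ω → Matrix (Fin (m n)) (Fin (p n)) 𝕜)
    (B : (n : ℕ) → Ω → Matrix (Fin (p n)) (Fin n) 𝕜) : Prop where
  tendsto_m : Tendsto (fun n => (m n : ℝ) / n) atTop (𝓝 α)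
  tendsto_p : Tendsto (fun n => (p n : ℝ) / n) atTop (𝓝 δ)
  gaussian : ∀ n, IsGaussianMatrix P (W n)
  measurable_B : ∀ n, Measurable (B n)
  indep : ∀ n, IndepFun (W n) (B n) P
  law : ∀ n, IdentDistrib (Φ n) (fun ω => ((Real.sqrt (p n))⁻¹ : ℝ) • (W n ω * B n ω)) P P

/-- The spectrum of `B_n† B_n / n`: almost surely, its empirical distribution converges weakly to
`ν_B`, which is compactly supported and not the point mass at `0`, and its largest eigenvalue
converges to a constant `λ_max ≥ 0`. -/
structure SpectrumConvergence {Ω : Type*} [MeasurableSpace Ω] (P : Measure Ω) {𝕜 : Type*}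
    [RCLike 𝕜] {p : ℕ → ℕ} (B : (n : ℕ) → Ω → Matrix (Fin (p n)) (Fin n) 𝕜)
    (νB : Measure ℝ) : Prop where
  limit : HasLimitingSpectrum P B νB
  compact : ∃ K : Set ℝ, IsCompact K ∧ νB Kᶜ = 0
  ne_dirac : νB ≠ Measure.dirac 0
  top_eigenvalue : ∃ lmax : ℝ, 0 ≤ lmax ∧
    ∀ᵐ ω ∂P, Tendsto (fun n => ⨆ i, gramEigenvalues (B n ω) i) atTop (𝓝 lmax)

end

end ReplicaGLM

namespace ReplicaGLM

noncomputable section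

/-! ### The Gaussian law `N_β(0,1)` -/

section Gaussian

variable {𝕜 : Type*} [RCLike 𝕜]

/-! Write `μ` for `ν_B`, `L(k) = ∫ ln(1 + kx) dμ`, `J(γ) = ∫ ln(1 + γλ) dν`, `Q` for `Q_z`, and
`g(x) = x - 1 - ln x` (`logGap`). The proof has a spectral half, a convexity half, and a scalar
duality that joins them.

Spectral half. The laws `ν` and `μ` are linked by `J(γ) ≤ L(k) + α g(kδ/(αγ))` for all `k, γ > 0`
(`integral_log_one_add_le`), with the reverse inequality when `k` makes the right-hand side
stationary, that is `k L'(k) + kδ/γ = α` (`le_integral_log_one_add`). Both are annealed bounds given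
`B`, turned into statements about `ν` by Markov's inequality along one good outcome. For the upper
bound, `E_W det(1 + γ Φ†Φ/n)` is averaged row by row, each Gaussian row being traded for a small
multiple of `B†B`. For the lower bound, `E_W det(1 + γ Φ†Φ/n)^(-β/2)` is a Gaussian integral of a
Gaussian integral; a Gamma integral, convexity of `ln det(1 + e^s B†B)` in `s`, and a Stirling bound
give the same exponent. Small `γ` and `k` in the two inequalities compare first moments
(`integral_id_eq_of_log_moments`), which is the identity for `Q_z`.

Reduction. With a Gaussian prior the `q_x` terms of `I_0` and `I_int` cancel, so `q_x = 0` is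
optimal. Put `t = Q - q_z`, `u = 1/(Q̂_z + q̂_z)` and `(β/2) ψ(u) = α Ψ_out(Q - u)`. Then `f_RS` is
`β/2` times the supremum over `t` of `inf_u [α g(t/u) + ψ(u)] + inf_γ [α t γ - J(γ)]`, while the
other side is `β/2` times the supremum over `k` of `inf_u [kδu + ψ(u)] - L(k)`.

Convexity half. Two properties of `ψ` are needed: it is convex and nonincreasing in `u`, and `ψ + α
ln u` is convex in `1/u` with slope `-α t` for some `t ∈ [0, u]` (`exists_channel_potential`). Both
come from one principle: the entropy of a density that is a martingale along Gaussian increments has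
nondecreasing increments, because mutual information is nonnegative
(`lintegral_entropyFun_marginals_le`). It is applied to the channel density smoothed by the
remaining variance, and to its tilt by a Gaussian observation of signal-to-noise ratio `a = Q/u -
1`.

Duality. Given `t`, the intermediate value theorem gives `k, u, γ` stationary for all the
functionals at once; the subgradient of `ψ` at `u` then gives the dual variable of the sup-inf
problem (`exists_nested_le`). Given `k`, the point `u = L'(k)/δ` and the slope of `ψ + α ln u` in
`1/u` give `t`, up to an arbitrarily small error (`exists_le_nested`). -/

theorem betaDim_cases (𝕜 : Type*) [RCLike 𝕜] :
    ((RCLike.I : 𝕜) = 0 ∧ betaDim 𝕜 = 1) ∨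
      (RCLike.im (RCLike.I : 𝕜) = 1 ∧ betaDim 𝕜 = 2) := by
  rcases RCLike.I_eq_zero_or_im_I_eq_one (K := 𝕜) with h | h
  · refine Or.inl ⟨h, ?_⟩
    have hs := RCLike.span_one_I 𝕜
    rw [h, Set.pair_comm, Submodule.span_insert_zero] at hs
    have : Module.finrank ℝ 𝕜 = 1 := by
      rw [← finrank_top ℝ 𝕜, ← hs]
      exact finrank_span_singleton one_ne_zero
    simp [betaDim, this]
  · refine Or.inr ⟨h, ?_⟩
    have : Module.finrank ℝ 𝕜 = 2 := by
      have := (RCLike.complexLinearIsometryEquiv (𝕜 := 𝕜) h).toLinearEquiv.finrank_eq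
      rw [Complex.finrank_real_complex] at this
      exact this
    simp [betaDim, this]

theorem betaDim_pos (𝕜 : Type*) [RCLike 𝕜] : 0 < betaDim 𝕜 := by
  rcases betaDim_cases 𝕜 with h | h <;> rw [h.2] <;> norm_num

theorem dot_eq_inner (z w : 𝕜) : dot z w = inner ℝ z w := by
  rw [dot, mul_comm]; rfl

theorem dot_eq_re_im (z w : 𝕜) :
    dot z w = RCLike.re z * RCLike.re w + RCLike.im z * RCLike.im w := by
  simp [dot, RCLike.mul_re]

theorem measurable_coordinates :
    Measurable (fun t : ℝ × ℝ => (t.1 : 𝕜) + (t.2 : 𝕜) * RCLike.I) := by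
  have : Continuous (fun t : ℝ × ℝ => (t.1 : 𝕜) + (t.2 : 𝕜) * RCLike.I) := by
    have h := RCLike.continuous_ofReal (K := 𝕜)
    exact (h.comp continuous_fst).add ((h.comp continuous_snd).mul continuous_const)
  exact this.measurable

instance : IsProbabilityMeasure (betaGaussian 𝕜) :=
  Measure.isProbabilityMeasure_map measurable_coordinates.aemeasurable

theorem lintegral_betaGaussian {f : 𝕜 → ℝ≥0∞} (hf : Measurable f) :
    ∫⁻ z, f z ∂(betaGaussian 𝕜) =
      ∫⁻ s, ∫⁻ t, f ((s : 𝕜) + (t : 𝕜) * RCLike.I)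
        ∂(gaussianReal 0 (Real.toNNReal (1 / betaDim 𝕜)))
        ∂(gaussianReal 0 (Real.toNNReal (1 / betaDim 𝕜))) := by
  rw [betaGaussian, lintegral_map hf measurable_coordinates, lintegral_prod]
  exact (hf.comp measurable_coordinates).aemeasurable

/-- Only `‖t‖` enters. This is the source of unitary invariance and of stability under sums, for
both fields at once; over the reals `RCLike.I = 0` removes the second coordinate. -/
theorem charFun_betaGaussian (t : 𝕜) :
    charFun (betaGaussian 𝕜) t = Complex.exp (-(‖t‖ ^ 2 / (2 * betaDim 𝕜) : ℝ)) := by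
  have hβ := betaDim_pos 𝕜
  have hv : ((Real.toNNReal (1 / betaDim 𝕜) : NNReal) : ℝ) = 1 / betaDim 𝕜 :=
    Real.coe_toNNReal _ (by positivity)
  have key : charFun (betaGaussian 𝕜) t
      = charFun (gaussianReal 0 (Real.toNNReal (1 / betaDim 𝕜))) (RCLike.re t) *
        charFun (gaussianReal 0 (Real.toNNReal (1 / betaDim 𝕜)))
          (RCLike.im (RCLike.I : 𝕜) * RCLike.im t) := by
    rw [charFun_apply, betaGaussian, integral_map measurable_coordinates.aemeasurable]
    · rw [charFun_apply, charFun_apply, ← integral_prod_mul]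
      refine integral_congr_ae (Eventually.of_forall fun x => ?_)
      simp only
      rw [← Complex.exp_add, ← add_mul, ← Complex.ofReal_add]
      congr 3
      rw [← dot_eq_inner, dot_eq_re_im]
      simp only [map_add, RCLike.mul_re, RCLike.mul_im, RCLike.I_re, RCLike.ofReal_re,
        RCLike.ofReal_im, Real.inner_apply]
      ring_nf
      try simp
    · refine Continuous.aestronglyMeasurable ?_
      fun_prop
  rw [key, charFun_gaussianReal, charFun_gaussianReal, ← Complex.exp_add, hv]
  congr 1
  rw [← RCLike.normSq_eq_def' t, RCLike.normSq_apply]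
  push_cast
  rcases betaDim_cases 𝕜 with ⟨h, hb⟩ | ⟨h, hb⟩
  · have him : RCLike.im t = 0 := by
      have := RCLike.re_add_im t
      rw [h] at this
      rw [← this]; simp
    rw [him, hb]; push_cast; ring_nf
  · rw [h, hb]; push_cast; ring_nf

theorem map_add_betaGaussian {v w : ℝ} (hv : 0 ≤ v) (hw : 0 ≤ w) :
    ((betaGaussian 𝕜).prod (betaGaussian 𝕜)).map
        (fun x => ((√v : ℝ) : 𝕜) * x.1 + ((√w : ℝ) : 𝕜) * x.2)
      = (betaGaussian 𝕜).map (fun z => ((√(v + w) : ℝ) : 𝕜) * z) := by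
  have e : ((betaGaussian 𝕜).prod (betaGaussian 𝕜)).map
        (fun x => ((√v : ℝ) : 𝕜) * x.1 + ((√w : ℝ) : 𝕜) * x.2)
      = ((betaGaussian 𝕜).map (fun z => √v • z)) ∗ ((betaGaussian 𝕜).map (fun z => √w • z)) := by
    rw [Measure.conv, Measure.map_prod_map _ _ (by fun_prop) (by fun_prop),
      Measure.map_map (by fun_prop) (by fun_prop)]
    congr 1
    ext x
    simp [RCLike.real_smul_eq_coe_mul]
  rw [e]
  simp_rw [← RCLike.real_smul_eq_coe_mul]
  have : IsProbabilityMeasure ((betaGaussian 𝕜).map (fun z => √v • z)) :=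
    Measure.isProbabilityMeasure_map (by fun_prop)
  have : IsProbabilityMeasure ((betaGaussian 𝕜).map (fun z => √w • z)) :=
    Measure.isProbabilityMeasure_map (by fun_prop)
  have : IsProbabilityMeasure ((betaGaussian 𝕜).map (fun z => √(v + w) • z)) :=
    Measure.isProbabilityMeasure_map (by fun_prop)
  refine Measure.ext_of_charFun ?_
  ext t
  rw [charFun_conv, charFun_map_smul, charFun_map_smul, charFun_map_smul,
    charFun_betaGaussian, charFun_betaGaussian, charFun_betaGaussian, ← Complex.exp_add]
  congr 1
  simp only [norm_smul, mul_pow, Real.norm_eq_abs, sq_abs, Real.sq_sqrt hv, Real.sq_sqrt hw,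
    Real.sq_sqrt (add_nonneg hv hw)]
  push_cast
  ring

theorem lintegral_add_betaGaussian {v w : ℝ} (hv : 0 ≤ v) (hw : 0 ≤ w) {f : 𝕜 → ℝ≥0∞}
    (hf : Measurable f) :
    ∫⁻ x, ∫⁻ y, f (((√v : ℝ) : 𝕜) * x + ((√w : ℝ) : 𝕜) * y) ∂(betaGaussian 𝕜) ∂(betaGaussian 𝕜)
      = ∫⁻ z, f (((√(v + w) : ℝ) : 𝕜) * z) ∂(betaGaussian 𝕜) := by
  have h1 : Measurable fun x : 𝕜 × 𝕜 => ((√v : ℝ) : 𝕜) * x.1 + ((√w : ℝ) : 𝕜) * x.2 := by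
    fun_prop
  have h2 : Measurable fun x : 𝕜 => ((√(v + w) : ℝ) : 𝕜) * x := by fun_prop
  rw [← lintegral_map hf h2, ← map_add_betaGaussian hv hw, lintegral_map hf h1, lintegral_prod]
  exact (hf.comp h1).aemeasurable

/-- Exponential tilting of a centred real Gaussian law. -/
theorem lintegral_gaussianReal_tilt {σ a b : ℝ} (hσ : 0 < σ) (ha : -1 < a) {f : ℝ → ℝ≥0∞}
    (hf : Measurable f) :
    ∫⁻ t, ENNReal.ofReal (Real.exp (-(a * t ^ 2 / (2 * σ)) + b * t / σ)) * f t
        ∂(gaussianReal 0 (Real.toNNReal σ))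
      = ENNReal.ofReal ((1 + a) ^ (-(1 / 2) : ℝ) * Real.exp (b ^ 2 / (2 * σ * (1 + a)))) *
        ∫⁻ t, f (√(1 / (1 + a)) * t + b / (1 + a)) ∂(gaussianReal 0 (Real.toNNReal σ)) := by
  have h1a : 0 < 1 + a := by linarith
  have hσ' : Real.toNNReal σ ≠ 0 := by simpa using hσ
  have hv : Real.toNNReal (σ / (1 + a)) ≠ 0 := by simpa using div_pos hσ h1a
  have hmap : (gaussianReal 0 (Real.toNNReal σ)).map (fun t => √(1 / (1 + a)) * t + b / (1 + a))
      = gaussianReal (b / (1 + a)) (Real.toNNReal (σ / (1 + a))) := by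
    have : (fun t => √(1 / (1 + a)) * t + b / (1 + a))
        = (fun t => t + b / (1 + a)) ∘ (fun t => √(1 / (1 + a)) * t) := rfl
    rw [this, ← Measure.map_map (by fun_prop) (by fun_prop), gaussianReal_map_const_mul,
      gaussianReal_map_add_const]
    congr 1
    · simp
    · ext
      push_cast
      rw [Real.coe_toNNReal _ hσ.le, Real.coe_toNNReal _ (div_pos hσ h1a).le]
      rw [Real.sq_sqrt (by positivity)]
      ring
  rw [← lintegral_map hf (by fun_prop), hmap, gaussianReal_of_var_ne_zero _ hσ',
    gaussianReal_of_var_ne_zero _ hv,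
    lintegral_withDensity_eq_lintegral_mul _ (measurable_gaussianPDF _ _) (by fun_prop),
    lintegral_withDensity_eq_lintegral_mul _ (measurable_gaussianPDF _ _) hf,
    ← lintegral_const_mul _ ((measurable_gaussianPDF _ _).mul hf)]
  refine lintegral_congr fun t => ?_
  simp only [Pi.mul_apply, gaussianPDF]
  rw [← mul_assoc, ← mul_assoc, ← ENNReal.ofReal_mul (gaussianPDFReal_nonneg _ _ _),
    ← ENNReal.ofReal_mul (by positivity)]
  congr 2
  rw [gaussianPDFReal, gaussianPDFReal, Real.coe_toNNReal _ hσ.le,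
    Real.coe_toNNReal _ (div_pos hσ h1a).le]
  have hs : (√(2 * Real.pi * (σ / (1 + a))))⁻¹ = (√(2 * Real.pi * σ))⁻¹ * √(1 + a) := by
    rw [show 2 * Real.pi * (σ / (1 + a)) = (2 * Real.pi * σ) / (1 + a) by ring,
      Real.sqrt_div' _ h1a.le]
    field_simp
  have hp : (1 + a) ^ (-(1 / 2) : ℝ) * √(1 + a) = 1 := by
    rw [Real.sqrt_eq_rpow, ← Real.rpow_add h1a]; norm_num
  rw [hs]
  -- Completing the square in `t`; the factor `√(1 + a)` produced by the change of variance is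
  -- absorbed by `(1 + a)^(-1/2)`.
  calc (√(2 * Real.pi * σ))⁻¹ * Real.exp (-(t - 0) ^ 2 / (2 * σ))
        * Real.exp (-(a * t ^ 2 / (2 * σ)) + b * t / σ)
      = (√(2 * Real.pi * σ))⁻¹ * (Real.exp (b ^ 2 / (2 * σ * (1 + a)))
        * Real.exp (-(t - b / (1 + a)) ^ 2 / (2 * (σ / (1 + a))))) := by
        rw [mul_assoc, ← Real.exp_add, ← Real.exp_add]
        congr 2
        field_simp
        ring
    _ = _ := by
        linear_combination (-(√(2 * Real.pi * σ))⁻¹ * (Real.exp (b ^ 2 / (2 * σ * (1 + a)))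
        * Real.exp (-(t - b / (1 + a)) ^ 2 / (2 * (σ / (1 + a)))))) * hp

/-- Exponential tilting of `N_β(0,1)`. -/
theorem lintegral_betaGaussian_tilt {a : ℝ} (ha : -1 < a) (b : 𝕜) {f : 𝕜 → ℝ≥0∞}
    (hf : Measurable f) :
    ∫⁻ z, ENNReal.ofReal (Real.exp (-(betaDim 𝕜 / 2) * a * ‖z‖ ^ 2 + betaDim 𝕜 * dot b z)) * f z
        ∂(betaGaussian 𝕜)
      = ENNReal.ofReal ((1 + a) ^ (-(betaDim 𝕜 / 2) : ℝ)
          * Real.exp (betaDim 𝕜 * ‖b‖ ^ 2 / (2 * (1 + a)))) *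
        ∫⁻ z, f (((√(1 / (1 + a)) : ℝ) : 𝕜) * z + ((1 / (1 + a) : ℝ) : 𝕜) * b)
          ∂(betaGaussian 𝕜) := by
  have hβ := betaDim_pos 𝕜
  have h1a : 0 < 1 + a := by linarith
  have hc := measurable_coordinates (𝕜 := 𝕜)
  have hdot : Measurable fun z : 𝕜 => dot b z := by
    simp_rw [dot_eq_inner]; fun_prop
  rw [lintegral_betaGaussian (by fun_prop), lintegral_betaGaussian (by fun_prop)]
  have hb : ((RCLike.re b : ℝ) : 𝕜) + (RCLike.im b : 𝕜) * RCLike.I = b := RCLike.re_add_im b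
  rcases betaDim_cases 𝕜 with ⟨hI, hβ1⟩ | ⟨hI, hβ2⟩
  · have hbim : RCLike.im b = 0 := by rw [← hb, hI]; simp
    simp only [hI, mul_zero, add_zero, lintegral_const, measure_univ, mul_one, hβ1] at hb ⊢
    have := lintegral_gaussianReal_tilt (σ := 1 / 1) (a := a) (b := RCLike.re b) (by norm_num) ha
      (f := fun t => f (t : 𝕜)) (by fun_prop)
    convert this using 3 with t
    · congr 2
      rw [dot_eq_re_im]
      simp
      ring
    · congr 2
      · rw [← RCLike.normSq_eq_def', RCLike.normSq_apply, hbim]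
        ring_nf
    · ext t
      congr 1
      push_cast
      conv_lhs => rw [← hb]
      ring
  · have hIm : (RCLike.I : 𝕜) ^ 2 = -1 := by
      rw [sq]
      rcases RCLike.I_mul_I (K := 𝕜) with h | h
      · rw [h] at hI; simp at hI
      · exact h
    have hnorm : ∀ s t : ℝ, ‖(s : 𝕜) + (t : 𝕜) * RCLike.I‖ ^ 2 = s ^ 2 + t ^ 2 := by
      intro s t
      rw [← RCLike.normSq_eq_def', RCLike.normSq_apply]
      simp [RCLike.mul_re, RCLike.mul_im, RCLike.I_re, hI]
      ring
    have hdots : ∀ s t : ℝ, dot b ((s : 𝕜) + (t : 𝕜) * RCLike.I)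
        = RCLike.re b * s + RCLike.im b * t := by
      intro s t
      rw [dot_eq_re_im]
      simp [RCLike.mul_re, RCLike.mul_im, RCLike.I_re, hI]
    have hnb : ‖b‖ ^ 2 = RCLike.re b ^ 2 + RCLike.im b ^ 2 := by
      rw [← RCLike.normSq_eq_def', RCLike.normSq_apply]; ring
    simp only [hnorm, hdots, hβ2]
    have hσ : (0 : ℝ) < 1 / 2 := by norm_num
    have inner1 : ∀ s : ℝ, ∫⁻ t, ENNReal.ofReal (Real.exp (-(2 / 2) * a * (s ^ 2 + t ^ 2)
          + 2 * (RCLike.re b * s + RCLike.im b * t))) * f ((s : 𝕜) + (t : 𝕜) * RCLike.I)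
          ∂(gaussianReal 0 (Real.toNNReal (1 / 2)))
        = ENNReal.ofReal (Real.exp (-(a * s ^ 2 / (2 * (1 / 2))) + RCLike.re b * s / (1 / 2))) *
          (ENNReal.ofReal ((1 + a) ^ (-(1 / 2) : ℝ) *
            Real.exp (RCLike.im b ^ 2 / (2 * (1 / 2) * (1 + a)))) *
          ∫⁻ t, f ((s : 𝕜) + ((√(1 / (1 + a)) * t + RCLike.im b / (1 + a) : ℝ) : 𝕜) * RCLike.I)
            ∂(gaussianReal 0 (Real.toNNReal (1 / 2)))) := by
      intro s
      rw [← lintegral_gaussianReal_tilt (σ := 1 / 2) (a := a) (b := RCLike.im b) hσ ha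
        (f := fun t => f ((s : 𝕜) + (t : 𝕜) * RCLike.I))
        (hf.comp (hc.comp (measurable_const.prodMk measurable_id))),
        ← lintegral_const_mul' _ _ (by simp)]
      refine lintegral_congr fun t => ?_
      rw [← mul_assoc, ← ENNReal.ofReal_mul (by positivity), ← Real.exp_add]
      congr 3
      ring
    simp only [inner1]
    rw [lintegral_gaussianReal_tilt (σ := 1 / 2) (a := a) (b := RCLike.re b) hσ ha
      (f := fun s => ENNReal.ofReal ((1 + a) ^ (-(1 / 2) : ℝ) *
            Real.exp (RCLike.im b ^ 2 / (2 * (1 / 2) * (1 + a)))) *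
          ∫⁻ t, f ((s : 𝕜) + ((√(1 / (1 + a)) * t + RCLike.im b / (1 + a) : ℝ) : 𝕜) * RCLike.I)
            ∂(gaussianReal 0 (Real.toNNReal (1 / 2))))]
    · rw [lintegral_const_mul' _ _ (by simp), ← mul_assoc,
        ← ENNReal.ofReal_mul (by positivity)]
      congr 2
      · rw [show ((1 + a) ^ (-(1 / 2) : ℝ) * Real.exp (RCLike.re b ^ 2 / (2 * (1 / 2) * (1 + a)))) *
            ((1 + a) ^ (-(1 / 2) : ℝ) * Real.exp (RCLike.im b ^ 2 / (2 * (1 / 2) * (1 + a))))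
            = ((1 + a) ^ (-(1 / 2) : ℝ) * (1 + a) ^ (-(1 / 2) : ℝ)) *
            (Real.exp (RCLike.re b ^ 2 / (2 * (1 / 2) * (1 + a))) *
            Real.exp (RCLike.im b ^ 2 / (2 * (1 / 2) * (1 + a)))) by ring,
          ← Real.exp_add, ← Real.rpow_add h1a, hnb]
        congr 2
        · norm_num
        · field_simp
      · ext s
        congr 1
        ext t
        congr 1
        push_cast
        conv_rhs => rw [← hb]
        ring
    · refine Measurable.const_mul ?_ _
      refine Measurable.lintegral_prod_right' (f := fun x : ℝ × ℝ => f ((x.1 : 𝕜) +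
        ((√(1 / (1 + a)) * x.2 + RCLike.im b / (1 + a) : ℝ) : 𝕜) * RCLike.I)) ?_
      have hm : Measurable fun x : ℝ × ℝ => (x.1, √(1 / (1 + a)) * x.2 + RCLike.im b / (1 + a)) := by
        fun_prop
      exact hf.comp (hc.comp hm)

theorem lintegral_exp_betaGaussian {a : ℝ} (ha : -1 < a) (b : 𝕜) :
    ∫⁻ z, ENNReal.ofReal (Real.exp (-(betaDim 𝕜 / 2) * a * ‖z‖ ^ 2 + betaDim 𝕜 * dot b z))
        ∂(betaGaussian 𝕜)
      = ENNReal.ofReal ((1 + a) ^ (-(betaDim 𝕜 / 2) : ℝ)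
          * Real.exp (betaDim 𝕜 * ‖b‖ ^ 2 / (2 * (1 + a)))) := by
  have := lintegral_betaGaussian_tilt ha b (f := fun _ => 1) measurable_const
  simpa using this

theorem lintegral_norm_sq_betaGaussian :
    ∫⁻ z, ENNReal.ofReal (‖z‖ ^ 2) ∂(betaGaussian 𝕜) = 1 := by
  have hβ := betaDim_pos 𝕜
  have hsq : ∫⁻ t : ℝ, ENNReal.ofReal (t ^ 2)
      ∂(gaussianReal 0 (Real.toNNReal (1 / betaDim 𝕜))) = ENNReal.ofReal (1 / betaDim 𝕜) := by
    have h2 : Integrable (fun t : ℝ => t ^ 2) (gaussianReal 0 (Real.toNNReal (1 / betaDim 𝕜))) :=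
      (memLp_id_gaussianReal 2).integrable_sq
    rw [← ofReal_integral_eq_lintegral_ofReal h2 (ae_of_all _ fun t => sq_nonneg t)]
    congr 1
    have := variance_fun_id_gaussianReal (μ := 0) (v := Real.toNNReal (1 / betaDim 𝕜))
    rw [variance_eq_integral (by fun_prop)] at this
    simp only [integral_id_gaussianReal, sub_zero] at this
    rw [this, Real.coe_toNNReal _ (by positivity)]
  rw [lintegral_betaGaussian (by fun_prop)]
  rcases betaDim_cases 𝕜 with ⟨hI, hβ1⟩ | ⟨hI, hβ2⟩
  · simpa [hI, hβ1] using hsq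
  · have hnorm : ∀ s t : ℝ, ENNReal.ofReal (‖(s : 𝕜) + (t : 𝕜) * RCLike.I‖ ^ 2)
        = ENNReal.ofReal (s ^ 2) + ENNReal.ofReal (t ^ 2) := by
      intro s t
      rw [← RCLike.normSq_eq_def', RCLike.normSq_apply,
        ← ENNReal.ofReal_add (by positivity) (by positivity)]
      simp [RCLike.mul_re, RCLike.mul_im, RCLike.I_re, hI, sq]
    simp_rw [hnorm]
    rw [hβ2] at hsq ⊢
    simp only [lintegral_add_right _ (measurable_const), lintegral_add_left measurable_const,
      lintegral_const, measure_univ, mul_one, hsq]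
    rw [← ENNReal.ofReal_add (by norm_num) (by norm_num)]
    norm_num

theorem integrable_norm_sq_betaGaussian :
    Integrable (fun z : 𝕜 => ‖z‖ ^ 2) (betaGaussian 𝕜) := by
  refine ⟨by fun_prop, ?_⟩
  rw [hasFiniteIntegral_iff_ofReal (ae_of_all _ fun z => sq_nonneg _),
    lintegral_norm_sq_betaGaussian]
  exact ENNReal.one_lt_top

theorem secondMoment_betaGaussian : secondMoment (betaGaussian 𝕜) = 1 := by
  rw [secondMoment, integral_eq_lintegral_of_nonneg_ae (ae_of_all _ fun z => sq_nonneg _)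
    (by fun_prop), lintegral_norm_sq_betaGaussian]
  simp

theorem Zprior_betaGaussian (b : 𝕜) {a : ℝ} (ha : -1 < a) :
    Zprior (betaGaussian 𝕜) b a = (1 + a) ^ (-(betaDim 𝕜 / 2) : ℝ)
          * Real.exp (betaDim 𝕜 * ‖b‖ ^ 2 / (2 * (1 + a))) := by
  have h1a : 0 < 1 + a := by linarith
  have hdot : Measurable fun z : 𝕜 => dot b z := by
    simp_rw [dot_eq_inner]; fun_prop
  rw [Zprior, integral_eq_lintegral_of_nonneg_ae (ae_of_all _ fun z => by positivity)
    (by fun_prop), lintegral_exp_betaGaussian ha, ENNReal.toReal_ofReal (by positivity)]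

end Gaussian

/-! ### Quadratic forms of Gaussian vectors -/

section QuadraticForms

open scoped ComplexOrder

variable {𝕜 : Type*} [RCLike 𝕜] {ι : Type*} [Fintype ι]

theorem lintegral_pi_prod [DecidableEq ι] {X : Type*} [MeasurableSpace X] (μ : Measure X) [IsProbabilityMeasure μ]
    {f : ι → X → ℝ≥0∞} (hf : ∀ i, Measurable (f i)) :
    ∫⁻ x, ∏ i, f i (x i) ∂(Measure.pi fun _ : ι => μ) = ∏ i, ∫⁻ x, f i x ∂μ := by
  have hi : iIndepFun (fun i (x : ι → X) => f i (x i)) (Measure.pi fun _ : ι => μ) :=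
    iIndepFun_pi (fun i => (hf i).aemeasurable)
  have h := lintegral_prod_eq_prod_lintegral_of_indepFun Finset.univ _ hi
    (fun i => (hf i).comp (measurable_pi_apply i))
  rw [h]
  refine Finset.prod_congr rfl fun i _ => ?_
  rw [← lintegral_map (hf i) (measurable_pi_apply i), Measure.pi_map_eval]
  simp

/-- The characteristic function of the product depends only on the Euclidean norm of its argument,
which `Uᴴ` preserves. -/
theorem map_mulVec_pi_betaGaussian [DecidableEq ι] (U : Matrix ι ι 𝕜) (hU : U * Uᴴ = 1) :
    (Measure.pi fun _ : ι => betaGaussian 𝕜).map (fun x => U *ᵥ x)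
      = Measure.pi fun _ : ι => betaGaussian 𝕜 := by
  have hm : Measurable (fun x : ι → 𝕜 => U *ᵥ x) := by
    have : Continuous (fun x : ι → 𝕜 => U *ᵥ x) := by fun_prop
    exact this.measurable
  have : IsProbabilityMeasure ((Measure.pi fun _ : ι => betaGaussian 𝕜).map (fun x => U *ᵥ x)) :=
    Measure.isProbabilityMeasure_map hm.aemeasurable
  -- Characteristic functions require an inner product, so both laws are transported to the `ℓ²`
  -- norm and back.
  have hinj : ∀ μ : Measure (ι → 𝕜), μ = (μ.map (WithLp.toLp 2)).map (WithLp.ofLp) := by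
    intro μ
    rw [Measure.map_map (by fun_prop) (by fun_prop)]
    exact Measure.map_id.symm
  have hinner : ∀ x y : ι → 𝕜, inner ℝ (WithLp.toLp 2 x : PiLp 2 fun _ : ι => 𝕜) (WithLp.toLp 2 y)
      = RCLike.re (star x ⬝ᵥ y) := by
    intro x y
    rw [PiLp.inner_apply, dotProduct, map_sum]
    refine Finset.sum_congr rfl fun i _ => ?_
    rw [← dot_eq_inner]
    rfl
  refine (hinj _).trans (Eq.trans ?_ (hinj _).symm)
  congr 1
  rw [Measure.map_map (by fun_prop) hm]
  have : IsProbabilityMeasure ((Measure.pi fun _ : ι => betaGaussian 𝕜).map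
      ((WithLp.toLp 2 : (ι → 𝕜) → PiLp 2 fun _ : ι => 𝕜) ∘ fun x => U *ᵥ x)) :=
    Measure.isProbabilityMeasure_map
      (((by fun_prop : Measurable (WithLp.toLp 2 : (ι → 𝕜) → PiLp 2 fun _ : ι => 𝕜)).comp
        hm).aemeasurable)
  have : IsProbabilityMeasure ((Measure.pi fun _ : ι => betaGaussian 𝕜).map
      (WithLp.toLp 2 : (ι → 𝕜) → PiLp 2 fun _ : ι => 𝕜)) :=
    Measure.isProbabilityMeasure_map (by fun_prop)
  refine Measure.ext_of_charFun ?_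
  ext t
  have hleft : charFun ((Measure.pi fun _ : ι => betaGaussian 𝕜).map
      ((WithLp.toLp 2 : (ι → 𝕜) → PiLp 2 fun _ : ι => 𝕜) ∘ fun x => U *ᵥ x)) t
      = charFun ((Measure.pi fun _ : ι => betaGaussian 𝕜).map
      (WithLp.toLp 2 : (ι → 𝕜) → PiLp 2 fun _ : ι => 𝕜)) (WithLp.toLp 2 (Uᴴ *ᵥ t.ofLp)) := by
    rw [charFun_apply, charFun_apply, integral_map, integral_map]
    · refine integral_congr_ae (ae_of_all _ fun x => ?_)
      have ht : t = WithLp.toLp 2 t.ofLp := rfl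
      simp only [Function.comp]
      rw [ht, hinner, hinner, Matrix.star_mulVec, ← Matrix.dotProduct_mulVec]
    · fun_prop
    · exact Continuous.aestronglyMeasurable (by fun_prop)
    · exact (((by fun_prop : Measurable (WithLp.toLp 2 : (ι → 𝕜) → PiLp 2 fun _ : ι => 𝕜)).comp
        hm).aemeasurable)
    · exact Continuous.aestronglyMeasurable (by fun_prop)
  rw [hleft, charFun_pi, charFun_pi]
  simp only [charFun_betaGaussian]
  rw [← Complex.exp_sum, ← Complex.exp_sum, Finset.sum_neg_distrib, Finset.sum_neg_distrib,
    ← Complex.ofReal_sum, ← Complex.ofReal_sum, ← Finset.sum_div, ← Finset.sum_div]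
  congr 4
  have hnorm : ∀ x : ι → 𝕜, ∑ i, ‖x i‖ ^ 2 = RCLike.re (star x ⬝ᵥ x) := by
    intro x
    rw [dotProduct, map_sum]
    refine Finset.sum_congr rfl fun i _ => ?_
    rw [Pi.star_apply, RCLike.star_def, RCLike.conj_mul, ← RCLike.ofReal_pow, RCLike.ofReal_re]
  rw [hnorm, hnorm, Matrix.star_mulVec, ← Matrix.dotProduct_mulVec, Matrix.mulVec_mulVec,
    Matrix.conjTranspose_conjTranspose, hU, Matrix.one_mulVec]

variable [DecidableEq ι]

theorem conj_eigenvectorUnitary {H : Matrix ι ι 𝕜} (hH : H.IsHermitian) :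
    H = (hH.eigenvectorUnitary : Matrix ι ι 𝕜) *
      Matrix.diagonal (fun i => (hH.eigenvalues i : 𝕜)) * (hH.eigenvectorUnitary : Matrix ι ι 𝕜)ᴴ := by
  conv_lhs => rw [hH.spectral_theorem]
  rw [Unitary.conjStarAlgAut_apply]
  rfl

theorem eigenvectorUnitary_mul_conjTranspose {H : Matrix ι ι 𝕜} (hH : H.IsHermitian) :
    (hH.eigenvectorUnitary : Matrix ι ι 𝕜) * (hH.eigenvectorUnitary : Matrix ι ι 𝕜)ᴴ = 1 :=
  Unitary.mul_star_self_of_mem hH.eigenvectorUnitary.2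

theorem conjTranspose_mul_eigenvectorUnitary {H : Matrix ι ι 𝕜} (hH : H.IsHermitian) :
    (hH.eigenvectorUnitary : Matrix ι ι 𝕜)ᴴ * (hH.eigenvectorUnitary : Matrix ι ι 𝕜) = 1 :=
  Unitary.star_mul_self_of_mem hH.eigenvectorUnitary.2

theorem re_quadForm_eq_sum {H : Matrix ι ι 𝕜} (hH : H.IsHermitian) (x : ι → 𝕜) :
    RCLike.re (star x ⬝ᵥ (H *ᵥ x)) = ∑ i, hH.eigenvalues i *
      ‖((hH.eigenvectorUnitary : Matrix ι ι 𝕜)ᴴ *ᵥ x) i‖ ^ 2 := by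
  conv_lhs => rw [conj_eigenvectorUnitary hH]
  rw [← Matrix.mulVec_mulVec, ← Matrix.mulVec_mulVec, Matrix.dotProduct_mulVec]
  set U := (hH.eigenvectorUnitary : Matrix ι ι 𝕜)
  have : star x ᵥ* U = star (Uᴴ *ᵥ x) := by
    rw [Matrix.star_mulVec, Matrix.conjTranspose_conjTranspose]
  rw [this, dotProduct, map_sum]
  refine Finset.sum_congr rfl fun i _ => ?_
  rw [Matrix.mulVec_diagonal, Pi.star_apply, mul_left_comm, RCLike.star_def, RCLike.conj_mul,
    ← RCLike.ofReal_pow, ← RCLike.ofReal_mul, RCLike.ofReal_re]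

theorem lintegral_quadForm {H : Matrix ι ι 𝕜} (hH : H.IsHermitian) {f : ℝ → ℝ≥0∞}
    (hf : Measurable f) :
    ∫⁻ x, f (RCLike.re (star x ⬝ᵥ (H *ᵥ x))) ∂(Measure.pi fun _ : ι => betaGaussian 𝕜)
      = ∫⁻ x, f (∑ i, hH.eigenvalues i * ‖x i‖ ^ 2)
          ∂(Measure.pi fun _ : ι => betaGaussian 𝕜) := by
  have hm : Measurable (fun x : ι → 𝕜 => (hH.eigenvectorUnitary : Matrix ι ι 𝕜)ᴴ *ᵥ x) := by
    have : Continuous (fun x : ι → 𝕜 => (hH.eigenvectorUnitary : Matrix ι ι 𝕜)ᴴ *ᵥ x) := by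
      fun_prop
    exact this.measurable
  conv_rhs => rw [← map_mulVec_pi_betaGaussian (hH.eigenvectorUnitary : Matrix ι ι 𝕜)ᴴ
    (by rw [Matrix.conjTranspose_conjTranspose]; exact conjTranspose_mul_eigenvectorUnitary hH)]
  rw [lintegral_map (by fun_prop) hm]
  simp_rw [re_quadForm_eq_sum hH]

theorem det_one_add_smul_eq_prod {H : Matrix ι ι 𝕜} (hH : H.IsHermitian) (c : ℝ) :
    (1 + c • H).det = ((∏ i, (1 + c * hH.eigenvalues i) : ℝ) : 𝕜) := by
  have hU := eigenvectorUnitary_mul_conjTranspose hH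
  set U := (hH.eigenvectorUnitary : Matrix ι ι 𝕜) with hUdef
  have e : 1 + c • H = U * Matrix.diagonal (fun i => ((1 + c * hH.eigenvalues i : ℝ) : 𝕜)) * Uᴴ := by
    have : Matrix.diagonal (fun i => ((1 + c * hH.eigenvalues i : ℝ) : 𝕜))
        = 1 + c • Matrix.diagonal (fun i => (hH.eigenvalues i : 𝕜)) := by
      rw [← Matrix.diagonal_one, ← Matrix.diagonal_smul, Matrix.diagonal_add]
      congr 1
      ext i
      simp [RCLike.real_smul_eq_coe_mul]
    rw [this, mul_add, add_mul, mul_one, hU, mul_smul_comm, smul_mul_assoc, hUdef,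
      ← conj_eigenvectorUnitary hH]
  rw [e, Matrix.det_mul, Matrix.det_mul, mul_right_comm, ← Matrix.det_mul, hU, Matrix.det_one,
    one_mul, Matrix.det_diagonal, RCLike.ofReal_prod]

/-- Unitary invariance diagonalises `H`; the integral then factors into one-dimensional Gaussian
integrals, one per eigenvalue. -/
theorem lintegral_exp_quadForm {H : Matrix ι ι 𝕜} (hH : H.PosSemidef) {c : ℝ} (hc : 0 ≤ c) :
    ∫⁻ x, ENNReal.ofReal (Real.exp (-(betaDim 𝕜 / 2) * (c * RCLike.re (star x ⬝ᵥ (H *ᵥ x)))))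
        ∂(Measure.pi fun _ : ι => betaGaussian 𝕜)
      = ENNReal.ofReal (RCLike.re (1 + c • H).det ^ (-(betaDim 𝕜 / 2))) := by
  have h0 := hH.eigenvalues_nonneg
  rw [lintegral_quadForm hH.1 (f := fun r => ENNReal.ofReal (Real.exp (-(betaDim 𝕜 / 2) * (c * r))))
    (by fun_prop), det_one_add_smul_eq_prod hH.1, RCLike.ofReal_re,
    ← Real.finsetProd_rpow _ _ (fun i _ => by have := mul_nonneg hc (h0 i); linarith),
    ENNReal.ofReal_prod_of_nonneg (fun i _ => Real.rpow_nonneg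
      (by have := mul_nonneg hc (h0 i); linarith) _)]
  have : ∀ x : ι → 𝕜, ENNReal.ofReal (Real.exp (-(betaDim 𝕜 / 2) *
      (c * ∑ i, hH.1.eigenvalues i * ‖x i‖ ^ 2)))
      = ∏ i, (fun z : 𝕜 => ENNReal.ofReal (Real.exp (-(betaDim 𝕜 / 2) *
        (c * hH.1.eigenvalues i) * ‖z‖ ^ 2))) (x i) := by
    intro x
    rw [← ENNReal.ofReal_prod_of_nonneg (fun i _ => (Real.exp_pos _).le), ← Real.exp_sum]
    congr 2
    rw [Finset.mul_sum, Finset.mul_sum]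
    exact Finset.sum_congr rfl fun i _ => by ring
  simp_rw [this]
  rw [lintegral_pi_prod (f := fun i (z : 𝕜) => ENNReal.ofReal (Real.exp (-(betaDim 𝕜 / 2) *
        (c * hH.1.eigenvalues i) * ‖z‖ ^ 2))) _ (fun i => by fun_prop)]
  refine Finset.prod_congr rfl fun i _ => ?_
  have := lintegral_exp_betaGaussian (𝕜 := 𝕜) (a := c * hH.1.eigenvalues i)
    (by have := mul_nonneg hc (h0 i); linarith) 0
  simpa [dot] using this

theorem lintegral_re_quadForm {H : Matrix ι ι 𝕜} (hH : H.PosSemidef) :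
    ∫⁻ x, ENNReal.ofReal (RCLike.re (star x ⬝ᵥ (H *ᵥ x)))
        ∂(Measure.pi fun _ : ι => betaGaussian 𝕜) = ENNReal.ofReal (RCLike.re H.trace) := by
  have h0 := hH.eigenvalues_nonneg
  rw [lintegral_quadForm hH.1 (f := fun r => ENNReal.ofReal r) (by fun_prop),
    hH.1.trace_eq_sum_eigenvalues, ← RCLike.ofReal_sum, RCLike.ofReal_re,
    ENNReal.ofReal_sum_of_nonneg (fun i _ => h0 i)]
  have : ∀ x : ι → 𝕜, ENNReal.ofReal (∑ i, hH.1.eigenvalues i * ‖x i‖ ^ 2)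
      = ∑ i, ENNReal.ofReal (hH.1.eigenvalues i) * ENNReal.ofReal (‖x i‖ ^ 2) := by
    intro x
    rw [ENNReal.ofReal_sum_of_nonneg (fun i _ => mul_nonneg (h0 i) (sq_nonneg _))]
    exact Finset.sum_congr rfl fun i _ => ENNReal.ofReal_mul (h0 i)
  simp_rw [this]
  rw [lintegral_finsetSum _ (fun i _ => by fun_prop)]
  refine Finset.sum_congr rfl fun i _ => ?_
  rw [lintegral_const_mul _ (by fun_prop)]
  have : ∫⁻ x : ι → 𝕜, ENNReal.ofReal (‖x i‖ ^ 2) ∂(Measure.pi fun _ : ι => betaGaussian 𝕜) = 1 := by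
    rw [← lintegral_map (f := fun z : 𝕜 => ENNReal.ofReal (‖z‖ ^ 2)) (by fun_prop)
      (measurable_pi_apply i), Measure.pi_map_eval]
    simpa using lintegral_norm_sq_betaGaussian (𝕜 := 𝕜)
  rw [this, mul_one]

end QuadraticForms

/-! ### Determinants of Wishart matrices: finite size bounds -/

section Wishart

open scoped ComplexOrder

variable {𝕜 : Type*} [RCLike 𝕜] {ι κ : Type*} [Fintype κ]

/-- The contribution `r† r` of the row `r = w b` to `(W b)† (W b)`. -/
def rowGram (b : Matrix κ ι 𝕜) (w : κ → 𝕜) : Matrix ι ι 𝕜 :=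
  Matrix.vecMulVec (star (w ᵥ* b)) (w ᵥ* b)

theorem posSemidef_rowGram [Finite ι] (b : Matrix κ ι 𝕜) (w : κ → 𝕜) : (rowGram b w).PosSemidef :=
  Matrix.posSemidef_vecMulVec_star_self _

theorem continuous_rowGram (b : Matrix κ ι 𝕜) : Continuous (rowGram b) := by
  unfold rowGram Matrix.vecMulVec
  fun_prop

theorem conjTranspose_mul_self_eq_sum_rowGram {m : ℕ} (b : Matrix κ ι 𝕜)
    (w : Matrix (Fin m) κ 𝕜) : (w * b)ᴴ * (w * b) = ∑ μ, rowGram b (w μ) := by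
  ext i j
  rw [Matrix.sum_apply, Matrix.mul_apply]
  rfl

theorem dotProduct_mul_star (P : Matrix κ κ 𝕜) (w : κ → 𝕜) :
    w ⬝ᵥ (P *ᵥ star w) = star w ⬝ᵥ (Pᵀ *ᵥ w) := by
  rw [Matrix.mulVec_transpose, Matrix.dotProduct_mulVec, dotProduct_comm]

theorem dotProduct_vecMulVec_mulVec (x a c y : κ → 𝕜) :
    x ⬝ᵥ (Matrix.vecMulVec a c *ᵥ y) = (x ⬝ᵥ a) * (c ⬝ᵥ y) := by
  rw [Matrix.vecMulVec_mulVec, dotProduct_smul, op_smul_eq_mul]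

variable [Fintype ι]

theorem trace_rowGram (b : Matrix κ ι 𝕜) (w : κ → 𝕜) :
    (rowGram b w).trace = star w ⬝ᵥ ((b * bᴴ)ᵀ *ᵥ w) := by
  rw [rowGram, Matrix.trace_vecMulVec, ← dotProduct_mul_star, ← Matrix.mulVec_mulVec,
    Matrix.dotProduct_mulVec, dotProduct_comm, Matrix.star_vecMul]

theorem quadForm_rowGram (b : Matrix κ ι 𝕜) (w : κ → 𝕜) (g : ι → 𝕜) :
    star g ⬝ᵥ (rowGram b w *ᵥ g) =
      star w ⬝ᵥ (Matrix.vecMulVec (star (b *ᵥ g)) (b *ᵥ g) *ᵥ w) := by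
  rw [rowGram, dotProduct_vecMulVec_mulVec, dotProduct_vecMulVec_mulVec,
    Matrix.star_dotProduct_star, Matrix.star_dotProduct_star, ← Matrix.dotProduct_mulVec,
    dotProduct_comm w]

variable [DecidableEq ι] [DecidableEq κ]

theorem det_add_smul_vecMulVec {A : Matrix ι ι 𝕜} (hA : IsUnit A.det) (c : ℝ) (u v : ι → 𝕜) :
    (A + c • Matrix.vecMulVec u v).det = A.det * (1 + c • (v ⬝ᵥ (A⁻¹ *ᵥ u))) := by
  have h := Matrix.det_add_replicateCol_mul_replicateRow (ι := Unit) hA (c • u) v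
  rw [Matrix.det_unique (n := Unit), Matrix.add_apply, Matrix.one_apply_eq] at h
  have e1 : c • Matrix.vecMulVec u v
      = Matrix.replicateCol Unit (c • u) * Matrix.replicateRow Unit v := by
    rw [← Matrix.vecMulVec_eq, Matrix.smul_vecMulVec]
  rw [e1, h]
  congr 2
  rw [Matrix.mul_assoc, ← Matrix.replicateCol_mulVec, Matrix.mulVec_smul]
  simp [Matrix.mul_apply, dotProduct, Finset.smul_sum]

/-- Because `1 - A⁻¹ = A⁻¹ (A - 1) A⁻¹ + (1 - A⁻¹)²`. -/
theorem posSemidef_one_sub_inv {A : Matrix ι ι 𝕜} (hA : A.PosDef) (h1 : (A - 1).PosSemidef) :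
    (1 - A⁻¹).PosSemidef := by
  have hu : IsUnit A.det := (Matrix.isUnit_iff_isUnit_det A).mp hA.isUnit
  have hi : A⁻¹.IsHermitian := hA.inv.isHermitian
  have h2 : (A⁻¹ * (A - 1) * A⁻¹ᴴ).PosSemidef := h1.mul_mul_conjTranspose_same _
  have h3 : ((1 - A⁻¹)ᴴ * (1 - A⁻¹)).PosSemidef := Matrix.posSemidef_conjTranspose_mul_self _
  have := h2.add h3
  rw [hi.eq, Matrix.conjTranspose_sub, hi.eq, Matrix.conjTranspose_one] at this
  convert this using 1
  have h4 := Matrix.nonsing_inv_mul A hu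
  rw [mul_sub, h4]
  noncomm_ring

/-- This is `1 + z ≤ e^z` at `z = -1 + d/c + d x`. The free parameter `d` is the exponential rate;
the prefactor produces the `logGap` term of the limiting exponent. -/
theorem one_add_le_exp_mul {x c d : ℝ} (hc : 0 < c) (hd : 0 < d) :
    1 + c * x ≤ c / d * Real.exp (-1 + d / c) * Real.exp (d * x) := by
  have h := Real.add_one_le_exp (-1 + d / c + d * x)
  rw [mul_assoc, ← Real.exp_add]
  calc 1 + c * x = c / d * (-1 + d / c + d * x + 1) := by field_simp; ring
    _ ≤ _ := by gcongr

/-- From `ln(1 + z) ≥ z/(1 + z)` with `z = Δ e`. For small `Δ`, the regime of use, the loss `1 + Δ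
τ` is negligible. -/
theorem exp_mul_le_one_add {e τ Δ : ℝ} (he : 0 ≤ e) (hτ : e ≤ τ) (hΔ : 0 < Δ) :
    Real.exp (Δ / (1 + Δ * τ) * e) ≤ 1 + Δ * e := by
  have h1 : 0 < 1 + Δ * e := by positivity
  have h2 : Δ / (1 + Δ * τ) * e ≤ Δ * e / (1 + Δ * e) := by
    rw [div_mul_eq_mul_div]
    gcongr
  have h3 := Real.add_one_le_exp (-(Δ * e / (1 + Δ * e)))
  have h4 : -(Δ * e / (1 + Δ * e)) + 1 = (1 + Δ * e)⁻¹ := by field_simp; ring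
  rw [h4, Real.exp_neg, inv_le_inv₀ h1 (Real.exp_pos _)] at h3
  exact (Real.exp_le_exp.mpr h2).trans h3

theorem re_det_pos {A : Matrix ι ι 𝕜} (hA : A.PosDef) :
    0 < RCLike.re A.det ∧ A.det = ((RCLike.re A.det : ℝ) : 𝕜) := by
  have := RCLike.pos_iff.mp hA.det_pos
  refine ⟨this.1, ?_⟩
  conv_lhs => rw [← RCLike.re_add_im A.det, this.2]
  simp

/-- By the Sylvester identity the quotient of determinants is `∏ (1 + Δ eᵢ)` over the eigenvalues
`eᵢ` of `b A⁻¹ b†`. Since `A ≥ 1`, each `eᵢ` is at most `τ`, and `exp_mul_le_one_add` applies factor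
by factor. -/
theorem exp_mul_re_det_le {A : Matrix ι ι 𝕜} (hA : A.PosDef) (h1 : (A - 1).PosSemidef)
    (b : Matrix κ ι 𝕜) {τ Δ : ℝ} (hΔ : 0 < Δ)
    (hb : ∀ y : κ → 𝕜, RCLike.re (star (bᴴ *ᵥ y) ⬝ᵥ (bᴴ *ᵥ y)) ≤ τ * RCLike.re (star y ⬝ᵥ y)) :
    RCLike.re A.det * Real.exp (Δ / (1 + Δ * τ) * RCLike.re (b * A⁻¹ * bᴴ).trace)
      ≤ RCLike.re (A + Δ • (bᴴ * b)).det := by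
  have hu : IsUnit A.det := (Matrix.isUnit_iff_isUnit_det A).mp hA.isUnit
  have hP : (b * A⁻¹ * bᴴ).PosSemidef := hA.inv.posSemidef.mul_mul_conjTranspose_same b
  have hdet : (A + Δ • (bᴴ * b)).det = A.det * (1 + Δ • (b * A⁻¹ * bᴴ)).det := by
    have e : A + Δ • (bᴴ * b) = A * (1 + (Δ • A⁻¹ * bᴴ) * b) := by
      rw [mul_add, mul_one, ← Matrix.mul_assoc, ← Matrix.mul_assoc, Matrix.mul_smul,
        Matrix.mul_nonsing_inv _ hu, Matrix.smul_mul, Matrix.smul_mul, Matrix.one_mul]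
    rw [e, Matrix.det_mul, Matrix.det_one_add_mul_comm]
    simp [Matrix.mul_assoc]
  rw [hdet, det_one_add_smul_eq_prod hP.1, (re_det_pos hA).2, ← RCLike.ofReal_mul,
    RCLike.ofReal_re, RCLike.ofReal_re]
  refine mul_le_mul_of_nonneg_left ?_ (re_det_pos hA).1.le
  rw [hP.1.trace_eq_sum_eigenvalues, ← RCLike.ofReal_sum, RCLike.ofReal_re, Finset.mul_sum,
    Real.exp_sum]
  refine Finset.prod_le_prod (fun i _ => (Real.exp_pos _).le) fun i _ => ?_
  refine exp_mul_le_one_add (hP.eigenvalues_nonneg i) ?_ hΔ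
  -- With `z` the unit eigenvector, the eigenvalue is `(b†z)† A⁻¹ (b†z) ≤ |b†z|² ≤ τ`.
  have he := hP.1.eigenvalues_eq i
  set z : κ → 𝕜 := (hP.1.eigenvectorBasis i).ofLp with hz
  have hz1 : RCLike.re (star z ⬝ᵥ z) = 1 := by
    have h := hP.1.eigenvectorBasis.orthonormal.1 i
    have h2 := inner_self_eq_norm_sq_to_K (𝕜 := 𝕜) (hP.1.eigenvectorBasis i)
    rw [h, EuclideanSpace.inner_eq_star_dotProduct, dotProduct_comm] at h2
    rw [hz, h2]; simp
  have h5 := (RCLike.nonneg_iff.mp ((posSemidef_one_sub_inv hA h1).dotProduct_mulVec_nonneg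
    (bᴴ *ᵥ z))).1
  rw [Matrix.sub_mulVec, Matrix.one_mulVec, dotProduct_sub, map_sub] at h5
  have h6 : star z ⬝ᵥ ((b * A⁻¹ * bᴴ) *ᵥ z) = star (bᴴ *ᵥ z) ⬝ᵥ (A⁻¹ *ᵥ (bᴴ *ᵥ z)) := by
    rw [← Matrix.mulVec_mulVec, ← Matrix.mulVec_mulVec, Matrix.dotProduct_mulVec,
      Matrix.star_mulVec, Matrix.conjTranspose_conjTranspose]
  have h7 := hb z
  rw [hz1, mul_one] at h7
  rw [he, h6]
  linarith

/-- Averaging a determinant over one Gaussian row. -/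
theorem lintegral_det_add_rowGram_le {A : Matrix ι ι 𝕜} (hA : A.PosDef) (h1 : (A - 1).PosSemidef)
    (b : Matrix κ ι 𝕜) {τ Δ c : ℝ} (hτ : 0 ≤ τ) (hΔ : 0 < Δ) (hc : 0 < c)
    (hb : ∀ y : κ → 𝕜, RCLike.re (star (bᴴ *ᵥ y) ⬝ᵥ (bᴴ *ᵥ y)) ≤ τ * RCLike.re (star y ⬝ᵥ y)) :
    ∫⁻ w, ENNReal.ofReal (RCLike.re (A + c • rowGram b w).det)
        ∂(Measure.pi fun _ : κ => betaGaussian 𝕜)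
      ≤ ENNReal.ofReal (c / (Δ / (1 + Δ * τ)) * Real.exp (-1 + Δ / (1 + Δ * τ) / c)) *
        ENNReal.ofReal (RCLike.re (A + Δ • (bᴴ * b)).det) := by
  have hu : IsUnit A.det := (Matrix.isUnit_iff_isUnit_det A).mp hA.isUnit
  have hP : (b * A⁻¹ * bᴴ).PosSemidef := hA.inv.posSemidef.mul_mul_conjTranspose_same b
  have hPT := hP.transpose
  have hd := re_det_pos hA
  have hq : ∀ w : κ → 𝕜, 0 ≤ RCLike.re (star w ⬝ᵥ ((b * A⁻¹ * bᴴ)ᵀ *ᵥ w)) := fun w =>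
    (RCLike.nonneg_iff.mp (hPT.dotProduct_mulVec_nonneg w)).1
  have e : ∀ w : κ → 𝕜, RCLike.re (A + c • rowGram b w).det
      = RCLike.re A.det * (1 + c * RCLike.re (star w ⬝ᵥ ((b * A⁻¹ * bᴴ)ᵀ *ᵥ w))) := by
    intro w
    rw [rowGram, det_add_smul_vecMulVec hu]
    have : (w ᵥ* b) ⬝ᵥ (A⁻¹ *ᵥ star (w ᵥ* b)) = star w ⬝ᵥ ((b * A⁻¹ * bᴴ)ᵀ *ᵥ w) := by
      rw [← dotProduct_mul_star, ← Matrix.mulVec_mulVec, ← Matrix.mulVec_mulVec,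
        Matrix.dotProduct_mulVec w, Matrix.star_vecMul]
    rw [this, hd.2, RCLike.re_ofReal_mul, map_add, RCLike.smul_re, RCLike.one_re,
      RCLike.ofReal_re]
  simp_rw [e]
  have e2 : ∀ w : κ → 𝕜, ENNReal.ofReal
      (RCLike.re A.det * (1 + c * RCLike.re (star w ⬝ᵥ ((b * A⁻¹ * bᴴ)ᵀ *ᵥ w))))
      = ENNReal.ofReal (RCLike.re A.det) * (1 + ENNReal.ofReal c *
        ENNReal.ofReal (RCLike.re (star w ⬝ᵥ ((b * A⁻¹ * bᴴ)ᵀ *ᵥ w)))) := by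
    intro w
    rw [ENNReal.ofReal_mul hd.1.le, ENNReal.ofReal_add zero_le_one (mul_nonneg hc.le (hq w)),
      ENNReal.ofReal_mul hc.le, ENNReal.ofReal_one]
  simp_rw [e2]
  have hmeas : Measurable fun w : κ → 𝕜 =>
      ENNReal.ofReal (RCLike.re (star w ⬝ᵥ ((b * A⁻¹ * bᴴ)ᵀ *ᵥ w))) := by
    have : Continuous fun w : κ → 𝕜 => RCLike.re (star w ⬝ᵥ ((b * A⁻¹ * bᴴ)ᵀ *ᵥ w)) := by
      fun_prop
    exact this.measurable.ennreal_ofReal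
  rw [lintegral_const_mul' _ _ ENNReal.ofReal_ne_top, lintegral_add_left measurable_const,
    lintegral_const_mul' _ _ ENNReal.ofReal_ne_top, lintegral_re_quadForm hPT, lintegral_const,
    measure_univ, mul_one, Matrix.trace_transpose]
  have htr : 0 ≤ RCLike.re (b * A⁻¹ * bᴴ).trace := (RCLike.nonneg_iff.mp hP.trace_nonneg).1
  rw [← ENNReal.ofReal_one, ← ENNReal.ofReal_mul hc.le,
    ← ENNReal.ofReal_add zero_le_one (by positivity), ← ENNReal.ofReal_mul hd.1.le,
    ← ENNReal.ofReal_mul (by positivity)]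
  refine ENNReal.ofReal_le_ofReal ?_
  -- The row average is exactly `det A` times an affine function of the trace. Bounding the affine
  -- function by an exponential allows it to be absorbed into the determinant of `A + Δ b†b`.
  calc RCLike.re A.det * (1 + c * RCLike.re (b * A⁻¹ * bᴴ).trace)
      ≤ RCLike.re A.det * (c / (Δ / (1 + Δ * τ)) * Real.exp (-1 + Δ / (1 + Δ * τ) / c) *
        Real.exp (Δ / (1 + Δ * τ) * RCLike.re (b * A⁻¹ * bᴴ).trace)) :=
        mul_le_mul_of_nonneg_left (one_add_le_exp_mul hc (by positivity)) hd.1.le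
    _ = c / (Δ / (1 + Δ * τ)) * Real.exp (-1 + Δ / (1 + Δ * τ) / c) * (RCLike.re A.det *
        Real.exp (Δ / (1 + Δ * τ) * RCLike.re (b * A⁻¹ * bᴴ).trace)) := by ring
    _ ≤ _ := mul_le_mul_of_nonneg_left (exp_mul_re_det_le hA h1 b hΔ hb) (by positivity)

/-- Averaging a determinant over all the rows of a Gaussian matrix. -/
theorem lintegral_det_add_sum_rowGram_le (b : Matrix κ ι 𝕜) {τ Δ c : ℝ} (hτ : 0 ≤ τ) (hΔ : 0 < Δ)
    (hc : 0 < c)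
    (hb : ∀ y : κ → 𝕜, RCLike.re (star (bᴴ *ᵥ y) ⬝ᵥ (bᴴ *ᵥ y)) ≤ τ * RCLike.re (star y ⬝ᵥ y))
    (m : ℕ) {A : Matrix ι ι 𝕜} (hA : A.PosDef) (h1 : (A - 1).PosSemidef) :
    ∫⁻ w, ENNReal.ofReal (RCLike.re (A + c • ∑ μ, rowGram b (w μ)).det)
        ∂(Measure.pi fun _ : Fin m => Measure.pi fun _ : κ => betaGaussian 𝕜)
      ≤ ENNReal.ofReal (c / (Δ / (1 + Δ * τ)) * Real.exp (-1 + Δ / (1 + Δ * τ) / c)) ^ m *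
        ENNReal.ofReal (RCLike.re (A + (m * Δ) • (bᴴ * b)).det) := by
  have hc0 : Continuous (rowGram b) := continuous_rowGram b
  induction m generalizing A with
  | zero => simp
  | succ m ih =>
    set K := ENNReal.ofReal (c / (Δ / (1 + Δ * τ)) * Real.exp (-1 + Δ / (1 + Δ * τ) / c))
    have hmp := measurePreserving_piFinSuccAbove
      (fun _ : Fin (m + 1) => Measure.pi fun _ : κ => betaGaussian 𝕜) 0
    have hf : Measurable fun x : (κ → 𝕜) × (Fin m → κ → 𝕜) => ENNReal.ofReal
        (RCLike.re (A + c • rowGram b x.1 + c • ∑ μ, rowGram b (x.2 μ)).det) := by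
      have : Continuous fun x : (κ → 𝕜) × (Fin m → κ → 𝕜) =>
        RCLike.re (A + c • rowGram b x.1 + c • ∑ μ, rowGram b (x.2 μ)).det := by fun_prop
      exact this.measurable.ennreal_ofReal
    have e : ∀ w : Fin (m + 1) → κ → 𝕜,
        ENNReal.ofReal (RCLike.re (A + c • ∑ μ, rowGram b (w μ)).det)
        = (fun x : (κ → 𝕜) × (Fin m → κ → 𝕜) => ENNReal.ofReal
        (RCLike.re (A + c • rowGram b x.1 + c • ∑ μ, rowGram b (x.2 μ)).det))
          (MeasurableEquiv.piFinSuccAbove (fun _ => κ → 𝕜) 0 w) := by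
      intro w
      simp only [Fin.sum_univ_succ, smul_add, ← add_assoc]
      rfl
    simp_rw [e]
    rw [hmp.lintegral_comp hf, lintegral_prod _ hf.aemeasurable]
    have hT : (bᴴ * b).PosSemidef := Matrix.posSemidef_conjTranspose_mul_self b
    have hmT : ((m * Δ) • (bᴴ * b)).PosSemidef := hT.smul (by positivity)
    calc ∫⁻ x, ∫⁻ y, ENNReal.ofReal
          (RCLike.re (A + c • rowGram b x + c • ∑ μ, rowGram b (y μ)).det)
          ∂(Measure.pi fun _ : Fin m => Measure.pi fun _ : κ => betaGaussian 𝕜)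
          ∂(Measure.pi fun _ : κ => betaGaussian 𝕜)
        ≤ ∫⁻ x, K ^ m * ENNReal.ofReal
          (RCLike.re ((A + (m * Δ) • (bᴴ * b)) + c • rowGram b x).det)
          ∂(Measure.pi fun _ : κ => betaGaussian 𝕜) := by
          -- The induction hypothesis is applied with one row `x` frozen inside `A`; that row is
          -- averaged afterwards, with `m Δ b†b` already added.
          refine lintegral_mono fun x => ?_
          have hR : (c • rowGram b x).PosSemidef := (posSemidef_rowGram b x).smul hc.le
          have := ih (A := A + c • rowGram b x) (hA.add_posSemidef hR)
            (by rw [add_sub_right_comm]; exact h1.add hR)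
          rwa [add_right_comm] at this
      _ ≤ K ^ m * (K * ENNReal.ofReal
          (RCLike.re ((A + (m * Δ) • (bᴴ * b)) + Δ • (bᴴ * b)).det)) := by
          rw [lintegral_const_mul' _ _ (ENNReal.pow_ne_top ENNReal.ofReal_ne_top)]
          gcongr
          exact lintegral_det_add_rowGram_le (hA.add_posSemidef hmT)
            (by rw [add_sub_right_comm]; exact h1.add hmT) b hτ hΔ hc hb
      _ = _ := by
          rw [← mul_assoc, ← pow_succ, add_assoc, ← add_smul]
          push_cast
          ring_nf

end Wishart

/-! ### Stirling bounds for Gamma functions -/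

section Gamma

theorem lintegral_rpow_mul_exp {a r : ℝ} (ha : 0 < a) (hr : 0 < r) :
    ∫⁻ t in Set.Ioi (0 : ℝ), ENNReal.ofReal (t ^ (a - 1) * Real.exp (-(r * t)))
      = ENNReal.ofReal ((1 / r) ^ a * Real.Gamma a) := by
  rw [← Real.integral_rpow_mul_exp_neg_mul_Ioi ha hr, ofReal_integral_eq_lintegral_ofReal]
  · have h := Real.GammaIntegral_convergent ha
    -- A nonintegrable integrand would have Bochner integral `0`, whereas the closed formula is
    -- positive.
    by_contra hn
    have h0 := Real.integral_rpow_mul_exp_neg_mul_Ioi ha hr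
    rw [integral_undef hn] at h0
    have : 0 < (1 / r) ^ a * Real.Gamma a :=
      mul_pos (Real.rpow_pos_of_pos (by positivity) _) (Real.Gamma_pos_of_pos ha)
    linarith
  · filter_upwards [ae_restrict_mem measurableSet_Ioi] with t ht
    exact mul_nonneg (Real.rpow_nonneg (le_of_lt ht) _) (Real.exp_pos _).le

/-- Keep only `t > x` in the Gamma integral, where `t^x ≥ x^x`. -/
theorem rpow_mul_exp_le_Gamma_add_one {x : ℝ} (hx : 0 < x) :
    x ^ x * Real.exp (-x) ≤ Real.Gamma (x + 1) := by
  have h1 : ENNReal.ofReal (x ^ x * Real.exp (-x)) ≤ ENNReal.ofReal (Real.Gamma (x + 1)) := by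
    have h2 := lintegral_rpow_mul_exp (a := x + 1) (r := 1) (by positivity) one_pos
    simp only [add_sub_cancel_right, one_mul, div_one, Real.one_rpow] at h2
    rw [← h2]
    calc ENNReal.ofReal (x ^ x * Real.exp (-x))
        = ∫⁻ t in Set.Ioi x, ENNReal.ofReal (x ^ x * Real.exp (-t)) := by
          have h3 : IntegrableOn (fun t : ℝ => Real.exp (-t)) (Set.Ioi x) :=
            integrableOn_exp_neg_Ioi x
          rw [← ofReal_integral_eq_lintegral_ofReal (h3.const_mul _)
            (ae_of_all _ fun t => by positivity), integral_const_mul, integral_exp_neg_Ioi]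
      _ ≤ ∫⁻ t in Set.Ioi x, ENNReal.ofReal (t ^ x * Real.exp (-t)) := by
          refine setLIntegral_mono (by fun_prop) fun t ht => ENNReal.ofReal_le_ofReal ?_
          have : x ≤ t := le_of_lt ht
          gcongr
      _ ≤ _ := lintegral_mono_set (Set.Ioi_subset_Ioi hx.le)
  exact (ENNReal.ofReal_le_ofReal_iff (Real.Gamma_pos_of_pos (by positivity)).le).mp h1

/-- Split `e^{-t} = e^{-θt} e^{-(1-θ)t}` with `θ = y/(y+1)`: the maximum of `t^y e^{-θt}` is
`(y/θ)^y e^{-y}`, the other factor integrates to `y + 1`, and `(1 + 1/y)^y ≤ e`. Polynomial losses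
do not matter on the exponential scale. -/
theorem Gamma_add_one_le {y : ℝ} (hy : 0 < y) :
    Real.Gamma (y + 1) ≤ Real.exp 1 * (y + 1) * (y ^ y * Real.exp (-y)) := by
  set θ : ℝ := y / (y + 1) with hθ
  have hθ0 : 0 < θ := by positivity
  have hθ1 : 1 - θ = 1 / (y + 1) := by rw [hθ]; field_simp; ring
  have h1 : ENNReal.ofReal (Real.Gamma (y + 1))
      ≤ ENNReal.ofReal ((y / θ) ^ y * Real.exp (-y) * (y + 1)) := by
    have h2 := lintegral_rpow_mul_exp (a := y + 1) (r := 1) (by positivity) one_pos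
    simp only [add_sub_cancel_right, one_mul, div_one, Real.one_rpow] at h2
    have h3 := lintegral_rpow_mul_exp (a := 1) (r := 1 - θ) one_pos (by rw [hθ1]; positivity)
    simp only [sub_self, Real.rpow_zero, one_mul, Real.rpow_one, Real.Gamma_one, mul_one, hθ1,
      one_div_one_div] at h3
    rw [← h2, ENNReal.ofReal_mul (by positivity), ← h3,
      ← lintegral_const_mul' _ _ ENNReal.ofReal_ne_top]
    refine setLIntegral_mono (by fun_prop) fun t ht => ?_
    have ht : 0 < t := ht
    rw [← ENNReal.ofReal_mul (by positivity)]
    refine ENNReal.ofReal_le_ofReal ?_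
    have h4 : t ^ y ≤ (y / θ) ^ y * Real.exp (-y) * Real.exp (θ * t) := by
      have h5 : t * θ / y ≤ Real.exp (t * θ / y - 1) := by
        have := Real.add_one_le_exp (t * θ / y - 1); linarith
      calc t ^ y = (y / θ) ^ y * (t * θ / y) ^ y := by
            rw [← Real.mul_rpow (by positivity) (by positivity)]
            congr 1
            field_simp
        _ ≤ (y / θ) ^ y * (Real.exp (t * θ / y - 1)) ^ y := by gcongr
        _ = (y / θ) ^ y * (Real.exp (-y) * Real.exp (θ * t)) := by
            rw [← Real.exp_mul, ← Real.exp_add]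
            congr 2
            field_simp
            ring
        _ = _ := by ring
    calc t ^ y * Real.exp (-t)
        ≤ (y / θ) ^ y * Real.exp (-y) * Real.exp (θ * t) * Real.exp (-t) := by gcongr
      _ = (y / θ) ^ y * Real.exp (-y) * Real.exp (-(1 / (y + 1) * t)) := by
          rw [mul_assoc, ← Real.exp_add]
          congr 2
          rw [← hθ1]; ring
  have h6 := (ENNReal.ofReal_le_ofReal_iff (by positivity)).mp h1
  have h7 : (y / θ) ^ y ≤ Real.exp 1 * y ^ y := by
    have h8 : y / θ = y * (1 + 1 / y) := by rw [hθ]; field_simp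
    rw [h8, Real.mul_rpow hy.le (by positivity), mul_comm]
    gcongr
    calc (1 + 1 / y) ^ y ≤ (Real.exp (1 / y)) ^ y := by
          gcongr
          have := Real.add_one_le_exp (1 / y); linarith
      _ = Real.exp 1 := by rw [← Real.exp_mul]; congr 1; field_simp
  calc Real.Gamma (y + 1) ≤ (y / θ) ^ y * Real.exp (-y) * (y + 1) := h6
    _ ≤ (Real.exp 1 * y ^ y) * Real.exp (-y) * (y + 1) := by gcongr
    _ = _ := by ring

/-- A Stirling type bound for quotients of Gamma functions. -/
theorem Gamma_div_Gamma_le {a x : ℝ} (ha : 0 < a) (hx : 0 < x) :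
    Real.Gamma x / Real.Gamma a ≤ Real.exp 1 * (x + 1) / x * a *
      Real.exp (x * Real.log x - x - (a * Real.log a - a)) := by
  have h1 := Gamma_add_one_le hx
  have h2 := rpow_mul_exp_le_Gamma_add_one ha
  rw [Real.Gamma_add_one hx.ne'] at h1
  rw [Real.Gamma_add_one ha.ne'] at h2
  have hga := Real.Gamma_pos_of_pos ha
  have hxx : x ^ x * Real.exp (-x) = Real.exp (x * Real.log x - x) := by
    rw [Real.rpow_def_of_pos hx, ← Real.exp_add]; ring_nf
  have haa : a ^ a * Real.exp (-a) = Real.exp (a * Real.log a - a) := by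
    rw [Real.rpow_def_of_pos ha, ← Real.exp_add]; ring_nf
  rw [hxx] at h1
  rw [haa] at h2
  rw [Real.exp_sub (x * Real.log x - x), div_le_iff₀ hga]
  have h3 : Real.Gamma x ≤ Real.exp 1 * (x + 1) / x * Real.exp (x * Real.log x - x) := by
    rw [div_mul_eq_mul_div, le_div_iff₀ hx]; linarith
  calc Real.Gamma x ≤ Real.exp 1 * (x + 1) / x * Real.exp (x * Real.log x - x) := h3
    _ = Real.exp 1 * (x + 1) / x * (Real.exp (x * Real.log x - x) /
        Real.exp (a * Real.log a - a)) * Real.exp (a * Real.log a - a) := by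
        field_simp
    _ ≤ Real.exp 1 * (x + 1) / x * (Real.exp (x * Real.log x - x) /
        Real.exp (a * Real.log a - a)) * (a * Real.Gamma a) := by gcongr
    _ = _ := by ring

/-- `ln (1 + e^s x)` is convex in `s`. -/
theorem log_one_add_mul_ge {x k k' : ℝ} (hx : 0 ≤ x) (hk : 0 < k) (hk' : 0 < k') :
    Real.log (1 + k * x) + k * x / (1 + k * x) * Real.log (k' / k) ≤ Real.log (1 + k' * x) := by
  have h1 : 0 < 1 + k * x := by positivity
  -- Concavity of the logarithm at the points `1` and `k'/k`, with weights `1/(1 + kx)` and `kx/(1 +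
  -- kx)`.
  have hconc := strictConcaveOn_log_Ioi.concaveOn.2 (show (1 : ℝ) ∈ Set.Ioi 0 by simp)
    (show k' / k ∈ Set.Ioi (0 : ℝ) from div_pos hk' hk) (show 0 ≤ 1 / (1 + k * x) by positivity)
    (show 0 ≤ k * x / (1 + k * x) by positivity) (by field_simp)
  simp only [Real.log_one, smul_eq_mul, mul_zero, zero_add, mul_one] at hconc
  have h2 : 1 / (1 + k * x) + k * x / (1 + k * x) * (k' / k) = (1 + k' * x) / (1 + k * x) := by
    field_simp
  rw [h2, Real.log_div (by positivity) h1.ne'] at hconc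
  linarith

end Gamma

/-! ### Negative powers of Wishart determinants -/

section Wishart

open scoped ComplexOrder

variable {𝕜 : Type*} [RCLike 𝕜] {ι κ : Type*} [Fintype ι] [Fintype κ] [DecidableEq κ]

/-- The Gaussian integral over one row. -/
theorem lintegral_exp_quadForm_rowGram (b : Matrix κ ι 𝕜) (g : ι → 𝕜) {c : ℝ} (hc : 0 ≤ c) :
    ∫⁻ w, ENNReal.ofReal (Real.exp (-(betaDim 𝕜 / 2) *
        (c * RCLike.re (star g ⬝ᵥ (rowGram b w *ᵥ g))))) ∂(Measure.pi fun _ : κ => betaGaussian 𝕜)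
      = ENNReal.ofReal ((1 + c * RCLike.re (star g ⬝ᵥ ((bᴴ * b) *ᵥ g))) ^ (-(betaDim 𝕜 / 2))) := by
  simp_rw [quadForm_rowGram]
  rw [lintegral_exp_quadForm (Matrix.posSemidef_vecMulVec_star_self _) hc,
    det_add_smul_vecMulVec (by simp)]
  congr 2
  have : b *ᵥ g ⬝ᵥ ((1 : Matrix κ κ 𝕜)⁻¹ *ᵥ star (b *ᵥ g)) = star g ⬝ᵥ ((bᴴ * b) *ᵥ g) := by
    rw [inv_one, Matrix.one_mulVec, dotProduct_comm, ← Matrix.mulVec_mulVec,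
      Matrix.dotProduct_mulVec (star g), Matrix.star_mulVec]
  rw [this]
  simp [RCLike.smul_re]

variable [DecidableEq ι]

/-- The negative power of the determinant is a Gaussian integral over `g`. After Tonelli the rows
separate, and each contributes the same Gaussian integral, which depends on `g` only through `g† b†b
g`. -/
theorem lintegral_det_rpow_eq (b : Matrix κ ι 𝕜) {c : ℝ} (hc : 0 ≤ c) (m : ℕ) :
    ∫⁻ w, ENNReal.ofReal (RCLike.re (1 + c • ∑ μ, rowGram b (w μ)).det ^ (-(betaDim 𝕜 / 2)))
        ∂(Measure.pi fun _ : Fin m => Measure.pi fun _ : κ => betaGaussian 𝕜)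
      = ∫⁻ g, ENNReal.ofReal ((1 + c * RCLike.re (star g ⬝ᵥ ((bᴴ * b) *ᵥ g)))
          ^ (-(betaDim 𝕜 * m / 2))) ∂(Measure.pi fun _ : ι => betaGaussian 𝕜) := by
  have hcont : Continuous (rowGram b) := continuous_rowGram b
  have h0 : ∀ g : ι → 𝕜, 0 ≤ RCLike.re (star g ⬝ᵥ ((bᴴ * b) *ᵥ g)) := fun g =>
    (RCLike.nonneg_iff.mp ((Matrix.posSemidef_conjTranspose_mul_self b).dotProduct_mulVec_nonneg
      g)).1
  calc _ = ∫⁻ w, ∫⁻ g, ENNReal.ofReal (Real.exp (-(betaDim 𝕜 / 2) *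
        (c * RCLike.re (star g ⬝ᵥ ((∑ μ, rowGram b (w μ)) *ᵥ g)))))
        ∂(Measure.pi fun _ : ι => betaGaussian 𝕜)
        ∂(Measure.pi fun _ : Fin m => Measure.pi fun _ : κ => betaGaussian 𝕜) := by
        refine lintegral_congr fun w => ?_
        rw [lintegral_exp_quadForm (Matrix.posSemidef_sum _ fun μ _ => posSemidef_rowGram b (w μ))
          hc]
    _ = ∫⁻ g, ∫⁻ w, ENNReal.ofReal (Real.exp (-(betaDim 𝕜 / 2) *
        (c * RCLike.re (star g ⬝ᵥ ((∑ μ, rowGram b (w μ)) *ᵥ g)))))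
        ∂(Measure.pi fun _ : Fin m => Measure.pi fun _ : κ => betaGaussian 𝕜)
        ∂(Measure.pi fun _ : ι => betaGaussian 𝕜) := by
        refine lintegral_lintegral_swap ?_
        have : Continuous (Function.uncurry fun (w : Fin m → κ → 𝕜) (g : ι → 𝕜) =>
          Real.exp (-(betaDim 𝕜 / 2) *
          (c * RCLike.re (star g ⬝ᵥ ((∑ μ, rowGram b (w μ)) *ᵥ g))))) := by
          unfold Function.uncurry
          fun_prop
        exact this.measurable.ennreal_ofReal.aemeasurable
    _ = _ := by
        refine lintegral_congr fun g => ?_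
        have e : ∀ w : Fin m → κ → 𝕜, ENNReal.ofReal (Real.exp (-(betaDim 𝕜 / 2) *
            (c * RCLike.re (star g ⬝ᵥ ((∑ μ, rowGram b (w μ)) *ᵥ g)))))
            = ∏ μ, (fun v : κ → 𝕜 => ENNReal.ofReal (Real.exp (-(betaDim 𝕜 / 2) *
            (c * RCLike.re (star g ⬝ᵥ (rowGram b v *ᵥ g)))))) (w μ) := by
          intro w
          rw [← ENNReal.ofReal_prod_of_nonneg (fun i _ => (Real.exp_pos _).le), ← Real.exp_sum,
            ← Finset.mul_sum, ← Finset.mul_sum, ← map_sum, ← dotProduct_sum, Matrix.sum_mulVec]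
        simp_rw [e]
        rw [lintegral_pi_prod (Measure.pi fun _ : κ => betaGaussian 𝕜) (f := fun _ (v : κ → 𝕜) => ENNReal.ofReal (Real.exp
          (-(betaDim 𝕜 / 2) * (c * RCLike.re (star g ⬝ᵥ (rowGram b v *ᵥ g))))))]
        · simp only [lintegral_exp_quadForm_rowGram b g hc, Finset.prod_const, Finset.card_univ,
            Fintype.card_fin]
          have h1 : 0 ≤ 1 + c * RCLike.re (star g ⬝ᵥ ((bᴴ * b) *ᵥ g)) := by
            have := mul_nonneg hc (h0 g); linarith
          rw [← ENNReal.ofReal_pow (Real.rpow_nonneg h1 _), ← Real.rpow_natCast,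
            ← Real.rpow_mul h1]
          congr 2
          ring
        · intro μ
          have : Continuous fun v : κ → 𝕜 => Real.exp
            (-(betaDim 𝕜 / 2) * (c * RCLike.re (star g ⬝ᵥ (rowGram b v *ᵥ g)))) := by fun_prop
          exact this.measurable.ennreal_ofReal

/-- Averaging a negative power of a determinant over the rows of a Gaussian matrix. -/
theorem lintegral_det_rpow_le (b : Matrix κ ι 𝕜) {c k a B : ℝ} (hc : 0 < c) (hk : 0 < k)
    {m : ℕ} (hm : 0 < m) {e : ι → ℝ}
    (he : e = (Matrix.posSemidef_conjTranspose_mul_self b).1.eigenvalues)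
    (ha : a = betaDim 𝕜 * m / 2)
    (hB : B = betaDim 𝕜 / 2 * ∑ i, k * e i / (1 + k * e i)) (hBa : B < a) :
    ∫⁻ w, ENNReal.ofReal (RCLike.re (1 + c • ∑ μ, rowGram b (w μ)).det ^ (-(betaDim 𝕜 / 2)))
        ∂(Measure.pi fun _ : Fin m => Measure.pi fun _ : κ => betaGaussian 𝕜)
      ≤ ENNReal.ofReal (Real.exp (-(betaDim 𝕜 / 2) * ∑ i, Real.log (1 + k * e i)) *
          (2 * c / (betaDim 𝕜 * k)) ^ (-B) * (Real.Gamma (a - B) / Real.Gamma a)) := by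
  have hβ := betaDim_pos 𝕜
  have hT : (bᴴ * b).PosSemidef := Matrix.posSemidef_conjTranspose_mul_self b
  have he0 : ∀ i, 0 ≤ e i := fun i => he ▸ hT.eigenvalues_nonneg i
  have ha0 : 0 < a := by rw [ha]; positivity
  have hGa := Real.Gamma_pos_of_pos ha0
  have h0 : ∀ g : ι → 𝕜, 0 ≤ RCLike.re (star g ⬝ᵥ ((bᴴ * b) *ᵥ g)) := fun g =>
    (RCLike.nonneg_iff.mp (hT.dotProduct_mulVec_nonneg g)).1
  rw [lintegral_det_rpow_eq b hc.le m, ← ha]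
  -- The power `r^(-a)` is written as a Gamma integral over `t`, so that `g` again appears in a
  -- Gaussian exponential.
  have h1 : ∀ g : ι → 𝕜, ENNReal.ofReal ((1 + c * RCLike.re (star g ⬝ᵥ ((bᴴ * b) *ᵥ g))) ^ (-a))
      = ∫⁻ t in Set.Ioi (0 : ℝ), ENNReal.ofReal (1 / Real.Gamma a) * (ENNReal.ofReal (t ^ (a - 1) *
          Real.exp (-t)) * ENNReal.ofReal (Real.exp (-(betaDim 𝕜 / 2) *
          (2 * t * c / betaDim 𝕜 * RCLike.re (star g ⬝ᵥ ((bᴴ * b) *ᵥ g)))))) := by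
    intro g
    have hr : 0 < 1 + c * RCLike.re (star g ⬝ᵥ ((bᴴ * b) *ᵥ g)) := by
      have := mul_nonneg hc.le (h0 g); linarith
    rw [lintegral_const_mul' _ _ ENNReal.ofReal_ne_top]
    have h2 := lintegral_rpow_mul_exp ha0 hr
    have h3 : ∀ t : ℝ, ENNReal.ofReal (t ^ (a - 1) *
          Real.exp (-t)) * ENNReal.ofReal (Real.exp (-(betaDim 𝕜 / 2) *
          (2 * t * c / betaDim 𝕜 * RCLike.re (star g ⬝ᵥ ((bᴴ * b) *ᵥ g)))))
          = ENNReal.ofReal (t ^ (a - 1) *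
            Real.exp (-((1 + c * RCLike.re (star g ⬝ᵥ ((bᴴ * b) *ᵥ g))) * t))) := by
      intro t
      rw [← ENNReal.ofReal_mul' (Real.exp_pos _).le, mul_assoc, ← Real.exp_add]
      congr 3
      field_simp
      ring
    simp_rw [h3]
    rw [h2, ← ENNReal.ofReal_mul (by positivity)]
    congr 1
    rw [Real.rpow_neg hr.le, one_div, one_div, Real.inv_rpow hr.le]
    field_simp
  simp_rw [h1]
  rw [lintegral_lintegral_swap]
  · have h4 : ∀ t ∈ Set.Ioi (0 : ℝ), ∫⁻ g, ENNReal.ofReal (1 / Real.Gamma a) *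
          (ENNReal.ofReal (t ^ (a - 1) *
          Real.exp (-t)) * ENNReal.ofReal (Real.exp (-(betaDim 𝕜 / 2) *
          (2 * t * c / betaDim 𝕜 * RCLike.re (star g ⬝ᵥ ((bᴴ * b) *ᵥ g))))))
          ∂(Measure.pi fun _ : ι => betaGaussian 𝕜)
        ≤ ENNReal.ofReal (Real.exp (-(betaDim 𝕜 / 2) * ∑ i, Real.log (1 + k * e i)) *
          (2 * c / (betaDim 𝕜 * k)) ^ (-B) * (1 / Real.Gamma a)) *
          ENNReal.ofReal (t ^ (a - B - 1) * Real.exp (-(1 * t))) := by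
      intro t ht
      have ht : 0 < t := ht
      have hk' : 0 < 2 * t * c / betaDim 𝕜 := by positivity
      rw [lintegral_const_mul' _ _ ENNReal.ofReal_ne_top,
        lintegral_const_mul' _ _ ENNReal.ofReal_ne_top,
        lintegral_exp_quadForm hT hk'.le,
        ← ENNReal.ofReal_mul (by positivity), ← ENNReal.ofReal_mul (by positivity),
        ← ENNReal.ofReal_mul (by positivity)]
      refine ENNReal.ofReal_le_ofReal ?_
      rw [det_one_add_smul_eq_prod hT.1, RCLike.ofReal_re, ← he]
      set k' := 2 * t * c / betaDim 𝕜 with hk'def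
      have hp : 0 < ∏ i, (1 + k' * e i) := Finset.prod_pos fun i _ => by
        have := mul_nonneg hk'.le (he0 i); linarith
      -- The log-determinant is convex in `ln k'`, hence above its tangent at `ln k`, whose slope is
      -- `B` up to sign. The result is the power `t^(-B)`, which shifts the Gamma parameter from `a`
      -- to `a - B`.
      have h5 : (∏ i, (1 + k' * e i)) ^ (-(betaDim 𝕜 / 2))
          ≤ Real.exp (-(betaDim 𝕜 / 2) * ∑ i, Real.log (1 + k * e i)) *
            (2 * c / (betaDim 𝕜 * k)) ^ (-B) * t ^ (-B) := by
        rw [mul_assoc, ← Real.mul_rpow (by positivity) ht.le,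
          show 2 * c / (betaDim 𝕜 * k) * t = k' / k by rw [hk'def]; field_simp,
          Real.rpow_def_of_pos hp, Real.rpow_def_of_pos (by positivity), ← Real.exp_add,
          Real.exp_le_exp, Real.log_prod (fun i _ => by
            have := mul_nonneg hk'.le (he0 i); linarith), hB]
        have h6 : ∑ i, Real.log (1 + k * e i) + (∑ i, k * e i / (1 + k * e i)) * Real.log (k' / k)
            ≤ ∑ i, Real.log (1 + k' * e i) := by
          rw [Finset.sum_mul, ← Finset.sum_add_distrib]
          exact Finset.sum_le_sum fun i _ => log_one_add_mul_ge (he0 i) hk hk'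
        nlinarith [mul_le_mul_of_nonneg_left h6 (by positivity : 0 ≤ betaDim 𝕜 / 2)]
      have h7 : t ^ (a - B - 1) = t ^ (a - 1) * t ^ (-B) := by
        rw [← Real.rpow_add ht]; ring_nf
      rw [h7, one_mul]
      calc 1 / Real.Gamma a * (t ^ (a - 1) * Real.exp (-t) *
            (∏ i, (1 + k' * e i)) ^ (-(betaDim 𝕜 / 2)))
          ≤ 1 / Real.Gamma a * (t ^ (a - 1) * Real.exp (-t) *
            (Real.exp (-(betaDim 𝕜 / 2) * ∑ i, Real.log (1 + k * e i)) *
            (2 * c / (betaDim 𝕜 * k)) ^ (-B) * t ^ (-B))) := by gcongr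
        _ = _ := by ring
    refine (setLIntegral_mono (by fun_prop) h4).trans (le_of_eq ?_)
    rw [lintegral_const_mul' _ _ ENNReal.ofReal_ne_top,
      lintegral_rpow_mul_exp (by linarith) one_pos, ← ENNReal.ofReal_mul (by positivity)]
    congr 1
    simp only [div_one, Real.one_rpow]
    ring
  · have hc1 : Continuous fun x : (ι → 𝕜) × ℝ => Real.exp (-(betaDim 𝕜 / 2) *
          (2 * x.2 * c / betaDim 𝕜 * RCLike.re (star x.1 ⬝ᵥ ((bᴴ * b) *ᵥ x.1)))) := by fun_prop
    have hm1 := hc1.measurable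
    have : Measurable fun x : (ι → 𝕜) × ℝ => x.2 ^ (a - 1) * Real.exp (-x.2) := by fun_prop
    exact ((this.ennreal_ofReal.mul hm1.ennreal_ofReal).const_mul _).aemeasurable

end Wishart

/-! ### Gram matrices and their spectra -/

section Gram

open scoped ComplexOrder

variable {𝕜 : Type*} [RCLike 𝕜] {k n m p : ℕ}

theorem gram_eq (b : Matrix (Fin k) (Fin n) 𝕜) :
    gram b = ((√n)⁻¹ • b)ᴴ * ((√n)⁻¹ • b) := by
  rw [gram, Matrix.conjTranspose_smul, Matrix.smul_mul, Matrix.mul_smul, smul_smul]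
  congr 1
  rw [star_trivial, ← mul_inv, Real.mul_self_sqrt (Nat.cast_nonneg n)]

theorem posSemidef_gram (b : Matrix (Fin k) (Fin n) 𝕜) : (gram b).PosSemidef := by
  rw [gram_eq]; exact Matrix.posSemidef_conjTranspose_mul_self _

theorem gramEigenvalues_nonneg (b : Matrix (Fin k) (Fin n) 𝕜) (i : Fin n) :
    0 ≤ gramEigenvalues b i :=
  (posSemidef_gram b).eigenvalues_nonneg i

theorem re_det_one_add_smul_gram (b : Matrix (Fin k) (Fin n) 𝕜) (c : ℝ) :
    RCLike.re (1 + c • gram b).det = ∏ i, (1 + c * gramEigenvalues b i) := by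
  rw [det_one_add_smul_eq_prod (gram_isHermitian b), RCLike.ofReal_re]; rfl

theorem log_re_det_one_add_smul_gram (b : Matrix (Fin k) (Fin n) 𝕜) {c : ℝ} (hc : 0 ≤ c) :
    Real.log (RCLike.re (1 + c • gram b).det) = ∑ i, Real.log (1 + c * gramEigenvalues b i) := by
  rw [re_det_one_add_smul_gram, Real.log_prod fun i _ => by
    have := mul_nonneg hc (gramEigenvalues_nonneg b i); linarith]

theorem re_det_one_add_smul_gram_pos (b : Matrix (Fin k) (Fin n) 𝕜) {c : ℝ} (hc : 0 ≤ c) :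
    0 < RCLike.re (1 + c • gram b).det := by
  rw [re_det_one_add_smul_gram]
  exact Finset.prod_pos fun i _ => by
    have := mul_nonneg hc (gramEigenvalues_nonneg b i); linarith

theorem re_trace_gram (b : Matrix (Fin k) (Fin n) 𝕜) :
    RCLike.re (gram b).trace = ∑ i, gramEigenvalues b i := by
  rw [(gram_isHermitian b).trace_eq_sum_eigenvalues, ← RCLike.ofReal_sum, RCLike.ofReal_re]; rfl

theorem gram_smul_mul (w : Matrix (Fin m) (Fin p) 𝕜) (b : Matrix (Fin p) (Fin n) 𝕜) :
    gram ((√p)⁻¹ • (w * b)) = (p : ℝ)⁻¹ • ∑ μ, rowGram ((√n)⁻¹ • b) (w μ) := by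
  have e : (√n)⁻¹ • ((√p)⁻¹ • (w * b)) = (√p)⁻¹ • (w * ((√n)⁻¹ • b)) := by
    rw [Matrix.mul_smul, smul_comm]
  rw [gram_eq, e, ← conjTranspose_mul_self_eq_sum_rowGram, Matrix.conjTranspose_smul, Matrix.smul_mul, Matrix.mul_smul, smul_smul]
  congr 1
  rw [star_trivial, ← mul_inv, Real.mul_self_sqrt (Nat.cast_nonneg p)]

theorem continuous_gram : Continuous fun M : Matrix (Fin k) (Fin n) 𝕜 => gram M := by
  unfold gram
  fun_prop

theorem re_star_dotProduct_self {ι : Type*} [Fintype ι] (x : ι → 𝕜) :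
    RCLike.re (star x ⬝ᵥ x) = ∑ i, ‖x i‖ ^ 2 := by
  rw [dotProduct, map_sum]
  refine Finset.sum_congr rfl fun i _ => ?_
  rw [Pi.star_apply, RCLike.star_def, RCLike.conj_mul, ← RCLike.ofReal_pow, RCLike.ofReal_re]

theorem re_quadForm_le {ι : Type*} [Fintype ι] [DecidableEq ι] {H : Matrix ι ι 𝕜}
    (hH : H.IsHermitian) {R : ℝ}
    (hR : ∀ i, hH.eigenvalues i ≤ R) (x : ι → 𝕜) :
    RCLike.re (star x ⬝ᵥ (H *ᵥ x)) ≤ R * RCLike.re (star x ⬝ᵥ x) := by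
  have h1 : RCLike.re (star x ⬝ᵥ x)
      = ∑ i, ‖((hH.eigenvectorUnitary : Matrix ι ι 𝕜)ᴴ *ᵥ x) i‖ ^ 2 := by
    rw [← re_star_dotProduct_self, Matrix.star_mulVec, ← Matrix.dotProduct_mulVec,
      Matrix.mulVec_mulVec, Matrix.conjTranspose_conjTranspose,
      eigenvectorUnitary_mul_conjTranspose, Matrix.one_mulVec]
  rw [re_quadForm_eq_sum hH, h1, Finset.mul_sum]
  exact Finset.sum_le_sum fun i _ => mul_le_mul_of_nonneg_right (hR i) (sq_nonneg _)

/-- Transfers the top eigenvalue of `b†b` to `bb†`: with `z = b†y`, expand `|R y - b z|² ≥ 0` and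
use `|b z|² ≤ R |z|²`. -/
theorem re_conjTranspose_mulVec_le {ι κ : Type*} [Fintype ι] [DecidableEq ι] [Fintype κ]
    (b : Matrix κ ι 𝕜) (hH : (bᴴ * b).IsHermitian) {R : ℝ} (hR0 : 0 < R)
    (hR : ∀ i, hH.eigenvalues i ≤ R) (y : κ → 𝕜) :
    RCLike.re (star (bᴴ *ᵥ y) ⬝ᵥ (bᴴ *ᵥ y)) ≤ R * RCLike.re (star y ⬝ᵥ y) := by
  set z := bᴴ *ᵥ y with hz
  have h1 := re_quadForm_le hH hR z
  have h2 : star z ⬝ᵥ ((bᴴ * b) *ᵥ z) = star (b *ᵥ z) ⬝ᵥ (b *ᵥ z) := by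
    rw [← Matrix.mulVec_mulVec, Matrix.dotProduct_mulVec (star z), Matrix.star_mulVec b]
  have h3 : star z ⬝ᵥ z = star y ⬝ᵥ (b *ᵥ z) := by
    conv_lhs => rw [hz, Matrix.star_mulVec, Matrix.conjTranspose_conjTranspose]
    rw [← hz, ← Matrix.dotProduct_mulVec]
  have h3' : star (b *ᵥ z) ⬝ᵥ y = star (star z ⬝ᵥ z) := by
    rw [h3, Matrix.star_dotProduct]
  have h4 : 0 ≤ RCLike.re (star ((R : 𝕜) • y - b *ᵥ z) ⬝ᵥ ((R : 𝕜) • y - b *ᵥ z)) := by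
    rw [re_star_dotProduct_self]
    exact Finset.sum_nonneg fun i _ => sq_nonneg _
  have h5 : RCLike.re (star ((R : 𝕜) • y - b *ᵥ z) ⬝ᵥ ((R : 𝕜) • y - b *ᵥ z))
      = R * (R * RCLike.re (star y ⬝ᵥ y)) - 2 * R * RCLike.re (star z ⬝ᵥ z)
        + RCLike.re (star (b *ᵥ z) ⬝ᵥ (b *ᵥ z)) := by
    rw [star_sub, star_smul, sub_dotProduct, dotProduct_sub, dotProduct_sub, smul_dotProduct,
      smul_dotProduct, dotProduct_smul, dotProduct_smul, ← h3, h3']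
    simp only [RCLike.star_def, RCLike.conj_ofReal, smul_eq_mul, map_sub, RCLike.re_ofReal_mul,
      RCLike.conj_re]
    ring
  rw [h5, ← h2] at h4
  have h6 : 0 ≤ R * (R * RCLike.re (star y ⬝ᵥ y) - RCLike.re (star z ⬝ᵥ z)) := by linarith
  have := nonneg_of_mul_nonneg_right h6 hR0
  linarith

theorem integral_empiricalSpectrum (b : Matrix (Fin k) (Fin n) 𝕜) (f : ℝ → ℝ) :
    ∫ x, f x ∂(empiricalSpectrum b) = (n : ℝ)⁻¹ * ∑ i, f (gramEigenvalues b i) := by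
  rw [empiricalSpectrum, integral_smul_measure, integral_finsetSum_measure]
  · simp
  · exact fun i _ => integrable_dirac (by simp)

end Gram

/-! ### Spectral averages and weak convergence -/

section Limits

variable {𝕜 : Type*} [RCLike 𝕜]

/-- Restriction of a function to `[0, R]`, extended by constants. -/
def clampBCF (f : ℝ → ℝ) (hf : ContinuousOn f (Set.Ici 0)) (R : ℝ) : ℝ →ᵇ ℝ :=
  BoundedContinuousFunction.mkOfBound
    ⟨fun x => f (max 0 (min x (max R 0))), by
      refine hf.comp_continuous (by fun_prop) fun x => ?_
      simp⟩
    (Classical.choose ((isCompact_Icc (a := (0 : ℝ)) (b := max R 0)).image_of_continuousOn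
      (hf.mono Set.Icc_subset_Ici_self)).isBounded.exists_norm_le + 
      Classical.choose ((isCompact_Icc (a := (0 : ℝ)) (b := max R 0)).image_of_continuousOn
      (hf.mono Set.Icc_subset_Ici_self)).isBounded.exists_norm_le) (by
    have h := Classical.choose_spec ((isCompact_Icc (a := (0 : ℝ))
      (b := max R 0)).image_of_continuousOn
      (hf.mono Set.Icc_subset_Ici_self)).isBounded.exists_norm_le
    intro x y
    refine (dist_le_norm_add_norm _ _).trans (add_le_add (h _ ?_) (h _ ?_)) <;>
    exact Set.mem_image_of_mem f ⟨le_max_left _ _, max_le (le_max_right _ _) (min_le_right _ _)⟩)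

theorem clampBCF_apply {f : ℝ → ℝ} (hf : ContinuousOn f (Set.Ici 0)) (R x : ℝ) :
    clampBCF f hf R x = f (max 0 (min x (max R 0))) := rfl

theorem clampBCF_eq {f : ℝ → ℝ} (hf : ContinuousOn f (Set.Ici 0)) {R x : ℝ} (h0 : 0 ≤ x)
    (hR : x ≤ R) : clampBCF f hf R x = f x := by
  rw [clampBCF_apply, min_eq_left (hR.trans (le_max_left _ _)), max_eq_right h0]

/-- The limit of a sequence of spectra of Gram matrices is supported by `[0, ∞)`. -/
theorem ae_nonneg_of_tendsto {k : ℕ → ℕ} {M : (n : ℕ) → Matrix (Fin (k n)) (Fin n) 𝕜}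
    {ν : Measure ℝ} [IsProbabilityMeasure ν]
    (h : ∀ f : ℝ →ᵇ ℝ, Tendsto (fun n => ∫ x, f x ∂(empiricalSpectrum (M n))) atTop
      (𝓝 (∫ x, f x ∂ν))) : ∀ᵐ x ∂ν, 0 ≤ x := by
  -- A bounded continuous test function, positive exactly on the negative reals; its average over
  -- every Gram spectrum is zero.
  set f : ℝ →ᵇ ℝ := BoundedContinuousFunction.mkOfBound
    ⟨fun x => max 0 (min (-x) 1), by fun_prop⟩ 1 (by
      intro x y
      rw [Real.dist_eq, abs_le]
      have h1 : ∀ z : ℝ, 0 ≤ max 0 (min (-z) 1) ∧ max 0 (min (-z) 1) ≤ 1 := fun z =>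
        ⟨le_max_left _ _, max_le zero_le_one (min_le_right _ _)⟩
      have hx := h1 x
      have hy := h1 y
      simp only [ContinuousMap.coe_mk]
      constructor <;> linarith) with hf
  have hfa : ∀ x, f x = max 0 (min (-x) 1) := fun x => rfl
  have h1 : ∀ n, ∫ x, f x ∂(empiricalSpectrum (M n)) = 0 := by
    intro n
    rw [integral_empiricalSpectrum]
    refine mul_eq_zero_of_right _ (Finset.sum_eq_zero fun i _ => ?_)
    rw [hfa]
    refine max_eq_left ((min_le_left _ _).trans ?_)
    simpa using gramEigenvalues_nonneg (M n) i
  have h2 := h f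
  simp only [h1] at h2
  have h3 : ∫ x, f x ∂ν = 0 := tendsto_nhds_unique h2 tendsto_const_nhds
  rw [integral_eq_zero_iff_of_nonneg (fun x => by rw [hfa]; exact le_max_left _ _)
    (f.integrable ν)] at h3
  filter_upwards [h3] with x hx
  rw [Pi.zero_apply, hfa] at hx
  by_contra hneg
  push Not at hneg
  have : 0 < max 0 (min (-x) 1) := lt_max_of_lt_right (lt_min (by linarith) one_pos)
  linarith

theorem ae_le_of_compact {ν : Measure ℝ} (hν : ∃ K : Set ℝ, IsCompact K ∧ ν Kᶜ = 0) :
    ∃ R : ℝ, 0 < R ∧ ∀ᵐ x ∂ν, x ≤ R := by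
  obtain ⟨K, hK, hK0⟩ := hν
  obtain ⟨R, hR⟩ := hK.isBounded.exists_norm_le
  refine ⟨max R 1, by positivity, ?_⟩
  have : ∀ᵐ x ∂ν, x ∈ K := by rw [ae_iff]; exact hK0
  filter_upwards [this] with x hx
  exact (le_abs_self x).trans ((hR x hx).trans (le_max_left _ _))

theorem integrable_of_continuousOn {ν : Measure ℝ} [IsProbabilityMeasure ν] {R : ℝ}
    (h0 : ∀ᵐ x ∂ν, 0 ≤ x) (hR : ∀ᵐ x ∂ν, x ≤ R) {f : ℝ → ℝ} (hf : ContinuousOn f (Set.Ici 0)) :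
    Integrable f ν := by
  refine ((clampBCF f hf R).integrable ν).congr ?_
  filter_upwards [h0, hR] with x h1 h2
  exact clampBCF_eq hf h1 h2

theorem integral_clampBCF {ν : Measure ℝ} {R : ℝ}
    (h0 : ∀ᵐ x ∂ν, 0 ≤ x) (hR : ∀ᵐ x ∂ν, x ≤ R) {f : ℝ → ℝ} (hf : ContinuousOn f (Set.Ici 0)) :
    ∫ x, clampBCF f hf R x ∂ν = ∫ x, f x ∂ν := by
  refine integral_congr_ae ?_
  filter_upwards [h0, hR] with x h1 h2
  exact clampBCF_eq hf h1 h2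

/-- Convergence of spectral averages of continuous functions when the top eigenvalue is bounded. -/
theorem tendsto_spectral_average {k : ℕ → ℕ} {M : (n : ℕ) → Matrix (Fin (k n)) (Fin n) 𝕜}
    {ν : Measure ℝ} [IsProbabilityMeasure ν]
    (h : ∀ f : ℝ →ᵇ ℝ, Tendsto (fun n => ∫ x, f x ∂(empiricalSpectrum (M n))) atTop
      (𝓝 (∫ x, f x ∂ν))) {R : ℝ} (hν : ∀ᵐ x ∂ν, x ≤ R)
    (hM : ∀ᶠ n in atTop, ∀ i, gramEigenvalues (M n) i ≤ R)
    {f : ℝ → ℝ} (hf : ContinuousOn f (Set.Ici 0)) :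
    Tendsto (fun n : ℕ => (n : ℝ)⁻¹ * ∑ i, f (gramEigenvalues (M n) i)) atTop
      (𝓝 (∫ x, f x ∂ν)) := by
  have h1 := h (clampBCF f hf R)
  rw [integral_clampBCF (ae_nonneg_of_tendsto h) hν hf] at h1
  refine h1.congr' ?_
  filter_upwards [hM] with n hn
  rw [integral_empiricalSpectrum]
  congr 1
  exact Finset.sum_congr rfl fun i _ => clampBCF_eq hf (gramEigenvalues_nonneg _ i) (hn i)

end Limits

/-! ### Limits of the exponents of the two determinant bounds -/

section Asymptotics

/-- `x - 1 - ln x`. -/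
def logGap (x : ℝ) : ℝ := x - 1 - Real.log x

/-- With `Δ = k/m` and `c = γ/p`, the ratio of the exponential rate to `c` tends to `y = kδ/(αγ)`,
and `-1 + y - ln y` is `logGap y`. The bound `R` on the spectrum disappears because `Δ R → 0`. -/
theorem tendsto_upper_exponent {m p : ℕ → ℕ} {α δ γ k R N : ℝ} {Nn : ℕ → ℝ} (hα : 0 < α)
    (hδ : 0 < δ) (hγ : 0 < γ) (hk : 0 < k)
    (hm : Tendsto (fun n => (m n : ℝ) / n) atTop (𝓝 α))
    (hp : Tendsto (fun n => (p n : ℝ) / n) atTop (𝓝 δ))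
    (hN : Tendsto Nn atTop (𝓝 N)) :
    Tendsto (fun n : ℕ => (m n : ℝ) / n * Real.log (γ / p n / (k / m n / (1 + k / m n * R)) *
        Real.exp (-1 + k / m n / (1 + k / m n * R) / (γ / p n))) + Nn n) atTop
      (𝓝 (N + α * logGap (k * δ / (α * γ)))) := by
  have hy : 0 < k * δ / (α * γ) := by positivity
  have hn : Tendsto (fun n : ℕ => (n : ℝ)⁻¹) atTop (𝓝 0) := tendsto_inv_atTop_nhds_zero_nat
  have hr : Tendsto (fun n : ℕ => k / m n / (1 + k / m n * R) / (γ / p n)) atTop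
      (𝓝 (k * δ / (α * γ))) := by
    have h1 : Tendsto (fun n : ℕ => k / γ * ((p n : ℝ) / n) / ((m n : ℝ) / n) /
        (1 + k * R * ((n : ℝ)⁻¹ / ((m n : ℝ) / n)))) atTop
        (𝓝 (k / γ * δ / α / (1 + k * R * (0 / α)))) := by
      refine Tendsto.div ((hp.const_mul _).div hm hα.ne') ?_ (by simp)
      exact ((hn.div hm hα.ne').const_mul _).const_add _
    have h2 : k / γ * δ / α / (1 + k * R * (0 / α)) = k * δ / (α * γ) := by
      field_simp; simp [hα.ne']
    rw [h2] at h1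
    refine h1.congr' ?_
    filter_upwards [eventually_gt_atTop 0, hm.eventually_const_lt hα] with n hn0 hmn
    have hn0' : (0 : ℝ) < n := by exact_mod_cast hn0
    have hm0 : (0 : ℝ) < m n := by
      rw [lt_div_iff₀ hn0'] at hmn; linarith
    have e : (n : ℝ)⁻¹ / ((m n : ℝ) / n) = 1 / m n := by field_simp
    have e2 : k * R * (1 / m n) = k / m n * R := by ring
    have e3 : k / γ * ((p n : ℝ) / n) / ((m n : ℝ) / n) = k / m n / (γ / p n) := by field_simp
    rw [e, e2, e3, div_right_comm]
  have hlim : Tendsto (fun n : ℕ => (m n : ℝ) / n *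
      (-Real.log (k / m n / (1 + k / m n * R) / (γ / p n))
        + (-1 + k / m n / (1 + k / m n * R) / (γ / p n))) + Nn n) atTop
      (𝓝 (α * (-Real.log (k * δ / (α * γ)) + (-1 + k * δ / (α * γ))) + N)) :=
    (hm.mul (((hr.log hy.ne').neg).add (hr.const_add _))).add hN
  have e : α * (-Real.log (k * δ / (α * γ)) + (-1 + k * δ / (α * γ))) + N
      = N + α * logGap (k * δ / (α * γ)) := by rw [logGap]; ring
  rw [e] at hlim
  refine hlim.congr' ?_
  filter_upwards [hr.eventually_const_lt hy] with n hrn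
  have e2 : γ / p n / (k / m n / (1 + k / m n * R))
      = (k / m n / (1 + k / m n * R) / (γ / p n))⁻¹ := (inv_div _ _).symm
  rw [e2, Real.log_mul (inv_ne_zero hrn.ne') (Real.exp_pos _).ne', Real.log_exp, Real.log_inv]

/-- The condition `θ + kδ/γ = α` is stationarity in `k` of the upper exponent. It fixes the limit of
the shifted Gamma parameter divided by `n`, and makes the Stirling terms collapse to the same
`logGap`. -/
theorem tendsto_lower_exponent {m p : ℕ → ℕ} {α δ γ k β N θ : ℝ} {Nn θn : ℕ → ℝ} (hα : 0 < α)
    (hδ : 0 < δ) (hγ : 0 < γ) (hk : 0 < k) (hβ : 0 < β)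
    (hm : Tendsto (fun n => (m n : ℝ) / n) atTop (𝓝 α))
    (hp : Tendsto (fun n => (p n : ℝ) / n) atTop (𝓝 δ))
    (hN : Tendsto Nn atTop (𝓝 N)) (hθ : Tendsto θn atTop (𝓝 θ))
    (hk' : θ + k * δ / γ = α) :
    Tendsto (fun n : ℕ => (n : ℝ)⁻¹ * (-(β / 2) * (n * Nn n)
        + -(β / 2 * (n * θn n)) * Real.log (2 * (γ / p n) / (β * k))
        + (Real.log (Real.exp 1 * ((β * m n / 2 - β / 2 * (n * θn n)) + 1) /
            (β * m n / 2 - β / 2 * (n * θn n)) * (β * m n / 2))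
          + ((β * m n / 2 - β / 2 * (n * θn n)) *
              Real.log (β * m n / 2 - β / 2 * (n * θn n)) - (β * m n / 2 - β / 2 * (n * θn n))
            - (β * m n / 2 * Real.log (β * m n / 2) - β * m n / 2))))) atTop
      (𝓝 (-(β / 2) * (N + α * logGap (k * δ / (α * γ))))) := by
  set y := k * δ / (α * γ) with hydef
  have hy : 0 < y := by positivity
  -- Stationarity, rewritten: the Gamma parameters `a` and `a - B` grow like `n A` and `n A y`.
  have hαy : α * y = α - θ := by
    have : α * y = k * δ / γ := by rw [hydef]; field_simp
    linarith
  set A := β * α / 2 with hA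
  have hA0 : 0 < A := by positivity
  have hX0 : 0 < A * y := by positivity
  have ha : Tendsto (fun n : ℕ => β * ((m n : ℝ) / n) / 2) atTop (𝓝 A) :=
    (hm.const_mul β).div_const 2
  have hx : Tendsto (fun n : ℕ => β * ((m n : ℝ) / n) / 2 - β / 2 * θn n) atTop (𝓝 (A * y)) := by
    have : A * y = A - β / 2 * θ := by rw [hA]; linear_combination (β / 2) * hαy
    rw [this]
    exact ha.sub (hθ.const_mul _)
  have hn : Tendsto (fun n : ℕ => (n : ℝ)⁻¹) atTop (𝓝 0) := tendsto_inv_atTop_nhds_zero_nat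
  have hlogn : Tendsto (fun n : ℕ => (n : ℝ)⁻¹ * Real.log n) atTop (𝓝 0) := by
    have h1 := Real.isLittleO_log_id_atTop.tendsto_div_nhds_zero.comp tendsto_natCast_atTop_atTop
    refine h1.congr fun n => ?_
    simp only [Function.comp, id]
    ring
  have hlim : Tendsto (fun n : ℕ => -(β / 2) * Nn n
      - β / 2 * θn n * (Real.log (2 * γ / (β * k)) - Real.log ((p n : ℝ) / n))
      + ((n : ℝ)⁻¹ * (1 + Real.log (1 + (n : ℝ)⁻¹ / (β * ((m n : ℝ) / n) / 2 - β / 2 * θn n))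
          + Real.log (β * ((m n : ℝ) / n) / 2)) + (n : ℝ)⁻¹ * Real.log n)
      + ((β * ((m n : ℝ) / n) / 2 - β / 2 * θn n) *
          Real.log (β * ((m n : ℝ) / n) / 2 - β / 2 * θn n)
        - (β * ((m n : ℝ) / n) / 2 - β / 2 * θn n)
        - (β * ((m n : ℝ) / n) / 2 * Real.log (β * ((m n : ℝ) / n) / 2)
          - β * ((m n : ℝ) / n) / 2))) atTop
      (𝓝 (-(β / 2) * N - β / 2 * θ * (Real.log (2 * γ / (β * k)) - Real.log δ)
        + (0 * (1 + Real.log (1 + 0 / (A * y)) + Real.log A) + 0)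
        + (A * y * Real.log (A * y) - A * y - (A * Real.log A - A)))) := by
    refine Tendsto.add (Tendsto.add (Tendsto.sub (hN.const_mul _) ?_) ?_) ?_
    · exact (hθ.const_mul _).mul ((hp.log hδ.ne').const_sub _)
    · refine (hn.mul (Tendsto.add (Tendsto.const_add _ ?_) (ha.log hA0.ne'))).add hlogn
      exact ((hn.div hx hX0.ne').const_add 1).log (by simp)
    · exact ((hx.mul (hx.log hX0.ne')).sub hx).sub ((ha.mul (ha.log hA0.ne')).sub ha)
  have e : -(β / 2) * N - β / 2 * θ * (Real.log (2 * γ / (β * k)) - Real.log δ)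
        + (0 * (1 + Real.log (1 + 0 / (A * y)) + Real.log A) + 0)
        + (A * y * Real.log (A * y) - A * y - (A * Real.log A - A))
      = -(β / 2) * (N + α * logGap y) := by
    -- Here `A y = βkδ/(2γ)`. Hence the terms in `ln A` cancel and `A ln y - A y + A` remains.
    have h1 : Real.log (2 * γ / (β * k)) - Real.log δ = -(Real.log A + Real.log y) := by
      rw [← Real.log_div (by positivity) hδ.ne', ← Real.log_mul hA0.ne' hy.ne', ← Real.log_inv]
      congr 1
      rw [hA, hydef]
      field_simp
    rw [h1, Real.log_mul hA0.ne' hy.ne', logGap]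
    have h2 : θ = α - α * y := by linarith
    rw [h2, hA]
    ring
  rw [e] at hlim
  refine hlim.congr' ?_
  filter_upwards [eventually_gt_atTop 0, hm.eventually_const_lt hα, hp.eventually_const_lt hδ,
    hx.eventually_const_lt hX0] with n hn0 hmn hpn hxn
  have hn0' : (0 : ℝ) < n := by exact_mod_cast hn0
  set a' := β * ((m n : ℝ) / n) / 2 with ha'
  have ha0 : 0 < a' := by positivity
  set x' := a' - β / 2 * θn n with hx'
  set z := (p n : ℝ) / n with hz
  have e1 : β * m n / 2 = n * a' := by rw [ha']; field_simp
  have e2 : β * m n / 2 - β / 2 * (n * θn n) = n * x' := by rw [e1, hx']; ring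
  have e3 : Real.log (2 * (γ / p n) / (β * k))
      = Real.log (2 * γ / (β * k)) - Real.log z - Real.log n := by
    have : 2 * (γ / p n) / (β * k) = 2 * γ / (β * k) / z / n := by
      rw [hz]
      have : (p n : ℝ) ≠ 0 := by
        intro h; rw [hz, h] at hpn; simp at hpn
      field_simp
    rw [this, Real.log_div (by positivity) hn0'.ne', Real.log_div (by positivity) hpn.ne']
  have e4 : Real.log (Real.exp 1 * (n * x' + 1) / (n * x') * (n * a'))
      = 1 + Real.log (1 + (n : ℝ)⁻¹ / x') + Real.log a' + Real.log n := by
    have : Real.exp 1 * (n * x' + 1) / (n * x') * (n * a')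
        = Real.exp 1 * (1 + (n : ℝ)⁻¹ / x') * a' * n := by field_simp
    rw [this, Real.log_mul (by positivity) hn0'.ne', Real.log_mul (by positivity) ha0.ne',
      Real.log_mul (by positivity) (by positivity), Real.log_exp]
  rw [e2, e1, e3, e4, Real.log_mul hn0'.ne' hxn.ne', Real.log_mul hn0'.ne' ha0.ne']
  have e5 : (n : ℝ)⁻¹ * n = 1 := inv_mul_cancel₀ hn0'.ne'
  -- This identity cancels all terms of order `ln n`; only `(ln n)/n` survives.
  have e6 : β / 2 * θn n = a' - x' := by rw [hx']; ring
  generalize Real.log (n : ℝ) = ln at *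
  have : ∀ v : ℝ, (n : ℝ)⁻¹ * (n * v) = v := fun v => by rw [← mul_assoc, e5, one_mul]
  calc _ = -(β / 2) * Nn n - β / 2 * θn n * (Real.log (2 * γ / (β * k)) - Real.log z - ln)
      + ((n : ℝ)⁻¹ * (1 + Real.log (1 + (n : ℝ)⁻¹ / x') + Real.log a' + ln))
      + (x' * (ln + Real.log x') - x' - (a' * (ln + Real.log a') - a')) := by
        linear_combination (-ln) * e6
    _ = _ := by
        field_simp
        ring

end Asymptotics

/-! ### From conditional moments to events of positive probability -/

section Probability

/-- If `D_n(B_n) = E_W H_n(W, B_n)` is almost surely eventually at most `d_n`, then `H_n(W_n, B_n)`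
is at most `t_n` with probability at least about `1 - d_n / t_n`. -/
theorem eventually_measure_le_of_lintegral_le {Ω : Type*} [MeasurableSpace Ω] (P : Measure Ω)
    [IsProbabilityMeasure P] {X Y : ℕ → Type*} [∀ n, MeasurableSpace (X n)]
    [∀ n, MeasurableSpace (Y n)] {W : (n : ℕ) → Ω → X n} {B : (n : ℕ) → Ω → Y n}
    (hW : ∀ n, AEMeasurable (W n) P) (hB : ∀ n, Measurable (B n))
    (hind : ∀ n, IndepFun (W n) (B n) P) {H : (n : ℕ) → X n → Y n → ℝ≥0∞}
    (hH : ∀ n, Measurable (Function.uncurry (H n))) {d t : ℕ → ℝ≥0∞}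
    (ht : ∀ n, t n ≠ 0) (ht' : ∀ n, t n ≠ ∞)
    (hd : ∀ᵐ ω ∂P, ∀ᶠ n in atTop, ∫⁻ w, H n w (B n ω) ∂(P.map (W n)) ≤ d n)
    {ε : ℝ≥0∞} (hε : 0 < ε) :
    ∀ᶠ n in atTop, P {ω | t n ≤ H n (W n ω) (B n ω)} ≤ d n / t n + ε := by
  have hprob : ∀ n, IsProbabilityMeasure (P.map (W n)) := fun n =>
    Measure.isProbabilityMeasure_map (hW n)
  have hD : ∀ n, Measurable fun b => ∫⁻ w, H n w b ∂(P.map (W n)) := fun n =>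
    Measurable.lintegral_prod_left' (hH n)
  have hS : ∀ n, MeasurableSet {ω | ¬ ∫⁻ w, H n w (B n ω) ∂(P.map (W n)) ≤ d n} := fun n =>
    ((measurableSet_Iic (a := d n)).preimage ((hD n).comp (hB n))).compl
  -- An inequality that almost surely holds eventually fails at index `n` with probability tending
  -- to zero. On the complement, Markov's inequality is used for each fixed value of `B_n`.
  have h1 : Tendsto (fun n => P {ω | ¬ ∫⁻ w, H n w (B n ω) ∂(P.map (W n)) ≤ d n}) atTop
      (𝓝 0) := by
    rw [← measure_empty (μ := P)]
    refine tendsto_measure_of_ae_tendsto_indicator_of_isFiniteMeasure atTop MeasurableSet.empty hS ?_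
    filter_upwards [hd] with ω hω
    filter_upwards [hω] with n hn
    simp [hn]
  filter_upwards [h1.eventually_le_const hε] with n hn
  have h2 : {ω | t n ≤ H n (W n ω) (B n ω)} ⊆
      {ω | ∫⁻ w, H n w (B n ω) ∂(P.map (W n)) ≤ d n ∧ t n ≤ H n (W n ω) (B n ω)}
      ∪ {ω | ¬ ∫⁻ w, H n w (B n ω) ∂(P.map (W n)) ≤ d n} := by
    intro ω hω
    by_cases h : ∫⁻ w, H n w (B n ω) ∂(P.map (W n)) ≤ d n
    · exact Or.inl ⟨h, hω⟩
    · exact Or.inr h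
  refine (measure_mono h2).trans ((measure_union_le _ _).trans (add_le_add ?_ hn))
  have hprod := (indepFun_iff_map_prod_eq_prod_map_map (hW n) (hB n).aemeasurable).mp (hind n)
  set E : Set (X n × Y n) := {x | ∫⁻ w, H n w x.2 ∂(P.map (W n)) ≤ d n ∧ t n ≤ H n x.1 x.2}
    with hE
  have hEm : MeasurableSet E :=
    ((measurableSet_Iic (a := d n)).preimage ((hD n).comp measurable_snd)).inter
      ((measurableSet_Ici (a := t n)).preimage (hH n))
  have h3 : P {ω | ∫⁻ w, H n w (B n ω) ∂(P.map (W n)) ≤ d n ∧ t n ≤ H n (W n ω) (B n ω)}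
      = (P.map (fun ω => (W n ω, B n ω))) E := by
    rw [Measure.map_apply_of_aemeasurable ((hW n).prodMk (hB n).aemeasurable) hEm]
    rfl
  have hprobB : IsProbabilityMeasure (P.map (B n)) :=
    Measure.isProbabilityMeasure_map (hB n).aemeasurable
  rw [h3, hprod, Measure.prod_apply_symm hEm]
  calc ∫⁻ b, (P.map (W n)) ((fun x => (x, b)) ⁻¹' E) ∂(P.map (B n))
      ≤ ∫⁻ _, d n / t n ∂(P.map (B n)) := by
        refine lintegral_mono fun b => ?_
        by_cases hb : ∫⁻ w, H n w b ∂(P.map (W n)) ≤ d n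
        · have h4 : (fun x => (x, b)) ⁻¹' E ⊆ {w | t n ≤ H n w b} := fun w hw => hw.2
          refine (measure_mono h4).trans ?_
          refine (meas_ge_le_lintegral_div
            ((hH n).comp measurable_prodMk_right).aemeasurable (ht n) (ht' n)).trans ?_
          exact ENNReal.div_le_div_right hb _
        · have h4 : (fun x => (x, b)) ⁻¹' E = ∅ := by
            ext w; simp [hE, hb]
          rw [h4]; simp
    _ = d n / t n := by simp

/-- If events have probability bounded away from one, then a generic outcome avoids infinitely many
of them. -/
theorem exists_frequently_notMem {Ω : Type*} [MeasurableSpace Ω] (P : Measure Ω)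
    [IsProbabilityMeasure P] {A : ℕ → Set Ω} {q : ℝ≥0∞} (hq : q < 1)
    (hA : ∀ᶠ n in atTop, P (A n) ≤ q) {G : Ω → Prop} (hG : ∀ᵐ ω ∂P, G ω) :
    ∃ ω, G ω ∧ ∃ᶠ n in atTop, ω ∉ A n := by
  by_contra hcon
  push Not at hcon
  -- Otherwise almost every outcome lies in the inferior limit of the events. That set is an
  -- increasing union of sets of probability at most `q < 1`, so it cannot have probability one.
  have h1 : ∀ᵐ ω ∂P, ω ∈ ⋃ N : ℕ, ⋂ n ≥ N, A n := by
    filter_upwards [hG] with ω hω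
    have h2 := hcon ω hω
    rw [eventually_atTop] at h2
    obtain ⟨N, hN⟩ := h2
    simp only [Set.mem_iUnion, Set.mem_iInter]
    exact ⟨N, fun n hn => by simpa using hN n hn⟩
  have h3 : P (⋃ N : ℕ, ⋂ n ≥ N, A n) = 1 := by
    have h5 : (⋃ N : ℕ, ⋂ n ≥ N, A n) =ᵐ[P] Set.univ := eventuallyEq_univ.mpr h1
    rw [measure_congr h5, measure_univ]
  have hmono : Monotone fun N : ℕ => ⋂ n ≥ N, A n := by
    intro N M hNM
    refine Set.iInter₂_mono' fun n hn => ⟨n, hNM.trans hn, le_rfl⟩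
  rw [hmono.measure_iUnion] at h3
  have h4 : ⨆ N : ℕ, P (⋂ n ≥ N, A n) ≤ q := by
    refine iSup_le fun N => ?_
    obtain ⟨n, hn, hnN⟩ := (hA.and (eventually_ge_atTop N)).exists
    exact (measure_mono (Set.iInter₂_subset n hnN)).trans hn
  rw [h3] at h4
  exact absurd hq (not_lt.mpr h4)

end Probability

/-! ### Conditional moments of the product matrix -/

section GaussianMatrix

open scoped ComplexOrder

variable {𝕜 : Type*} [RCLike 𝕜]

/-- The law of a matrix with i.i.d. entries of law `N_β(0,1)`. -/
def gaussianMatrix (𝕜 : Type*) [RCLike 𝕜] (m p : ℕ) : Measure (Matrix (Fin m) (Fin p) 𝕜) :=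
  (Measure.pi fun _ : Fin m => Measure.pi fun _ : Fin p => betaGaussian 𝕜 :
    Measure (Fin m → Fin p → 𝕜))

theorem aemeasurable_gaussianMatrix {Ω : Type*} [MeasurableSpace Ω] {P : Measure Ω} {m p : ℕ}
    {W : Ω → Matrix (Fin m) (Fin p) 𝕜} (hW : IsGaussianMatrix P W) : AEMeasurable W P :=
  aemeasurable_pi_lambda _ fun i => aemeasurable_pi_lambda _ fun j => (hW.law i j).aemeasurable

theorem map_gaussianMatrix {Ω : Type*} [MeasurableSpace Ω] {P : Measure Ω} [IsProbabilityMeasure P]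
    {m p : ℕ} {W : Ω → Matrix (Fin m) (Fin p) 𝕜} (hW : IsGaussianMatrix P W) :
    P.map W = gaussianMatrix 𝕜 m p := by
  have hmeas : ∀ ij : Fin m × Fin p, AEMeasurable (fun ω => W ω ij.1 ij.2) P := fun ij =>
    (hW.law ij.1 ij.2).aemeasurable
  have h1 := (iIndepFun_iff_map_fun_eq_pi_map hmeas).mp hW.indep
  simp only [fun ij : Fin m × Fin p => (hW.law ij.1 ij.2).map_eq] at h1
  have hunc : Measurable fun (w : Fin m → Fin p → 𝕜) (ij : Fin m × Fin p) => w ij.1 ij.2 := by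
    fun_prop
  have hcur : Measurable fun (v : Fin m × Fin p → 𝕜) (i : Fin m) (j : Fin p) => v (i, j) := by
    fun_prop
  have h2 : (Measure.pi fun _ : Fin m × Fin p => betaGaussian 𝕜)
      = (Measure.pi fun _ : Fin m => Measure.pi fun _ : Fin p => betaGaussian 𝕜).map
        (fun w ij => w ij.1 ij.2) := by
    refine Measure.pi_eq fun s hs => ?_
    rw [Measure.map_apply hunc (MeasurableSet.univ_pi hs)]
    have : (fun (w : Fin m → Fin p → 𝕜) (ij : Fin m × Fin p) => w ij.1 ij.2) ⁻¹' Set.univ.pi s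
        = Set.univ.pi fun i => Set.univ.pi fun j => s (i, j) := by
      ext w
      simp only [Set.mem_preimage, Set.mem_univ_pi, Prod.forall]
    rw [this, Measure.pi_pi]
    simp only [Measure.pi_pi]
    rw [Fintype.prod_prod_type]
  have h3 : P.map W = (P.map fun ω (ij : Fin m × Fin p) => W ω ij.1 ij.2).map
      (fun v i j => v (i, j)) := by
    rw [AEMeasurable.map_map_of_aemeasurable hcur.aemeasurable (aemeasurable_pi_lambda _ hmeas)]
    rfl
  rw [h3, h1, h2, Measure.map_map hcur hunc]
  exact Measure.map_id

variable {n m p : ℕ}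

theorem eigenvalues_eq_gramEigenvalues (b : Matrix (Fin p) (Fin n) 𝕜)
    {H : Matrix (Fin n) (Fin n) 𝕜} (hH : H.IsHermitian) (h : H = gram b) :
    hH.eigenvalues = gramEigenvalues b := by
  subst h; rfl

theorem lintegral_det_gram_le (b : Matrix (Fin p) (Fin n) 𝕜) {γ k R : ℝ} (hm : 0 < m)
    (hp : 0 < p) (hγ : 0 < γ) (hk : 0 < k) (hR0 : 0 < R) (hR : ∀ i, gramEigenvalues b i ≤ R) :
    ∫⁻ w, ENNReal.ofReal (RCLike.re (1 + γ • gram ((√p)⁻¹ • (w * b))).det)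
        ∂(gaussianMatrix 𝕜 m p)
      ≤ ENNReal.ofReal (Real.exp (m * Real.log (γ / p / (k / m / (1 + k / m * R)) *
        Real.exp (-1 + k / m / (1 + k / m * R) / (γ / p)))
        + ∑ i, Real.log (1 + k * gramEigenvalues b i))) := by
  have hm0 : (0 : ℝ) < m := by exact_mod_cast hm
  have hp0 : (0 : ℝ) < p := by exact_mod_cast hp
  have hH := (Matrix.posSemidef_conjTranspose_mul_self ((√n)⁻¹ • b)).1
  have hb := re_conjTranspose_mulVec_le ((√n)⁻¹ • b) hH hR0 (by
    rw [eigenvalues_eq_gramEigenvalues b hH (gram_eq b).symm]; exact hR)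
  have h := lintegral_det_add_sum_rowGram_le ((√n)⁻¹ • b) hR0.le (Δ := k / m) (c := γ / p)
    (by positivity) (by positivity) hb m Matrix.PosDef.one (by simpa using Matrix.PosSemidef.zero)
  rw [← gram_eq, mul_div_cancel₀ _ hm0.ne', ← ENNReal.ofReal_pow (by positivity),
    ← ENNReal.ofReal_mul (by positivity)] at h
  refine le_trans (le_of_eq ?_) (h.trans (le_of_eq ?_))
  · refine lintegral_congr fun w => ?_
    rw [gram_smul_mul, smul_smul, div_eq_mul_inv]
  · congr 1
    rw [Real.exp_add (m * Real.log _), ← log_re_det_one_add_smul_gram b hk.le,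
      Real.exp_log (re_det_one_add_smul_gram_pos b hk.le), ← Real.log_pow, Real.exp_log]
    positivity

/-- The Gamma quotient is replaced by its Stirling bound, so that the whole estimate is a single
exponential. The hypothesis `hx` is positivity of the shifted Gamma parameter. -/
theorem lintegral_det_gram_rpow_le (b : Matrix (Fin p) (Fin n) 𝕜) {γ k : ℝ} (hm : 0 < m)
    (hp : 0 < p) (hγ : 0 < γ) (hk : 0 < k)
    (hx : betaDim 𝕜 / 2 * ∑ i, k * gramEigenvalues b i / (1 + k * gramEigenvalues b i)
      < betaDim 𝕜 * m / 2) :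
    ∫⁻ w, ENNReal.ofReal (RCLike.re (1 + γ • gram ((√p)⁻¹ • (w * b))).det ^ (-(betaDim 𝕜 / 2)))
        ∂(gaussianMatrix 𝕜 m p)
      ≤ ENNReal.ofReal (Real.exp (-(betaDim 𝕜 / 2) * ∑ i, Real.log (1 + k * gramEigenvalues b i)
        + -(betaDim 𝕜 / 2 * ∑ i, k * gramEigenvalues b i / (1 + k * gramEigenvalues b i))
            * Real.log (2 * (γ / p) / (betaDim 𝕜 * k))
        + (Real.log (Real.exp 1 * ((betaDim 𝕜 * m / 2 - betaDim 𝕜 / 2 * ∑ i, k *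
              gramEigenvalues b i / (1 + k * gramEigenvalues b i)) + 1) /
            (betaDim 𝕜 * m / 2 - betaDim 𝕜 / 2 * ∑ i, k * gramEigenvalues b i /
              (1 + k * gramEigenvalues b i)) * (betaDim 𝕜 * m / 2))
          + ((betaDim 𝕜 * m / 2 - betaDim 𝕜 / 2 * ∑ i, k * gramEigenvalues b i /
                (1 + k * gramEigenvalues b i)) *
              Real.log (betaDim 𝕜 * m / 2 - betaDim 𝕜 / 2 * ∑ i, k * gramEigenvalues b i /
                (1 + k * gramEigenvalues b i))
              - (betaDim 𝕜 * m / 2 - betaDim 𝕜 / 2 * ∑ i, k * gramEigenvalues b i /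
                (1 + k * gramEigenvalues b i))
            - (betaDim 𝕜 * m / 2 * Real.log (betaDim 𝕜 * m / 2) - betaDim 𝕜 * m / 2))))) := by
  have hβ := betaDim_pos 𝕜
  have hm0 : (0 : ℝ) < m := by exact_mod_cast hm
  have hp0 : (0 : ℝ) < p := by exact_mod_cast hp
  set a := betaDim 𝕜 * m / 2 with ha
  set B := betaDim 𝕜 / 2 * ∑ i, k * gramEigenvalues b i / (1 + k * gramEigenvalues b i) with hB
  have he := eigenvalues_eq_gramEigenvalues b
    (Matrix.posSemidef_conjTranspose_mul_self ((√n)⁻¹ • b)).1 (gram_eq b).symm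
  have h := lintegral_det_rpow_le ((√n)⁻¹ • b) (c := γ / p) (by positivity) hk hm he.symm ha hB hx
  have ha0 : 0 < a := by positivity
  have hG := Gamma_div_Gamma_le ha0 (sub_pos.mpr hx)
  have hx0 : 0 < a - B := sub_pos.mpr hx
  refine le_trans (le_of_eq ?_) (h.trans (ENNReal.ofReal_le_ofReal ?_))
  · refine lintegral_congr fun w => ?_
    rw [gram_smul_mul, smul_smul, div_eq_mul_inv γ]
  · rw [Real.exp_add, Real.exp_add, Real.exp_add (Real.log _), Real.exp_log (by positivity),
      Real.rpow_def_of_pos (by positivity), mul_comm (Real.log _) (-B)]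
    gcongr

/-- An exact first moment. It later prevents mass of the logarithmic moment from escaping to large
eigenvalues. -/
theorem lintegral_trace_gram (b : Matrix (Fin p) (Fin n) 𝕜) :
    ∫⁻ w, ENNReal.ofReal (RCLike.re (gram ((√p)⁻¹ • (w * b))).trace) ∂(gaussianMatrix 𝕜 m p)
      = ENNReal.ofReal (m / p * ∑ i, gramEigenvalues b i) := by
  set b' := (√n)⁻¹ • b with hb'
  have hT : (b' * b'ᴴ)ᵀ.PosSemidef := (Matrix.posSemidef_self_mul_conjTranspose b').transpose
  have h0 : ∀ w : Fin p → 𝕜, 0 ≤ RCLike.re (star w ⬝ᵥ ((b' * b'ᴴ)ᵀ *ᵥ w)) := fun w =>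
    (RCLike.nonneg_iff.mp (hT.dotProduct_mulVec_nonneg w)).1
  have e : ∀ w : Matrix (Fin m) (Fin p) 𝕜,
      ENNReal.ofReal (RCLike.re (gram ((√p)⁻¹ • (w * b))).trace)
      = ENNReal.ofReal (p : ℝ)⁻¹ *
        ∑ μ, ENNReal.ofReal (RCLike.re (star (w μ) ⬝ᵥ ((b' * b'ᴴ)ᵀ *ᵥ (w μ)))) := by
    intro w
    rw [gram_smul_mul, Matrix.trace_smul, Matrix.trace_sum, RCLike.smul_re, map_sum,
      ENNReal.ofReal_mul (by positivity)]
    refine congrArg _ (Eq.trans (congrArg _ (Finset.sum_congr rfl fun μ _ => ?_))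
      (ENNReal.ofReal_sum_of_nonneg (f := fun μ => RCLike.re (star (w μ) ⬝ᵥ ((b' * b'ᴴ)ᵀ *ᵥ (w μ))))
        fun i _ => h0 _))
    exact congrArg _ (trace_rowGram b' (w μ))
  have hmeas : Measurable fun w : Fin p → 𝕜 =>
      ENNReal.ofReal (RCLike.re (star w ⬝ᵥ ((b' * b'ᴴ)ᵀ *ᵥ w))) := by
    have : Continuous fun w : Fin p → 𝕜 => RCLike.re (star w ⬝ᵥ ((b' * b'ᴴ)ᵀ *ᵥ w)) := by
      fun_prop
    exact this.measurable.ennreal_ofReal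
  have hs : 0 ≤ ∑ i, gramEigenvalues b i := Finset.sum_nonneg fun i _ => gramEigenvalues_nonneg b i
  simp_rw [e]
  rw [lintegral_const_mul' _ _ ENNReal.ofReal_ne_top, gaussianMatrix]
  have h1 : ∫⁻ w : Fin m → Fin p → 𝕜, ∑ μ, ENNReal.ofReal (RCLike.re
      (star (w μ) ⬝ᵥ ((b' * b'ᴴ)ᵀ *ᵥ (w μ))))
      ∂(Measure.pi fun _ : Fin m => Measure.pi fun _ : Fin p => betaGaussian 𝕜)
      = m * ENNReal.ofReal (∑ i, gramEigenvalues b i) := by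
    have hm' : ∀ μ : Fin m, Measurable fun w : Fin m → Fin p → 𝕜 => ENNReal.ofReal (RCLike.re
        (star (w μ) ⬝ᵥ ((b' * b'ᴴ)ᵀ *ᵥ (w μ)))) := fun μ => hmeas.comp (measurable_pi_apply μ)
    rw [lintegral_finsetSum _ fun μ _ => hm' μ]
    have h2 : ∀ μ : Fin m, ∫⁻ w : Fin m → Fin p → 𝕜, ENNReal.ofReal (RCLike.re
        (star (w μ) ⬝ᵥ ((b' * b'ᴴ)ᵀ *ᵥ (w μ))))
        ∂(Measure.pi fun _ : Fin m => Measure.pi fun _ : Fin p => betaGaussian 𝕜)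
        = ENNReal.ofReal (∑ i, gramEigenvalues b i) := by
      intro μ
      rw [← lintegral_map hmeas (measurable_pi_apply μ), Measure.pi_map_eval]
      simp only [measure_univ, Finset.prod_const_one, one_smul]
      rw [lintegral_re_quadForm hT, Matrix.trace_transpose, Matrix.trace_mul_comm, ← gram_eq,
        re_trace_gram]
    simp only [h2, Finset.sum_const, Finset.card_univ, Fintype.card_fin, nsmul_eq_mul]
  refine (congrArg _ h1).trans ?_
  rw [← ENNReal.ofReal_natCast m, ← ENNReal.ofReal_mul (by positivity),
    ← ENNReal.ofReal_mul (by positivity)]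
  congr 1
  ring

theorem measurable_re_det_gram (γ : ℝ) : Measurable
    (fun M : Matrix (Fin m) (Fin n) 𝕜 => RCLike.re (1 + γ • gram M).det) := by
  have h := continuous_gram (𝕜 := 𝕜) (k := m) (n := n)
  have : Continuous (fun M : Matrix (Fin m) (Fin n) 𝕜 => RCLike.re (1 + γ • gram M).det) := by
    fun_prop
  have hb : BorelSpace (Matrix (Fin m) (Fin n) 𝕜) :=
    inferInstanceAs (BorelSpace (Fin m → Fin n → 𝕜))
  exact this.measurable

theorem measurable_re_trace_gram : Measurable
    (fun M : Matrix (Fin m) (Fin n) 𝕜 => RCLike.re (gram M).trace) := by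
  have h := continuous_gram (𝕜 := 𝕜) (k := m) (n := n)
  have : Continuous (fun M : Matrix (Fin m) (Fin n) 𝕜 => RCLike.re (gram M).trace) := by
    fun_prop
  have hb : BorelSpace (Matrix (Fin m) (Fin n) 𝕜) :=
    inferInstanceAs (BorelSpace (Fin m → Fin n → 𝕜))
  exact this.measurable

theorem measurable_smul_mul (c : ℝ) : Measurable
    (fun x : Matrix (Fin m) (Fin p) 𝕜 × Matrix (Fin p) (Fin n) 𝕜 => c • (x.1 * x.2)) := by
  have : Continuous
    (fun x : Matrix (Fin m) (Fin p) 𝕜 × Matrix (Fin p) (Fin n) 𝕜 => c • (x.1 * x.2)) := by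
    fun_prop
  have hb : BorelSpace (Matrix (Fin m) (Fin n) 𝕜) :=
    inferInstanceAs (BorelSpace (Fin m → Fin n → 𝕜))
  have hb : BorelSpace (Matrix (Fin m) (Fin p) 𝕜 × Matrix (Fin p) (Fin n) 𝕜) :=
    inferInstanceAs (BorelSpace ((Fin m → Fin p → 𝕜) × (Fin p → Fin n → 𝕜)))
  exact this.measurable

end GaussianMatrix

/-! ### Transfer of conditional moment bounds to the sensing matrix -/

section LimitingSpectrum

variable {𝕜 : Type*} [RCLike 𝕜] {Ω : Type*} [MeasurableSpace Ω] {P : Measure Ω}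
  [IsProbabilityMeasure P] {α δ : ℝ} {m p : ℕ → ℕ}
  {Φ : (n : ℕ) → Ω → Matrix (Fin (m n)) (Fin n) 𝕜}
  {W : (n : ℕ) → Ω → Matrix (Fin (m n)) (Fin (p n)) 𝕜}
  {B : (n : ℕ) → Ω → Matrix (Fin (p n)) (Fin n) 𝕜}
  {νB ν : Measure ℝ}

theorem eventually_pos_of_tendsto_div {a : ℝ} (ha : 0 < a) {m : ℕ → ℕ}
    (hm : Tendsto (fun n => (m n : ℝ) / n) atTop (𝓝 a)) : ∀ᶠ n in atTop, 0 < m n := by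
  filter_upwards [hm.eventually_const_lt ha] with n hn
  rcases Nat.eq_zero_or_pos (m n) with h | h
  · rw [h] at hn; simp at hn
  · exact h

theorem ae_nonneg_of_hasLimitingSpectrum {k : ℕ → ℕ}
    {M : (n : ℕ) → Ω → Matrix (Fin (k n)) (Fin n) 𝕜} [IsProbabilityMeasure ν]
    (h : HasLimitingSpectrum P M ν) : ∀ᵐ x ∂ν, 0 ≤ x := by
  obtain ⟨ω, hω⟩ := h.exists
  exact ae_nonneg_of_tendsto hω

/-- Transfer of moment bounds along the product structure. -/
theorem eventually_measure_le (hprod : ProductStructure P α δ m p Φ W B)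
    {H : (n : ℕ) → Matrix (Fin (m n)) (Fin n) 𝕜 → ℝ≥0∞} (hH : ∀ n, Measurable (H n))
    {d t : ℕ → ℝ≥0∞} (ht : ∀ n, t n ≠ 0) (ht' : ∀ n, t n ≠ ∞)
    (hd : ∀ᵐ ω ∂P, ∀ᶠ n in atTop,
      ∫⁻ w, H n ((√(p n))⁻¹ • (w * B n ω)) ∂(gaussianMatrix 𝕜 (m n) (p n)) ≤ d n)
    {ε : ℝ≥0∞} (hε : 0 < ε) :
    ∀ᶠ n in atTop, P {ω | t n ≤ H n (Φ n ω)} ≤ d n / t n + ε := by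
  have h := eventually_measure_le_of_lintegral_le P (W := W) (B := B)
    (fun n => aemeasurable_gaussianMatrix (hprod.gaussian n)) hprod.measurable_B hprod.indep
    (H := fun n w b => H n ((√(p n))⁻¹ • (w * b)))
    (fun n => (hH n).comp (measurable_smul_mul _)) ht ht'
    (by
      filter_upwards [hd] with ω hω
      filter_upwards [hω] with n hn
      rw [map_gaussianMatrix (hprod.gaussian n)]
      exact hn) hε
  filter_upwards [h] with n hn
  have e : P {ω | t n ≤ H n (Φ n ω)}
      = P {ω | t n ≤ H n ((√(p n))⁻¹ • (W n ω * B n ω))} :=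
    (hprod.law n).measure_mem_eq (s := {M | t n ≤ H n M})
      ((hH n) measurableSet_Ici)
  rw [e]
  exact hn

end LimitingSpectrum

/-! ### Logarithmic moments of the limiting spectrum -/

section LimitingSpectrum

variable {𝕜 : Type*} [RCLike 𝕜] {Ω : Type*} [MeasurableSpace Ω] {P : Measure Ω}
  [IsProbabilityMeasure P] {α δ : ℝ} {m p : ℕ → ℕ}
  {Φ : (n : ℕ) → Ω → Matrix (Fin (m n)) (Fin n) 𝕜}
  {W : (n : ℕ) → Ω → Matrix (Fin (m n)) (Fin (p n)) 𝕜}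
  {B : (n : ℕ) → Ω → Matrix (Fin (p n)) (Fin n) 𝕜}
  {νB ν : Measure ℝ}

theorem SpectrumConvergence.exists_bound [IsProbabilityMeasure νB]
    (hB : SpectrumConvergence P B νB) :
    ∃ R : ℝ, 0 < R ∧ (∀ᵐ x ∂νB, 0 ≤ x) ∧ (∀ᵐ x ∂νB, x ≤ R) ∧
      ∀ᵐ ω ∂P, (∀ᶠ n in atTop, ∀ i, gramEigenvalues (B n ω) i ≤ R) ∧
        ∀ f : ℝ → ℝ, ContinuousOn f (Set.Ici 0) →
          Tendsto (fun n : ℕ => (n : ℝ)⁻¹ * ∑ i, f (gramEigenvalues (B n ω) i)) atTop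
            (𝓝 (∫ x, f x ∂νB)) := by
  obtain ⟨R1, hR1, hb⟩ := ae_le_of_compact hB.compact
  obtain ⟨l, hl, htop⟩ := hB.top_eigenvalue
  -- `R1` bounds the support of the limit, while `l + 1` eventually exceeds the top eigenvalue; one
  -- constant serves both purposes.
  have hb' : ∀ᵐ x ∂νB, x ≤ max R1 (l + 1) := by
    filter_upwards [hb] with x hx using hx.trans (le_max_left _ _)
  refine ⟨max R1 (l + 1), by positivity, ae_nonneg_of_hasLimitingSpectrum hB.limit, hb', ?_⟩
  filter_upwards [htop, hB.limit] with ω h1 h2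
  have h3 : ∀ᶠ n in atTop, ∀ i, gramEigenvalues (B n ω) i ≤ max R1 (l + 1) := by
    filter_upwards [h1.eventually_lt_const (lt_add_one l)] with n hn i
    exact ((le_ciSup (Set.finite_range _).bddAbove i).trans hn.le).trans (le_max_right _ _)
  exact ⟨h3, fun f hf => tendsto_spectral_average h2 hb' h3 hf⟩

/-- The gap `c < c'` makes the Markov quotient `e^{n(c - c')}` vanish, so only the exponential rate
of a conditional moment matters. -/
theorem eventually_measure_exp_le (hprod : ProductStructure P α δ m p Φ W B)
    {H : (n : ℕ) → Matrix (Fin (m n)) (Fin n) 𝕜 → ℝ} (hH : ∀ n, Measurable (H n))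
    {c c' : ℝ} (hc : c < c')
    (hd : ∀ᵐ ω ∂P, ∀ᶠ n : ℕ in atTop,
      ∫⁻ w, ENNReal.ofReal (H n ((√(p n))⁻¹ • (w * B n ω))) ∂(gaussianMatrix 𝕜 (m n) (p n))
        ≤ ENNReal.ofReal (Real.exp (n * c))) {ε : ℝ} (hε : 0 < ε) :
    ∀ᶠ n : ℕ in atTop, P {ω | Real.exp (n * c') ≤ H n (Φ n ω)} ≤ ENNReal.ofReal ε := by
  have h := eventually_measure_le hprod (H := fun n M => ENNReal.ofReal (H n M))
    (fun n => (hH n).ennreal_ofReal) (d := fun n => ENNReal.ofReal (Real.exp (n * c)))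
    (t := fun n => ENNReal.ofReal (Real.exp (n * c')))
    (fun n => by simp [Real.exp_pos]) (fun n => ENNReal.ofReal_ne_top) hd
    (ε := ENNReal.ofReal (ε / 2)) (by simpa using hε)
  have hlim : Tendsto (fun n : ℕ => Real.exp (n * (c - c'))) atTop (𝓝 0) := by
    refine Real.tendsto_exp_atBot.comp ?_
    exact tendsto_natCast_atTop_atTop.atTop_mul_const_of_neg (by linarith)
  filter_upwards [h, hlim.eventually_lt_const (half_pos hε)] with n hn h2
  have e : {ω | Real.exp (n * c') ≤ H n (Φ n ω)}
      ⊆ {ω | ENNReal.ofReal (Real.exp (n * c')) ≤ ENNReal.ofReal (H n (Φ n ω))} :=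
    fun ω hω => ENNReal.ofReal_le_ofReal hω
  refine (measure_mono e).trans (hn.trans ?_)
  rw [← ENNReal.ofReal_div_of_pos (Real.exp_pos _), ← Real.exp_sub,
    ← ENNReal.ofReal_add (Real.exp_pos _).le (by positivity)]
  refine ENNReal.ofReal_le_ofReal ?_
  rw [← mul_sub]
  linarith

theorem continuousOn_log_one_add_mul {γ : ℝ} (hγ : 0 ≤ γ) :
    ContinuousOn (fun x : ℝ => Real.log (1 + γ * x)) (Set.Ici 0) := by
  refine ContinuousOn.log (by fun_prop) fun x hx => ?_
  have := mul_nonneg hγ (Set.mem_Ici.mp hx)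
  linarith

theorem continuousOn_mul_div_one_add {k : ℝ} (hk : 0 ≤ k) (c : ℝ) :
    ContinuousOn (fun x : ℝ => c * x / (1 + k * x)) (Set.Ici 0) := by
  refine ContinuousOn.div (by fun_prop) (by fun_prop) fun x hx => ?_
  have := mul_nonneg hk (Set.mem_Ici.mp hx)
  linarith

/-- Upper bound on the logarithmic moment of the limiting spectrum of a product matrix. -/
theorem integral_log_one_add_le [IsProbabilityMeasure νB] [IsProbabilityMeasure ν]
    (hα : 0 < α) (hδ : 0 < δ) (hprod : ProductStructure P α δ m p Φ W B)
    (hB : SpectrumConvergence P B νB) (hν : HasLimitingSpectrum P Φ ν) {R : ℝ}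
    (h0 : ∀ᵐ x ∂ν, 0 ≤ x) (hR : ∀ᵐ x ∂ν, x ≤ R) {γ k : ℝ} (hγ : 0 < γ) (hk : 0 < k) :
    ∫ l, Real.log (1 + γ * l) ∂ν
      ≤ ∫ x, Real.log (1 + k * x) ∂νB + α * logGap (k * δ / (α * γ)) := by
  by_contra! hcon
  -- The conditional moment is at most `e^{nc}`, and Markov's inequality is used at the level
  -- `e^{nc'}`, with `c < c'` still below the supposed logarithmic moment of `ν`.
  obtain ⟨c, hc1, hc2⟩ := exists_between hcon
  obtain ⟨c', hc'1, hc'2⟩ := exists_between hc2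
  obtain ⟨RB, hRB, _, _, hgood⟩ := hB.exists_bound
  have hE := eventually_measure_exp_le hprod
    (H := fun n M => RCLike.re (1 + γ • gram M).det) (fun n => measurable_re_det_gram γ) hc'1 (by
      filter_upwards [hgood] with ω ⟨h1, h2⟩
      have h3 := tendsto_upper_exponent (R := RB) hα hδ hγ hk hprod.tendsto_m hprod.tendsto_p
        (h2 _ (continuousOn_log_one_add_mul hk.le))
      filter_upwards [h1, eventually_pos_of_tendsto_div hα hprod.tendsto_m,
        eventually_pos_of_tendsto_div hδ hprod.tendsto_p, h3.eventually_lt_const hc1,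
        eventually_gt_atTop 0] with n hn hm hp hlt hn0
      refine (lintegral_det_gram_le (B n ω) hm hp hγ hk hRB hn).trans
        (ENNReal.ofReal_le_ofReal (Real.exp_le_exp.mpr ?_))
      have hn0' : (0 : ℝ) < n := by exact_mod_cast hn0
      refine le_trans (le_of_eq ?_) (mul_le_mul_of_nonneg_left hlt.le hn0'.le)
      field_simp) (ε := 1 / 2) (by norm_num)
  obtain ⟨ω, hω, hfr⟩ := exists_frequently_notMem P (q := ENNReal.ofReal (1 / 2))
    (by rw [← ENNReal.ofReal_one]; exact (ENNReal.ofReal_lt_ofReal_iff one_pos).mpr (by norm_num))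
    hE hν
  have hf := continuousOn_log_one_add_mul hγ.le
  have hlim := hω (clampBCF _ hf R)
  rw [integral_clampBCF h0 hR hf] at hlim
  obtain ⟨n, hn1, hn2, hn0⟩ := (hfr.and_eventually
    ((hlim.eventually_const_lt hc'2).and (eventually_gt_atTop 0))).exists
  have hn0' : (0 : ℝ) < n := by exact_mod_cast hn0
  have hpos := re_det_one_add_smul_gram_pos (Φ n ω) hγ.le
  have h1 : Real.log (RCLike.re (1 + γ • gram (Φ n ω)).det) ≤ n * c' := by
    rw [Real.log_le_iff_le_exp hpos]
    exact (not_le.mp hn1).le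
  rw [log_re_det_one_add_smul_gram _ hγ.le] at h1
  rw [integral_empiricalSpectrum] at hn2
  -- Truncating the logarithm at `R` only decreases it, so no control of the top eigenvalue of
  -- `Φ†Φ/n` is needed in this direction.
  have h2 : ∑ i, clampBCF _ hf R (gramEigenvalues (Φ n ω) i)
      ≤ ∑ i, Real.log (1 + γ * gramEigenvalues (Φ n ω) i) := by
    refine Finset.sum_le_sum fun i _ => ?_
    rw [clampBCF_apply]
    have hi := gramEigenvalues_nonneg (Φ n ω) i
    have hle : max 0 (min (gramEigenvalues (Φ n ω) i) (max R 0)) ≤ gramEigenvalues (Φ n ω) i :=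
      max_le hi (min_le_left _ _)
    have hge : 0 ≤ max 0 (min (gramEigenvalues (Φ n ω) i) (max R 0)) := le_max_left _ _
    refine Real.log_le_log (by positivity) ?_
    gcongr
  have h3 : (n : ℝ)⁻¹ * ∑ i, clampBCF _ hf R (gramEigenvalues (Φ n ω) i) ≤ c' := by
    rw [inv_mul_le_iff₀ hn0']
    exact h2.trans h1
  linarith

/-- Beyond `K` the logarithm lies below its tangent at `K`, of slope `γ/(1 + γK)`. This slope
vanishes as `K → ∞`, so a bound on the mean eigenvalue controls the truncation error. -/
theorem log_one_add_mul_le_clamp {γ K x : ℝ} (hγ : 0 < γ) (hK : 0 ≤ K) (hx : 0 ≤ x) :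
    Real.log (1 + γ * x)
      ≤ clampBCF _ (continuousOn_log_one_add_mul hγ.le) K x + γ / (1 + γ * K) * x := by
  have h1 : 0 < 1 + γ * K := by positivity
  rcases le_total x K with h | h
  · rw [clampBCF_eq _ hx h]
    have : 0 ≤ γ / (1 + γ * K) * x := by positivity
    linarith
  · rw [clampBCF_apply, max_eq_left hK, min_eq_right h, max_eq_right hK]
    have h2 : Real.log (1 + γ * x) - Real.log (1 + γ * K) = Real.log ((1 + γ * x) / (1 + γ * K)) :=
      (Real.log_div (by positivity) h1.ne').symm
    have h3 := Real.log_le_sub_one_of_pos (x := (1 + γ * x) / (1 + γ * K)) (by positivity)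
    have h4 : (1 + γ * x) / (1 + γ * K) - 1 ≤ γ / (1 + γ * K) * x := by
      rw [div_sub_one h1.ne', div_mul_eq_mul_div]
      gcongr
      nlinarith
    linarith

/-- Markov's inequality with a threshold four times the conditional mean, plus `1/4` for the
exceptional event. Adding one to `n` and to the mean keeps the threshold positive at every index. -/
theorem eventually_measure_trace_le [IsProbabilityMeasure νB]
    (hprod : ProductStructure P α δ m p Φ W B) (hα : 0 < α) (hδ : 0 < δ)
    (hB : SpectrumConvergence P B νB) :
    ∃ T : ℝ, 0 < T ∧ ∀ᶠ n : ℕ in atTop,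
      P {ω | (n + 1) * T ≤ RCLike.re (gram (Φ n ω)).trace} ≤ ENNReal.ofReal (1 / 2) := by
  obtain ⟨RB, hRB, h0, _, hgood⟩ := hB.exists_bound
  set T := α / δ * ∫ x, x ∂νB with hT
  have hT0 : 0 ≤ T := mul_nonneg (by positivity) (integral_nonneg_of_ae h0)
  refine ⟨4 * (T + 1), by positivity, ?_⟩
  have h := eventually_measure_le hprod
    (H := fun n M => ENNReal.ofReal (RCLike.re (gram M).trace))
    (fun n => measurable_re_trace_gram.ennreal_ofReal)
    (d := fun n => ENNReal.ofReal ((n + 1) * (T + 1)))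
    (t := fun n => ENNReal.ofReal ((n + 1) * (4 * (T + 1))))
    (fun n => by simp; positivity) (fun n => ENNReal.ofReal_ne_top) (by
      filter_upwards [hgood] with ω ⟨_, h2⟩
      have h3 := h2 (fun x => x) (by fun_prop)
      have h4 := ((hprod.tendsto_m.div hprod.tendsto_p hδ.ne').mul h3).eventually_lt_const
        (lt_add_one T)
      filter_upwards [h4, eventually_gt_atTop 0] with n hn hn0
      rw [lintegral_trace_gram]
      refine ENNReal.ofReal_le_ofReal ?_
      have hn0' : (0 : ℝ) < n := by exact_mod_cast hn0
      simp only [Pi.div_apply] at hn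
      have h5 := mul_le_mul_of_nonneg_left hn.le hn0'.le
      have h6 : (n : ℝ) * ((m n / n : ℝ) / (p n / n) * ((n : ℝ)⁻¹ *
          ∑ i, gramEigenvalues (B n ω) i)) = m n / p n * ∑ i, gramEigenvalues (B n ω) i := by
        rw [div_div_div_cancel_right₀ hn0'.ne']
        field_simp
      rw [h6] at h5
      nlinarith)
    (ε := ENNReal.ofReal (1 / 4)) (by simp)
  filter_upwards [h] with n hn
  refine (measure_mono fun ω hω => ENNReal.ofReal_le_ofReal hω).trans (hn.trans ?_)
  have h1 : (0 : ℝ) < (n + 1) * (4 * (T + 1)) := by positivity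
  rw [← ENNReal.ofReal_div_of_pos h1, ← ENNReal.ofReal_add (by positivity) (by norm_num)]
  refine ENNReal.ofReal_le_ofReal (le_of_eq ?_)
  have : (0 : ℝ) < T + 1 := by positivity
  field_simp
  norm_num

/-- Lower bound on the logarithmic moment of the limiting spectrum of a product matrix. -/
theorem le_integral_log_one_add [IsProbabilityMeasure νB] [IsProbabilityMeasure ν]
    (hα : 0 < α) (hδ : 0 < δ) (hprod : ProductStructure P α δ m p Φ W B)
    (hB : SpectrumConvergence P B νB) (hν : HasLimitingSpectrum P Φ ν) {R : ℝ}
    (h0 : ∀ᵐ x ∂ν, 0 ≤ x) (hR : ∀ᵐ x ∂ν, x ≤ R) {γ k : ℝ} (hγ : 0 < γ) (hk : 0 < k)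
    (hkγ : ∫ x, k * x / (1 + k * x) ∂νB + k * δ / γ = α) :
    ∫ x, Real.log (1 + k * x) ∂νB + α * logGap (k * δ / (α * γ))
      ≤ ∫ l, Real.log (1 + γ * l) ∂ν := by
  set L := ∫ x, Real.log (1 + k * x) ∂νB + α * logGap (k * δ / (α * γ)) with hL
  set M := ∫ l, Real.log (1 + γ * l) ∂ν with hM
  have hβ := betaDim_pos 𝕜
  by_contra! hcon
  obtain ⟨c1, hc1, hc1'⟩ := exists_between hcon
  obtain ⟨c2, hc2, hc2'⟩ := exists_between hc1'
  obtain ⟨RB, hRB, _, _, hgood⟩ := hB.exists_bound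
  -- The factor `-β/2` reverses the order of `c1 < c2`. The event being bounded says that the
  -- determinant is at most `e^{n c1}`.
  have hE := eventually_measure_exp_le hprod
    (H := fun n M => RCLike.re (1 + γ • gram M).det ^ (-(betaDim 𝕜 / 2)))
    (fun n => (measurable_re_det_gram γ).pow_const _)
    (c := -(betaDim 𝕜 / 2) * c2) (c' := -(betaDim 𝕜 / 2) * c1) (by nlinarith) (by
      filter_upwards [hgood] with ω ⟨h1, h2⟩
      have hθ := h2 _ (continuousOn_mul_div_one_add hk.le k)
      have h3 := tendsto_lower_exponent hα hδ hγ hk hβ hprod.tendsto_m hprod.tendsto_p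
        (h2 _ (continuousOn_log_one_add_mul hk.le)) hθ hkγ
      -- The stationarity condition forces `θ < α`, hence eventually a positive shifted Gamma
      -- parameter.
      have h4 : ∫ x, k * x / (1 + k * x) ∂νB < α := by
        have : 0 < k * δ / γ := by positivity
        linarith
      have h5 := (hprod.tendsto_m.sub hθ).eventually_const_lt (sub_pos.mpr h4)
      filter_upwards [h1, eventually_pos_of_tendsto_div hα hprod.tendsto_m,
        eventually_pos_of_tendsto_div hδ hprod.tendsto_p,
        h3.eventually_lt_const (u := -(betaDim 𝕜 / 2) * c2) (by nlinarith),
        eventually_gt_atTop 0, h5] with n hn hm hp hlt hn0 hmθ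
      have hn0' : (0 : ℝ) < n := by exact_mod_cast hn0
      have hmθ' : betaDim 𝕜 / 2 * ∑ i, k * gramEigenvalues (B n ω) i /
          (1 + k * gramEigenvalues (B n ω) i) < betaDim 𝕜 * m n / 2 := by
        have h6 := mul_pos hn0' hmθ
        rw [mul_sub, mul_div_cancel₀ _ hn0'.ne', mul_inv_cancel_left₀ hn0'.ne'] at h6
        nlinarith
      refine (lintegral_det_gram_rpow_le (B n ω) hm hp hγ hk hmθ').trans
        (ENNReal.ofReal_le_ofReal (Real.exp_le_exp.mpr ?_))
      have h7 := mul_le_mul_of_nonneg_left hlt.le hn0'.le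
      simp only [mul_inv_cancel_left₀ hn0'.ne'] at h7
      exact h7) (ε := 1 / 4) (by norm_num)
  obtain ⟨T, hT, htr⟩ := eventually_measure_trace_le hprod hα hδ hB
  -- `3/4` is `1/4` for a small determinant plus `1/2` for a large trace; both are avoided for
  -- infinitely many `n` along one outcome at which the spectra converge.
  obtain ⟨ω, hω, hfr⟩ := exists_frequently_notMem P (q := ENNReal.ofReal (3 / 4))
    (by rw [← ENNReal.ofReal_one]; exact (ENNReal.ofReal_lt_ofReal_iff one_pos).mpr (by norm_num))
    (by
      filter_upwards [hE, htr] with n h1 h2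
      refine (measure_union_le _ _).trans ((add_le_add h1 h2).trans ?_)
      rw [← ENNReal.ofReal_add (by norm_num) (by norm_num)]
      exact ENNReal.ofReal_le_ofReal (by norm_num))
    hν
  have hf := continuousOn_log_one_add_mul hγ.le
  -- The trace bound `(n + 1) T ≤ 2 n T` pays for truncation at `K`; then `K → ∞`.
  have key : ∀ K : ℝ, max R 1 ≤ K → c1 ≤ M + γ / (1 + γ * K) * (2 * T) := by
    intro K hK
    have hK0 : 0 ≤ K := by linarith [le_max_right R 1]
    have hlim := hω (clampBCF _ hf K)
    rw [integral_clampBCF h0 (by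
      filter_upwards [hR] with x hx using hx.trans ((le_max_left _ _).trans hK)) hf] at hlim
    refine le_of_forall_pos_lt_add fun ε hε => ?_
    obtain ⟨n, hn1, hn2, hn0⟩ := (hfr.and_eventually
      ((hlim.eventually_lt_const (lt_add_of_pos_right _ hε)).and (eventually_gt_atTop 0))).exists
    have hn0' : (1 : ℝ) ≤ n := by exact_mod_cast hn0
    simp only [Set.mem_union, Set.mem_ofPred_eq, not_or, not_le] at hn1
    obtain ⟨hdet, htrace⟩ := hn1
    rw [re_trace_gram] at htrace
    rw [Real.rpow_def_of_pos (re_det_one_add_smul_gram_pos _ hγ.le),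
      log_re_det_one_add_smul_gram _ hγ.le, Real.exp_lt_exp] at hdet
    rw [integral_empiricalSpectrum] at hn2
    have h2 : ∑ i, Real.log (1 + γ * gramEigenvalues (Φ n ω) i)
        ≤ ∑ i, clampBCF _ hf K (gramEigenvalues (Φ n ω) i)
          + γ / (1 + γ * K) * ∑ i, gramEigenvalues (Φ n ω) i := by
      rw [Finset.mul_sum, ← Finset.sum_add_distrib]
      exact Finset.sum_le_sum fun i _ =>
        log_one_add_mul_le_clamp hγ hK0 (gramEigenvalues_nonneg (Φ n ω) i)
    have h3 : n * c1 < ∑ i, Real.log (1 + γ * gramEigenvalues (Φ n ω) i) := by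
      by_contra! h
      nlinarith
    rw [inv_mul_lt_iff₀ (by linarith)] at hn2
    have h4 : γ / (1 + γ * K) * ∑ i, gramEigenvalues (Φ n ω) i
        ≤ n * (γ / (1 + γ * K) * (2 * T)) := by
      have : 0 ≤ γ / (1 + γ * K) := by positivity
      have h5 : ∑ i, gramEigenvalues (Φ n ω) i ≤ n * (2 * T) := by nlinarith
      calc _ ≤ γ / (1 + γ * K) * (n * (2 * T)) := by gcongr
        _ = _ := by ring
    have h6 : n * c1 < n * (M + γ / (1 + γ * K) * (2 * T) + ε) := by
      linarith
    exact lt_of_mul_lt_mul_left h6 (by linarith)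
  have hlim : Tendsto (fun K : ℝ => M + γ / (1 + γ * K) * (2 * T)) atTop
      (𝓝 (M + 0 * (2 * T))) := by
    refine (Tendsto.mul_const _ ?_).const_add _
    exact tendsto_const_nhds.div_atTop
      (tendsto_atTop_add_const_left _ _ (tendsto_id.const_mul_atTop hγ))
  have := ge_of_tendsto hlim (by
    filter_upwards [eventually_ge_atTop (max R 1)] with K hK using key K hK)
  linarith

end LimitingSpectrum

/-! ### First moments from logarithmic moments -/

section Moments

theorem logGap_nonneg {x : ℝ} (hx : 0 < x) : 0 ≤ logGap x := by
  have := Real.log_le_sub_one_of_pos hx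
  unfold logGap; linarith

theorem logGap_one : logGap 1 = 0 := by simp [logGap]

theorem integral_mul_div_one_add (μ : Measure ℝ) (k c : ℝ) :
    ∫ x, c * x / (1 + k * x) ∂μ = c * ∫ x, x / (1 + k * x) ∂μ := by
  rw [← integral_const_mul]
  simp_rw [mul_div_assoc]

variable {μ ν : Measure ℝ} [IsProbabilityMeasure μ] [IsProbabilityMeasure ν] {α δ R : ℝ}

theorem integrable_log_one_add_mul (h0 : ∀ᵐ x ∂μ, 0 ≤ x) (hR : ∀ᵐ x ∂μ, x ≤ R) {k : ℝ}
    (hk : 0 ≤ k) : Integrable (fun x => Real.log (1 + k * x)) μ :=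
  integrable_of_continuousOn h0 hR (continuousOn_log_one_add_mul hk)

theorem integrable_mul_div_one_add (h0 : ∀ᵐ x ∂μ, 0 ≤ x) (hR : ∀ᵐ x ∂μ, x ≤ R) {k : ℝ}
    (hk : 0 ≤ k) (c : ℝ) : Integrable (fun x => c * x / (1 + k * x)) μ :=
  integrable_of_continuousOn h0 hR (continuousOn_mul_div_one_add hk c)

theorem integrable_div_one_add (h0 : ∀ᵐ x ∂μ, 0 ≤ x) (hR : ∀ᵐ x ∂μ, x ≤ R) {k : ℝ}
    (hk : 0 ≤ k) : Integrable (fun x => x / (1 + k * x)) μ := by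
  simpa using integrable_mul_div_one_add h0 hR hk 1

/-- Concavity of `k ↦ ∫ ln(1 + kx) dμ`, stated with its derivative `∫ x/(1 + kx) dμ`. All the
duality arguments use it in this form. -/
theorem integral_log_one_add_tangent (h0 : ∀ᵐ x ∂μ, 0 ≤ x) (hR : ∀ᵐ x ∂μ, x ≤ R) {k k' : ℝ}
    (hk : 0 ≤ k) (hk' : 0 ≤ k') :
    ∫ x, Real.log (1 + k' * x) ∂μ
      ≤ ∫ x, Real.log (1 + k * x) ∂μ + (k' - k) * ∫ x, x / (1 + k * x) ∂μ := by
  rw [← integral_const_mul, ← integral_add (integrable_log_one_add_mul h0 hR hk)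
    ((integrable_div_one_add h0 hR hk).const_mul _)]
  refine integral_mono_ae (integrable_log_one_add_mul h0 hR hk')
    ((integrable_log_one_add_mul h0 hR hk).add ((integrable_div_one_add h0 hR hk).const_mul _)) ?_
  filter_upwards [h0] with x hx
  have h1 : 0 < 1 + k * x := by positivity
  have h2 : 0 < 1 + k' * x := by positivity
  have h3 := Real.log_le_sub_one_of_pos (x := (1 + k' * x) / (1 + k * x)) (by positivity)
  rw [Real.log_div h2.ne' h1.ne'] at h3
  have h4 : (1 + k' * x) / (1 + k * x) - 1 = (k' - k) * (x / (1 + k * x)) := by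
    field_simp; ring
  linarith

theorem continuousOn_integral_div_one_add (h0 : ∀ᵐ x ∂μ, 0 ≤ x) (hR : ∀ᵐ x ∂μ, x ≤ R) :
    ContinuousOn (fun k => ∫ x, x / (1 + k * x) ∂μ) (Set.Ici 0) := by
  refine continuousOn_of_dominated (bound := fun _ => R) (fun k hk =>
    (integrable_div_one_add h0 hR hk).aestronglyMeasurable) (fun k hk => ?_)
    (integrable_const _) ?_
  · filter_upwards [h0, hR] with x hx hxR
    have hk' : 0 ≤ k := hk
    rw [Real.norm_of_nonneg (by positivity)]
    refine (div_le_self hx ?_).trans hxR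
    nlinarith
  · filter_upwards [h0] with x hx
    refine ContinuousOn.div (by fun_prop) (by fun_prop) fun k hk => ?_
    have := mul_nonneg (Set.mem_Ici.mp hk) hx
    linarith

theorem integral_pos_of_ne_dirac (h0 : ∀ᵐ x ∂μ, 0 ≤ x) (hR : ∀ᵐ x ∂μ, x ≤ R)
    (hμ : μ ≠ Measure.dirac 0) {k : ℝ} (hk : 0 ≤ k) : 0 < ∫ x, x / (1 + k * x) ∂μ := by
  have hnn : 0 ≤ᵐ[μ] fun x => x / (1 + k * x) := by
    filter_upwards [h0] with x hx
    simp only [Pi.zero_apply]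
    positivity
  refine lt_of_le_of_ne (integral_nonneg_of_ae hnn) fun h => hμ ?_
  have h1 := (integral_eq_zero_iff_of_nonneg_ae hnn (integrable_div_one_add h0 hR hk)).mp h.symm
  have h2 : ∀ᵐ x ∂μ, x = 0 := by
    filter_upwards [h1, h0] with x hx hx0
    have : 0 < 1 + k * x := by positivity
    simpa [this.ne'] using hx
  have h3 : μ.map (fun x => x) = μ.map (fun _ => (0 : ℝ)) := Measure.map_congr h2
  rw [Measure.map_id', Measure.map_const, measure_univ, one_smul] at h3
  exact h3

theorem mul_integral_div_one_add_le_one (h0 : ∀ᵐ x ∂μ, 0 ≤ x) {k : ℝ}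
    (hk : 0 ≤ k) : k * ∫ x, x / (1 + k * x) ∂μ ≤ 1 := by
  rw [← integral_const_mul]
  by_cases hi : Integrable (fun x => k * (x / (1 + k * x))) μ
  · refine (integral_mono_ae hi (integrable_const (1 : ℝ)) ?_).trans (by simp)
    filter_upwards [h0] with x hx
    have h1 : 0 < 1 + k * x := by positivity
    rw [← mul_div_assoc, div_le_one h1]
    linarith
  · rw [integral_undef hi]; exact zero_le_one

theorem integral_div_one_add_le (h0 : ∀ᵐ x ∂μ, 0 ≤ x) (hR : ∀ᵐ x ∂μ, x ≤ R) {k : ℝ}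
    (hk : 0 ≤ k) : ∫ x, x / (1 + k * x) ∂μ ≤ ∫ x, x ∂μ := by
  refine integral_mono_ae (integrable_div_one_add h0 hR hk)
    (integrable_of_continuousOn h0 hR (by fun_prop)) ?_
  filter_upwards [h0] with x hx
  exact div_le_self hx (by nlinarith)

theorem le_integral_div_one_add (h0 : ∀ᵐ x ∂μ, 0 ≤ x) (hR : ∀ᵐ x ∂μ, x ≤ R) {k : ℝ}
    (hk : 0 ≤ k) : ∫ x, x ∂μ - k * ∫ x, x ^ 2 ∂μ ≤ ∫ x, x / (1 + k * x) ∂μ := by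
  have hi1 : Integrable (fun x : ℝ => x) μ := integrable_of_continuousOn h0 hR (by fun_prop)
  have hi2 : Integrable (fun x : ℝ => x ^ 2) μ := integrable_of_continuousOn h0 hR (by fun_prop)
  rw [← integral_const_mul, ← integral_sub hi1 (hi2.const_mul k)]
  refine integral_mono_ae (hi1.sub (hi2.const_mul k)) (integrable_div_one_add h0 hR hk) ?_
  filter_upwards [h0] with x hx
  have h1 : 0 < 1 + k * x := by positivity
  rw [le_div_iff₀ h1]
  nlinarith [mul_nonneg (mul_nonneg hk hk) (pow_nonneg hx 3)]

theorem mul_integral_div_one_add_le_integral_log (h0 : ∀ᵐ x ∂μ, 0 ≤ x) (hR : ∀ᵐ x ∂μ, x ≤ R)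
    {k : ℝ} (hk : 0 ≤ k) :
    k * ∫ x, x / (1 + k * x) ∂μ ≤ ∫ x, Real.log (1 + k * x) ∂μ := by
  have h := integral_log_one_add_tangent h0 hR hk le_rfl
  simp only [zero_mul, add_zero, Real.log_one, integral_zero, zero_sub] at h
  linarith

theorem integral_log_one_add_le_mul (h0 : ∀ᵐ x ∂μ, 0 ≤ x) (hR : ∀ᵐ x ∂μ, x ≤ R)
    {k : ℝ} (hk : 0 ≤ k) : ∫ x, Real.log (1 + k * x) ∂μ ≤ k * ∫ x, x ∂μ := by
  have h := integral_log_one_add_tangent h0 hR le_rfl hk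
  simpa using h

/-- The first moments of two laws related by the logarithmic moment inequalities. -/
theorem integral_id_eq_of_log_moments (hα : 0 < α) (hδ : 0 < δ) (hμ0 : ∀ᵐ x ∂μ, 0 ≤ x)
    (hμR : ∀ᵐ x ∂μ, x ≤ R) (hν0 : ∀ᵐ x ∂ν, 0 ≤ x) (hνR : ∀ᵐ x ∂ν, x ≤ R)
    (hU : ∀ γ k : ℝ, 0 < γ → 0 < k → ∫ l, Real.log (1 + γ * l) ∂ν
      ≤ ∫ x, Real.log (1 + k * x) ∂μ + α * logGap (k * δ / (α * γ)))
    (hL : ∀ γ k : ℝ, 0 < γ → 0 < k → k * ∫ x, x / (1 + k * x) ∂μ + k * δ / γ = α →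
      ∫ x, Real.log (1 + k * x) ∂μ + α * logGap (k * δ / (α * γ))
        ≤ ∫ l, Real.log (1 + γ * l) ∂ν) :
    ∫ l, l ∂ν = α / δ * ∫ x, x ∂μ := by
  set e := ∫ x, x ∂μ with he
  set f := ∫ l, l ∂ν with hf
  have he0 : 0 ≤ e := integral_nonneg_of_ae hμ0
  apply le_antisymm
  · have h2 : 0 ≤ ∫ l, l ^ 2 ∂ν := integral_nonneg fun l => by positivity
    set f2 := ∫ l, l ^ 2 ∂ν
    refine le_of_forall_pos_le_add fun ε hε => ?_
    -- At `k = αγ/δ` the gap vanishes and the upper inequality compares first moments at order `γ`;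
    -- the second-order error `γ f2` is at most `ε`.
    have hγ : 0 < ε / (f2 + 1) := by positivity
    set γ := ε / (f2 + 1) with hγd
    have h3 := hU γ (α * γ / δ) hγ (by positivity)
    rw [show α * γ / δ * δ / (α * γ) = 1 by field_simp, logGap_one] at h3
    have h4 := integral_log_one_add_le_mul hμ0 hμR (k := α * γ / δ) (by positivity)
    have h5 := mul_integral_div_one_add_le_integral_log hν0 hνR hγ.le
    have h6 := le_integral_div_one_add hν0 hνR hγ.le
    have h7 : γ * (f - γ * f2) ≤ γ * (α / δ * e) := by
      calc γ * (f - γ * f2) ≤ γ * ∫ x, x / (1 + γ * x) ∂ν := by gcongr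
        _ ≤ α * γ / δ * e := by linarith
        _ = _ := by ring
    have h8 := le_of_mul_le_mul_left h7 hγ
    have h9 : γ * f2 ≤ ε := by
      rw [hγd, div_mul_eq_mul_div, div_le_iff₀ (by positivity)]
      nlinarith
    linarith
  · have h2 : 0 ≤ ∫ x, x ^ 2 ∂μ := integral_nonneg fun x => by positivity
    set e2 := ∫ x, x ^ 2 ∂μ
    have key : ∀ k : ℝ, 0 < k → k * e < α → α * e ≤ δ * f + k * (α * e2 + e ^ 2) := by
      intro k hk hke
      have h3 := integral_div_one_add_le hμ0 hμR hk.le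
      have h4 := le_integral_div_one_add hμ0 hμR hk.le
      have h4' := mul_integral_div_one_add_le_integral_log hμ0 hμR hk.le
      have h5 : 0 ≤ ∫ x, x / (1 + k * x) ∂μ := integral_nonneg_of_ae (by
        filter_upwards [hμ0] with x hx
        simp only [Pi.zero_apply]
        positivity)
      have hL' := hL
      set a := ∫ x, x / (1 + k * x) ∂μ
      have h6 : 0 < α - k * a := by nlinarith
      have h7 : 0 < k * δ / (α - k * a) := by positivity
      -- For given small `k`, this `γ` solves the stationarity equation. Dropping the nonnegative
      -- gap leaves `k a ≤ γ f`, where `a` tends to the first moment of `μ` as `k → 0`.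
      have h8 := hL' (k * δ / (α - k * a)) k h7 hk (by field_simp; ring)
      have h9 := integral_log_one_add_le_mul hν0 hνR h7.le
      have h10 := logGap_nonneg (x := k * δ / (α * (k * δ / (α - k * a)))) (by positivity)
      have h11 : k * a ≤ k * δ / (α - k * a) * f := by
        have := mul_nonneg hα.le h10
        linarith
      rw [div_mul_eq_mul_div, le_div_iff₀ h6] at h11
      have h12 : a * (α - k * a) ≤ δ * f :=
        le_of_mul_le_mul_left (by linarith : k * (a * (α - k * a)) ≤ k * (δ * f)) hk
      have h13 : k * a ^ 2 ≤ k * e ^ 2 := by gcongr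
      nlinarith
    rw [div_mul_eq_mul_div, div_le_iff₀ hδ]
    refine le_of_forall_pos_le_add fun ε hε => ?_
    set k := min (α / (e + 1) / 2) (ε / (α * e2 + e ^ 2 + 1)) with hkd
    have hk : 0 < k := by positivity
    have hk1 : k * e < α := by
      have h3 : k ≤ α / (e + 1) / 2 := min_le_left _ _
      have h4 : α / (e + 1) / 2 * e < α := by
        rw [div_div, div_mul_eq_mul_div, div_lt_iff₀ (by positivity)]
        nlinarith
      nlinarith
    have hk2 : k * (α * e2 + e ^ 2) ≤ ε := by
      have h3 : k ≤ ε / (α * e2 + e ^ 2 + 1) := min_le_right _ _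
      rw [le_div_iff₀ (by positivity)] at h3
      nlinarith
    have := key k hk hk1
    linarith

end Moments

/-! ### Duality between the nested and the sup-inf problems -/

section Variational

variable {μ ν : Measure ℝ} [IsProbabilityMeasure μ] {α δ R Q : ℝ}
  {ψ : ℝ → ℝ}

/-- With `u(k) = ∫ x/(1 + kx) dμ / δ`, solve `α (u - t) = k δ u²`. At `k = 0` one has `u = Q ≥ t`,
and at `k = 1/(δt)` the bound `k δ u ≤ 1` gives `u ≤ t`, so the intermediate value theorem applies.
Then `γ = 1/t - 1/u` satisfies the stationarity condition of `hL`, with `kδ/(αγ) = t/u` and `α t γ =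
k δ u`. -/
theorem exists_conjugate_point (hα : 0 < α) (hδ : 0 < δ) (hμ0 : ∀ᵐ x ∂μ, 0 ≤ x)
    (hμR : ∀ᵐ x ∂μ, x ≤ R) (hμ : μ ≠ Measure.dirac 0)
    (hL : ∀ γ k : ℝ, 0 < γ → 0 < k → k * ∫ x, x / (1 + k * x) ∂μ + k * δ / γ = α →
      ∫ x, Real.log (1 + k * x) ∂μ + α * logGap (k * δ / (α * γ))
        ≤ ∫ l, Real.log (1 + γ * l) ∂ν)
    (hQ : Q = (∫ x, x ∂μ) / δ) {t : ℝ} (ht0 : 0 < t) (htQ : t ≤ Q) :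
    ∃ k u γ : ℝ, 0 ≤ k ∧ 0 < u ∧ u ≤ Q ∧ 0 ≤ γ ∧ δ * u = ∫ x, x / (1 + k * x) ∂μ ∧
      α * t * γ - ∫ l, Real.log (1 + γ * l) ∂ν
        ≤ k * δ * u - ∫ x, Real.log (1 + k * x) ∂μ - α * logGap (t / u) := by
  have hcont := continuousOn_integral_div_one_add hμ0 hμR
  set n1 : ℝ → ℝ := fun k => ∫ x, x / (1 + k * x) ∂μ with hn1
  have hone : ∀ k, 0 ≤ k → k * n1 k ≤ 1 := fun k hk => mul_integral_div_one_add_le_one hμ0 hk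
  have hle : ∀ k, 0 ≤ k → n1 k ≤ ∫ x, x ∂μ := fun k hk => integral_div_one_add_le hμ0 hμR hk
  have hpos : ∀ k, 0 ≤ k → 0 < n1 k := fun k hk => integral_pos_of_ne_dirac hμ0 hμR hμ hk
  have hzero : n1 0 = ∫ x, x ∂μ := by simp [hn1]
  have hk1 : 0 ≤ 1 / (δ * t) := by positivity
  have hg : ContinuousOn (fun k => α * (n1 k / δ - t) - k * δ * (n1 k / δ) ^ 2)
      (Set.Icc 0 (1 / (δ * t))) := by
    have := hcont.mono (Set.Icc_subset_Ici_self : Set.Icc 0 (1 / (δ * t)) ⊆ Set.Ici 0)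
    fun_prop
  have hmem : (0 : ℝ) ∈ Set.Icc
      (α * (n1 (1 / (δ * t)) / δ - t) - 1 / (δ * t) * δ * (n1 (1 / (δ * t)) / δ) ^ 2)
      (α * (n1 0 / δ - t) - 0 * δ * (n1 0 / δ) ^ 2) := by
    constructor
    · have h1 := hone _ hk1
      have h2 : n1 (1 / (δ * t)) / δ ≤ t := by
        rw [div_le_iff₀ hδ]
        rw [one_div_mul_eq_div, div_le_one (by positivity)] at h1
        linarith
      have h3 : 0 ≤ 1 / (δ * t) * δ * (n1 (1 / (δ * t)) / δ) ^ 2 := by positivity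
      have h4 : α * (n1 (1 / (δ * t)) / δ - t) ≤ 0 :=
        mul_nonpos_of_nonneg_of_nonpos hα.le (by linarith)
      linarith
    · have : n1 0 / δ = Q := by rw [hQ, ← hzero]
      rw [this, zero_mul, zero_mul, sub_zero]
      exact mul_nonneg hα.le (by linarith)
  obtain ⟨k, ⟨hk0, hk1⟩, hkeq⟩ := intermediate_value_Icc' hk1 hg hmem
  simp only at hkeq
  have hu0 : 0 < n1 k / δ := div_pos (hpos k hk0) hδ
  have huQ : n1 k / δ ≤ Q := by rw [hQ]; exact div_le_div_of_nonneg_right (hle k hk0) hδ.le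
  have hun : δ * (n1 k / δ) = n1 k := mul_div_cancel₀ _ hδ.ne'
  rcases hk0.eq_or_lt with rfl | hk
  -- The degenerate root: `u = t`, `γ = 0`, and both sides vanish.
  · refine ⟨0, n1 0 / δ, 0, le_rfl, hu0, huQ, le_rfl, hun, ?_⟩
    have : n1 0 / δ = t := by
      simp only [zero_mul, sub_zero, mul_eq_zero, hα.ne', false_or] at hkeq
      linarith
    rw [this, div_self ht0.ne', logGap_one]
    simp
  · set u := n1 k / δ with hu
    have hut : 0 < u - t := by
      have : 0 < k * δ * u ^ 2 := by positivity
      by_contra! h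
      nlinarith
    have hγ : 0 < (u - t) / (u * t) := by positivity
    have hcond : k * n1 k + k * δ / ((u - t) / (u * t)) = α := by
      rw [← hun]
      have : k * (δ * u) + k * δ / ((u - t) / (u * t)) = k * δ * u ^ 2 / (u - t) := by
        field_simp; ring
      rw [this, div_eq_iff hut.ne']
      linarith
    have h1 := hL _ k hγ hk hcond
    have h2 : k * δ / (α * ((u - t) / (u * t))) = t / u := by
      have : k * δ = α * (u - t) / u ^ 2 := by
        rw [eq_div_iff (by positivity)]; linarith
      rw [this]
      field_simp
    have h3 : α * t * ((u - t) / (u * t)) = k * δ * u := by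
      have : k * δ = α * (u - t) / u ^ 2 := by
        rw [eq_div_iff (by positivity)]; linarith
      rw [this]
      field_simp
    refine ⟨k, u, (u - t) / (u * t), hk0, hu0, huQ, hγ.le, hun, ?_⟩
    rw [h2] at h1
    rw [h3]
    linarith

/-- Every value of the nested variational problem is dominated by a value of the sup-inf problem. -/
theorem exists_nested_le (hα : 0 < α) (hδ : 0 < δ) (hμ0 : ∀ᵐ x ∂μ, 0 ≤ x)
    (hμR : ∀ᵐ x ∂μ, x ≤ R) (hμ : μ ≠ Measure.dirac 0)
    (hL : ∀ γ k : ℝ, 0 < γ → 0 < k → k * ∫ x, x / (1 + k * x) ∂μ + k * δ / γ = α →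
      ∫ x, Real.log (1 + k * x) ∂μ + α * logGap (k * δ / (α * γ))
        ≤ ∫ l, Real.log (1 + γ * l) ∂ν)
    (hQ : Q = (∫ x, x ∂μ) / δ)
    (hψ : ∀ u, 0 < u → u ≤ Q → ∃ c : ℝ, 0 ≤ c ∧ ∀ u', 0 < u' → u' ≤ Q →
      ψ u - c * (u' - u) ≤ ψ u') {t : ℝ} (ht0 : 0 < t) (htQ : t ≤ Q) :
    ∃ k u γ : ℝ, 0 ≤ k ∧ 0 < u ∧ u ≤ Q ∧ 0 ≤ γ ∧ ∀ u', 0 < u' → u' ≤ Q →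
      α * logGap (t / u) + ψ u + (α * t * γ - ∫ l, Real.log (1 + γ * l) ∂ν)
        ≤ k * δ * u' + ψ u' - ∫ x, Real.log (1 + k * x) ∂μ := by
  obtain ⟨k, u, γ, hk, hu0, huQ, hγ, hun, h⟩ :=
    exists_conjugate_point hα hδ hμ0 hμR hμ hL hQ ht0 htQ
  obtain ⟨c, hc, hsub⟩ := hψ u hu0 huQ
  -- The dual variable is read off the slope of `ψ` at `u`, which makes the sup-inf functional at
  -- least its value at `u`. The tangent of `k ↦ ∫ ln(1 + kx) dμ` at the conjugate `k`, whose slope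
  -- is `δu`, then compares `c/δ` with `k`.
  refine ⟨c / δ, u, γ, by positivity, hu0, huQ, hγ, fun u' hu' hu'Q => ?_⟩
  have h1 := hsub u' hu' hu'Q
  have h2 := integral_log_one_add_tangent hμ0 hμR hk (k' := c / δ) (by positivity)
  rw [← hun] at h2
  have h3 : (c / δ - k) * (δ * u) = c * u - k * δ * u := by field_simp
  have h4 : c / δ * δ = c := by field_simp
  rw [h3] at h2
  rw [h4]
  linarith

/-- Every value of the sup-inf problem is approached by values of the nested variational problem. -/
theorem exists_le_nested (hα : 0 < α) (hδ : 0 < δ) (hμ0 : ∀ᵐ x ∂μ, 0 ≤ x)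
    (hμR : ∀ᵐ x ∂μ, x ≤ R) (hμ : μ ≠ Measure.dirac 0)
    (hU : ∀ γ k : ℝ, 0 < γ → 0 < k → ∫ l, Real.log (1 + γ * l) ∂ν
      ≤ ∫ x, Real.log (1 + k * x) ∂μ + α * logGap (k * δ / (α * γ)))
    (hQ : Q = (∫ x, x ∂μ) / δ)
    (hψ : ∀ u, 0 < u → u ≤ Q → ∃ t : ℝ, 0 ≤ t ∧ t ≤ u ∧ ∀ u', 0 < u' → u' ≤ Q →
      ψ u + α * Real.log u - α * t * (1 / u' - 1 / u) ≤ ψ u' + α * Real.log u') {k : ℝ}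
    (hk : 0 ≤ k) {ε : ℝ} (hε : 0 < ε) :
    ∃ t u a j : ℝ, 0 < t ∧ t ≤ Q ∧ 0 < u ∧ u ≤ Q ∧
      (∀ u', 0 < u' → u' ≤ Q → a ≤ α * logGap (t / u') + ψ u') ∧
      (∀ γ, 0 ≤ γ → j ≤ α * t * γ - ∫ l, Real.log (1 + γ * l) ∂ν) ∧
      k * δ * u + ψ u - ∫ x, Real.log (1 + k * x) ∂μ - ε ≤ a + j := by
  set u := (∫ x, x / (1 + k * x) ∂μ) / δ with hu
  have hun : ∫ x, x / (1 + k * x) ∂μ = δ * u := (mul_div_cancel₀ _ hδ.ne').symm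
  have hu0 : 0 < u := div_pos (integral_pos_of_ne_dirac hμ0 hμR hμ hk) hδ
  have huQ : u ≤ Q := by
    rw [hQ]; exact div_le_div_of_nonneg_right (integral_div_one_add_le hμ0 hμR hk) hδ.le
  obtain ⟨t0, ht0, ht0u, hsub⟩ := hψ u hu0 huQ
  have hQ0 : 0 < Q := hu0.trans_le huQ
  -- The slope `t0` may be zero while `t` must be positive. A small positive `t` replaces it at a
  -- cost of at most `ε`.
  obtain ⟨t, ht, ht0t, htu, hte⟩ : ∃ t : ℝ, 0 < t ∧ t0 ≤ t ∧ t ≤ u ∧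
      α * (t - t0) * (1 / u) ≤ ε := by
    rcases ht0.eq_or_lt with h | h
    · refine ⟨min u (ε * u / α), by positivity, by rw [← h]; positivity, min_le_left _ _, ?_⟩
      rw [← h, sub_zero]
      have : min u (ε * u / α) ≤ ε * u / α := min_le_right _ _
      calc α * min u (ε * u / α) * (1 / u) ≤ α * (ε * u / α) * (1 / u) := by gcongr
        _ = ε := by field_simp
    · exact ⟨t0, h, le_rfl, ht0u, by simpa using hε.le⟩
  have key : ∀ k', 0 ≤ k' → k * δ * u - ∫ x, Real.log (1 + k * x) ∂μ
      ≤ k' * δ * u - ∫ x, Real.log (1 + k' * x) ∂μ := by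
    intro k' hk'
    have h := integral_log_one_add_tangent hμ0 hμR hk hk'
    rw [hun] at h
    linarith
  have hgap := logGap_nonneg (x := t / u) (by positivity)
  refine ⟨t, u, α * logGap (t / u) + ψ u - ε, k * δ * u - ∫ x, Real.log (1 + k * x) ∂μ
    - α * logGap (t / u), ht, htu.trans huQ, hu0, huQ, fun u' hu' hu'Q => ?_, fun γ hγ => ?_, ?_⟩
  · have h1 := hsub u' hu' hu'Q
    have h2 : α * (t - t0) * (1 / u - 1 / u') ≤ ε := by
      refine le_trans ?_ hte
      have h3 : 0 ≤ α * (t - t0) := mul_nonneg hα.le (by linarith)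
      refine mul_le_mul_of_nonneg_left ?_ h3
      have : 0 < 1 / u' := by positivity
      linarith
    unfold logGap
    rw [Real.log_div ht.ne' hu0.ne', Real.log_div ht.ne' hu'.ne']
    have e1 : t / u = t * (1 / u) := by ring
    have e2 : t / u' = t * (1 / u') := by ring
    rw [e1, e2]
    nlinarith
  · rcases hγ.eq_or_lt with rfl | hγ
    · have := key 0 le_rfl
      have h1 := mul_nonneg hα.le hgap
      simp only [zero_mul, add_zero, Real.log_one, integral_zero, mul_zero, sub_zero] at this ⊢
      linarith
    -- This comparison point makes the argument of the gap equal to `t/u`, independently of `γ`, and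
    -- satisfies `k'δu = α t γ`.
    · have h1 := hU γ (α * γ * t / (δ * u)) hγ (by positivity)
      have h2 := key (α * γ * t / (δ * u)) (by positivity)
      have e1 : α * γ * t / (δ * u) * δ / (α * γ) = t / u := by field_simp
      have e2 : α * γ * t / (δ * u) * δ * u = α * t * γ := by field_simp
      rw [e1] at h1
      rw [e2] at h2
      linarith
  · linarith

end Variational

/-! ### Convexity from increments, and subgradients -/

section Convexity

/-- A monotone function with nondecreasing increments is convex. -/
theorem convexOn_of_increments {I : Set ℝ} (hI : Convex ℝ I) {f : ℝ → ℝ} (hf : MonotoneOn f I)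
    (hinc : ∀ t b c, 0 ≤ b → 0 ≤ c → t ∈ I → t + b + c ∈ I →
      f (t + b) + f (t + c) ≤ f (t + b + c) + f t) : ConvexOn ℝ I f := by
  refine convexOn_of_slope_mono_adjacent hI fun {x y z} hx hz hxy hyz => ?_
  have hmem : ∀ w, x ≤ w → w ≤ z → w ∈ I := fun w h1 h2 => hI.ordConnected.out hx hz ⟨h1, h2⟩
  set p := y - x with hp
  set q := z - y with hq
  have hp0 : 0 < p := by linarith
  have hq0 : 0 < q := by linarith
  set A := f y - f x with hA
  have hA0 : 0 ≤ A := sub_nonneg.mpr (hf hx (hmem y hxy.le hyz.le) hxy.le)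
  have key : ∀ n : ℕ, 0 < n → p / n ≤ q → q / p * A ≤ f z - f y + A / n := by
    intro n hn hnq
    have hn0 : (0 : ℝ) < n := by exact_mod_cast hn
    -- On a grid of mesh `h`, every increment to the left of `y` is at most `d` and every increment
    -- to the right at least `d`. Monotonicity discards the incomplete last cell at a cost `A/n`, so
    -- no regularity of `f` is assumed.
    set h := p / n with hh
    have hh0 : 0 < h := by positivity
    have hnh : n * h = p := by rw [hh]; field_simp
    set d := f (y + h) - f y with hd
    have c1 : ∀ j : ℕ, j ≤ n → f y - f (y - j * h) ≤ j * d := by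
      intro j
      induction j with
      | zero => intro _; simp
      | succ j ih =>
        intro hj
        have h1 := ih (by omega)
        have hj' : ((j + 1 : ℕ) : ℝ) ≤ n := by exact_mod_cast hj
        have hle : ((j + 1 : ℕ) : ℝ) * h ≤ p := by
          rw [← hnh]; gcongr
        have h2 := hinc (y - ((j + 1 : ℕ) : ℝ) * h) h (((j + 1 : ℕ) : ℝ) * h) hh0.le (by positivity)
          (hmem _ (by linarith) (by nlinarith [hh0, (Nat.cast_nonneg (j + 1) : (0 : ℝ) ≤ _)]))
          (hmem _ (by linarith) (by linarith))
        rw [show y - ((j + 1 : ℕ) : ℝ) * h + h = y - j * h by push_cast; ring,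
          show y - j * h + ((j + 1 : ℕ) : ℝ) * h = y + h by push_cast; ring,
          show y - ((j + 1 : ℕ) : ℝ) * h + ((j + 1 : ℕ) : ℝ) * h = y by ring] at h2
        have h3 : ((j + 1 : ℕ) : ℝ) * d = j * d + d := by push_cast; ring
        linarith
    have c2 : ∀ k : ℕ, k * h ≤ q → k * d ≤ f (y + k * h) - f y := by
      intro k
      induction k with
      | zero => intro _; simp
      | succ k ih =>
        intro hk
        have hk' : ((k + 1 : ℕ) : ℝ) * h = k * h + h := by push_cast; ring
        have h1 := ih (by linarith)
        have h0 : (0 : ℝ) ≤ k * h := by positivity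
        have h2 := hinc y h (k * h) hh0.le h0 (hmem _ hxy.le hyz.le)
          (hmem _ (by linarith) (by linarith))
        rw [show y + h + k * h = y + ((k + 1 : ℕ) : ℝ) * h by rw [hk']; ring] at h2
        have h3 : ((k + 1 : ℕ) : ℝ) * d = k * d + d := by push_cast; ring
        linarith
    have h1 := c1 n le_rfl
    rw [hnh, show y - p = x by rw [hp]; ring] at h1
    set k := ⌊q / h⌋₊ with hk
    have hkq : k * h ≤ q := by
      have := Nat.floor_le (show 0 ≤ q / h by positivity)
      rwa [le_div_iff₀ hh0] at this
    have hkq' : q / h - 1 ≤ k := by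
      have := Nat.lt_floor_add_one (q / h)
      rw [← hk] at this
      linarith
    have h2 := c2 k hkq
    have h3 : f (y + k * h) ≤ f z := hf (hmem _ (by
      have : (0 : ℝ) ≤ k * h := by positivity
      linarith) (by linarith)) hz (by linarith)
    have h4 : (q / h - 1) * A ≤ n * (f z - f y) := by
      calc (q / h - 1) * A ≤ k * A := by gcongr
        _ ≤ k * (n * d) := by gcongr
        _ = n * (k * d) := by ring
        _ ≤ n * (f z - f y) := by gcongr; linarith
    have h5 : q / h = n * (q / p) := by rw [hh]; field_simp
    rw [h5] at h4
    have h6 : n * (q / p * A) ≤ n * (f z - f y + A / n) := by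
      have : n * (A / n) = A := by field_simp
      rw [mul_add, this]
      linarith
    exact le_of_mul_le_mul_left h6 hn0
  have hlim : Tendsto (fun n : ℕ => f z - f y + A / n) atTop (𝓝 (f z - f y + 0)) :=
    (tendsto_const_div_atTop_nhds_zero_nat A).const_add _
  have h := ge_of_tendsto hlim (by
    have hp' := tendsto_const_div_atTop_nhds_zero_nat p
    filter_upwards [eventually_gt_atTop 0, hp'.eventually_le_const hq0] with n h1 h2
    exact key n h1 h2)
  rw [add_zero, div_mul_eq_mul_div, div_le_iff₀ hp0] at h
  rw [div_le_div_iff₀ hp0 hq0]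
  linarith

theorem exists_subgradient {S : Set ℝ} {f : ℝ → ℝ} (hf : ConvexOn ℝ S f) {x : ℝ}
    (hx : x ∈ interior S) : ∃ c : ℝ, ∀ y ∈ S, f x + c * (y - x) ≤ f y := by
  refine ⟨derivWithin f (Set.Ioi x) x, fun y hy => ?_⟩
  rcases lt_trichotomy x y with h | rfl | h
  · have h1 := hf.rightDeriv_le_slope_of_mem_interior hx hy h
    rw [slope_def_field, le_div_iff₀ (by linarith)] at h1
    linarith
  · simp
  · have h1 := (hf.slope_le_leftDeriv_of_mem_interior hy hx h).trans
      (hf.leftDeriv_le_rightDeriv_of_mem_interior hx)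
    rw [slope_def_field, div_le_iff₀ (by linarith)] at h1
    linarith

/-- Monotonicity makes interior subgradients nonnegative and permits slope zero at the left
endpoint, where an interior subgradient is not available. -/
theorem exists_nonneg_subgradient {Q : ℝ} {f : ℝ → ℝ} (hf : ConvexOn ℝ (Set.Ico 0 Q) f)
    (hm : MonotoneOn f (Set.Ico 0 Q)) {x : ℝ} (hx : x ∈ Set.Ico 0 Q) :
    ∃ c : ℝ, 0 ≤ c ∧ ∀ y ∈ Set.Ico 0 Q, f x + c * (y - x) ≤ f y := by
  rcases hx.1.eq_or_lt with h | h
  · refine ⟨0, le_rfl, fun y hy => ?_⟩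
    have := hm hx hy (by rw [← h]; exact hy.1)
    linarith
  · obtain ⟨c, hc⟩ := exists_subgradient hf (x := x) (by rw [interior_Ico]; exact ⟨h, hx.2⟩)
    refine ⟨c, ?_, hc⟩
    by_contra! hneg
    have h0 : (0 : ℝ) ∈ Set.Ico 0 Q := ⟨le_rfl, h.trans hx.2⟩
    have h1 := hc 0 h0
    have h2 := hm h0 hx h.le
    nlinarith

end Convexity

/-! ### Entropy, marginals and mutual information -/

section Entropy

open InformationTheory

/-- The function `x ln x + 1 - x` on `[0, ∞]`. -/
def entropyFun (x : ℝ≥0∞) : ℝ≥0∞ := ENNReal.ofReal (klFun x.toReal)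

theorem measurable_entropyFun : Measurable entropyFun :=
  (measurable_klFun.comp ENNReal.measurable_toReal).ennreal_ofReal

theorem abs_mul_log_le_klFun {x : ℝ} (hx : 0 ≤ x) : |x * Real.log x| ≤ klFun x + x + 1 := by
  have h1 := klFun_nonneg hx
  rw [klFun_apply] at *
  rw [abs_le]
  constructor
  · nlinarith
  · linarith

variable {T T₁ T₂ : Type*} [MeasurableSpace T] [MeasurableSpace T₁] [MeasurableSpace T₂]

theorem integrable_toReal_of_entropyFun {π : Measure T} [IsFiniteMeasure π] {X : T → ℝ≥0∞}
    (hX : Measurable X) (hfin : ∫⁻ t, X t ∂π ≠ ∞) (hent : ∫⁻ t, entropyFun (X t) ∂π ≠ ∞) :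
    Integrable (fun t => (X t).toReal) π ∧ Integrable (fun t => klFun (X t).toReal) π ∧
      Integrable (fun t => (X t).toReal * Real.log (X t).toReal) π := by
  have h1 : Integrable (fun t => (X t).toReal) π := integrable_toReal_of_lintegral_ne_top
    hX.aemeasurable hfin
  have h2 : Integrable (fun t => klFun (X t).toReal) π := by
    refine ⟨(measurable_klFun.comp hX.ennreal_toReal).aestronglyMeasurable, ?_⟩
    rw [hasFiniteIntegral_iff_ofReal (ae_of_all _ fun t => klFun_nonneg ENNReal.toReal_nonneg)]
    exact hent.lt_top
  refine ⟨h1, h2, ((h2.add h1).add (integrable_const (1 : ℝ))).mono'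
    (hX.ennreal_toReal.mul hX.ennreal_toReal.log).aestronglyMeasurable (ae_of_all _ fun t => ?_)⟩
  exact abs_mul_log_le_klFun ENNReal.toReal_nonneg

theorem integral_klFun {π : Measure T} [IsProbabilityMeasure π] {x : T → ℝ} (h1 : Integrable x π)
    (h2 : Integrable (fun t => x t * Real.log (x t)) π) :
    ∫ t, klFun (x t) ∂π = ∫ t, x t * Real.log (x t) ∂π + 1 - ∫ t, x t ∂π := by
  have h3 : Integrable (fun t => x t * Real.log (x t) + 1) π := h2.add (integrable_const 1)
  simp only [klFun_apply]
  rw [integral_sub h3 h1, integral_add h2 (integrable_const _)]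
  simp

/-- Jensen's inequality for `x ln x + 1 - x`; nonnegativity of this function permits infinite
entropies. -/
theorem entropyFun_lintegral_le {π : Measure T} [IsProbabilityMeasure π] {X : T → ℝ≥0∞}
    (hX : Measurable X) (hfin : ∫⁻ t, X t ∂π ≠ ∞) :
    entropyFun (∫⁻ t, X t ∂π) ≤ ∫⁻ t, entropyFun (X t) ∂π := by
  by_cases hent : ∫⁻ t, entropyFun (X t) ∂π = ∞
  · rw [hent]; exact le_top
  obtain ⟨h1, h2, -⟩ := integrable_toReal_of_entropyFun hX hfin hent
  have h3 := convexOn_klFun.map_integral_le continuous_klFun.continuousOn isClosed_Ici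
    (ae_of_all _ fun t => Set.mem_Ici.mpr ENNReal.toReal_nonneg) h1 h2
  rw [integral_toReal hX.aemeasurable (ae_lt_top hX hfin)] at h3
  refine (ENNReal.ofReal_le_ofReal h3).trans (le_of_eq ?_)
  exact ofReal_integral_eq_lintegral_ofReal h2
    (ae_of_all _ fun t => klFun_nonneg ENNReal.toReal_nonneg)

/-- The logarithm of the marginal is constant in the second variable, so integrating that variable
replaces the density by its marginal. Jensen's inequality passes finite entropy to the marginal and
gives the integrability needed to split integrals later. -/
theorem integral_mul_log_marginal {π₁ : Measure T₁} {π₂ : Measure T₂} [IsProbabilityMeasure π₁]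
    [IsProbabilityMeasure π₂] {X : T₁ × T₂ → ℝ≥0∞} (hX : Measurable X)
    (hfin : ∫⁻ t, X t ∂(π₁.prod π₂) ≠ ∞) (hent : ∫⁻ t, entropyFun (X t) ∂(π₁.prod π₂) ≠ ∞) :
    ∫⁻ s, entropyFun (∫⁻ t, X (s, t) ∂π₂) ∂π₁ ≠ ∞ ∧
    Integrable (fun s => (∫⁻ t, X (s, t) ∂π₂).toReal) π₁ ∧
    Integrable (fun s => klFun (∫⁻ t, X (s, t) ∂π₂).toReal) π₁ ∧
    Integrable (fun s => (∫⁻ t, X (s, t) ∂π₂).toReal *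
      Real.log (∫⁻ t, X (s, t) ∂π₂).toReal) π₁ ∧
    Integrable (fun p => (X p).toReal * Real.log (∫⁻ t, X (p.1, t) ∂π₂).toReal) (π₁.prod π₂) ∧
    ∫ p, (X p).toReal * Real.log (∫⁻ t, X (p.1, t) ∂π₂).toReal ∂(π₁.prod π₂)
      = ∫ s, (∫⁻ t, X (s, t) ∂π₂).toReal * Real.log (∫⁻ t, X (s, t) ∂π₂).toReal ∂π₁ := by
  set Y : T₁ → ℝ≥0∞ := fun s => ∫⁻ t, X (s, t) ∂π₂ with hY
  have hYm : Measurable Y := hX.lintegral_prod_right'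
  have hYfin : ∫⁻ s, Y s ∂π₁ ≠ ∞ := by
    rw [hY, ← lintegral_prod _ hX.aemeasurable]; exact hfin
  have hYae := ae_lt_top hYm hYfin
  have hYent : ∫⁻ s, entropyFun (Y s) ∂π₁ ≠ ∞ := by
    refine ne_top_of_le_ne_top hent ?_
    rw [lintegral_prod (fun t => entropyFun (X t)) (measurable_entropyFun.comp hX).aemeasurable]
    refine lintegral_mono_ae ?_
    filter_upwards [hYae] with s hs
    exact entropyFun_lintegral_le (hX.comp measurable_prodMk_left) hs.ne
  obtain ⟨h1, h2, h3⟩ := integrable_toReal_of_entropyFun hYm hYfin hYent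
  obtain ⟨g1, g2, g3⟩ := integrable_toReal_of_entropyFun hX hfin hent
  have hsec : ∀ᵐ s ∂π₁, ∫ t, (X (s, t)).toReal ∂π₂ = (Y s).toReal := by
    filter_upwards [hYae] with s hs
    exact integral_toReal (hX.comp measurable_prodMk_left).aemeasurable
      (ae_lt_top (hX.comp measurable_prodMk_left) hs.ne)
  have hm : Measurable fun p : T₁ × T₂ => (X p).toReal * Real.log (Y p.1).toReal :=
    hX.ennreal_toReal.mul (hYm.comp measurable_fst).ennreal_toReal.log
  have hint : Integrable (fun p => (X p).toReal * Real.log (Y p.1).toReal) (π₁.prod π₂) := by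
    rw [integrable_prod_iff hm.aestronglyMeasurable]
    refine ⟨?_, ?_⟩
    · filter_upwards [g1.prod_right_ae] with s hs
      exact hs.mul_const _
    · refine h3.norm.congr ?_
      filter_upwards [hsec] with s hs
      simp only [norm_mul]
      rw [integral_mul_const]
      congr 1
      rw [← hs, Real.norm_of_nonneg (integral_nonneg fun t => ENNReal.toReal_nonneg)]
      refine integral_congr_ae (ae_of_all _ fun t => ?_)
      exact (Real.norm_of_nonneg ENNReal.toReal_nonneg).symm
  refine ⟨hYent, h1, h2, h3, hint, ?_⟩
  rw [integral_prod _ hint]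
  refine integral_congr_ae ?_
  filter_upwards [hsec] with s hs
  rw [integral_mul_const, hs]

/-- Strong subadditivity: the mutual information of a positive density is nonnegative. -/
theorem lintegral_entropyFun_marginals_le {π₁ : Measure T₁} {π₂ : Measure T₂}
    [IsProbabilityMeasure π₁] [IsProbabilityMeasure π₂] {X : T₁ × T₂ → ℝ≥0∞} (hX : Measurable X)
    (hfin : ∫⁻ t, X t ∂(π₁.prod π₂) ≠ ∞) :
    ∫⁻ s, entropyFun (∫⁻ t, X (s, t) ∂π₂) ∂π₁ + ∫⁻ t, entropyFun (∫⁻ s, X (s, t) ∂π₁) ∂π₂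
      ≤ ∫⁻ p, entropyFun (X p) ∂(π₁.prod π₂) + entropyFun (∫⁻ p, X p ∂(π₁.prod π₂)) := by
  by_cases hent : ∫⁻ p, entropyFun (X p) ∂(π₁.prod π₂) = ∞
  · rw [hent, top_add]; exact le_top
  obtain ⟨g1, g2, g3⟩ := integrable_toReal_of_entropyFun hX hfin hent
  obtain ⟨hY0, hY1, hY2, hY3, hY4, hY5⟩ := integral_mul_log_marginal hX hfin hent
  have hXs : Measurable fun p : T₂ × T₁ => X p.swap := hX.comp measurable_swap
  have hfins : ∫⁻ p, X p.swap ∂(π₂.prod π₁) ≠ ∞ := by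
    rwa [lintegral_prod_swap]
  have hents : ∫⁻ p, entropyFun (X p.swap) ∂(π₂.prod π₁) ≠ ∞ := by
    rwa [lintegral_prod_swap (fun p => entropyFun (X p))]
  obtain ⟨hZ0, hZ1, hZ2, hZ3, hZ4, hZ5⟩ := integral_mul_log_marginal hXs hfins hents
  simp only [Prod.swap_prod_mk] at hZ0 hZ1 hZ2 hZ3 hZ4 hZ5
  have hZ4' := hZ4.swap
  rw [← integral_prod_swap] at hZ5
  simp only [Prod.swap_swap, Prod.fst_swap, Function.comp_def] at hZ4' hZ5
  set Y : T₁ → ℝ≥0∞ := fun s => ∫⁻ t, X (s, t) ∂π₂ with hY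
  set Z : T₂ → ℝ≥0∞ := fun t => ∫⁻ s, X (s, t) ∂π₁ with hZ
  set m := (∫⁻ p, X p ∂(π₁.prod π₂)).toReal with hm
  have hYm : Measurable Y := hX.lintegral_prod_right'
  have hZm : Measurable Z := hX.lintegral_prod_left'
  have hYtot : ∫⁻ s, Y s ∂π₁ = ∫⁻ p, X p ∂(π₁.prod π₂) := (lintegral_prod _ hX.aemeasurable).symm
  have hZtot : ∫⁻ t, Z t ∂π₂ = ∫⁻ p, X p ∂(π₁.prod π₂) :=
    (lintegral_prod_symm _ hX.aemeasurable).symm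
  have iX : ∫ p, (X p).toReal ∂(π₁.prod π₂) = m :=
    integral_toReal hX.aemeasurable (ae_lt_top hX hfin)
  have iY : ∫ s, (Y s).toReal ∂π₁ = m := by
    rw [integral_toReal hYm.aemeasurable (ae_lt_top hYm (hYtot ▸ hfin)), hYtot]
  have iZ : ∫ t, (Z t).toReal ∂π₂ = m := by
    rw [integral_toReal hZm.aemeasurable (ae_lt_top hZm (hZtot ▸ hfin)), hZtot]
  have main : ∫ s, (Y s).toReal * Real.log (Y s).toReal ∂π₁
      + ∫ t, (Z t).toReal * Real.log (Z t).toReal ∂π₂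
      ≤ ∫ p, (X p).toReal * Real.log (X p).toReal ∂(π₁.prod π₂) + m * Real.log m := by
    have hm0 : 0 ≤ m := ENNReal.toReal_nonneg
    rcases hm0.eq_or_lt with hm0 | hm0
    · have z0 : ∫⁻ p, X p ∂(π₁.prod π₂) = 0 := by
        have := (ENNReal.toReal_eq_zero_iff _).mp hm0.symm
        tauto
      have zY := (lintegral_eq_zero_iff hYm).mp (hYtot.trans z0)
      have zZ := (lintegral_eq_zero_iff hZm).mp (hZtot.trans z0)
      have zX := (lintegral_eq_zero_iff hX).mp z0
      rw [integral_eq_zero_of_ae (by filter_upwards [zY] with s hs; simp [hs]),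
        integral_eq_zero_of_ae (by filter_upwards [zZ] with s hs; simp [hs]),
        integral_eq_zero_of_ae (by filter_upwards [zX] with s hs; simp [hs]), ← hm0]
      simp
    -- Where a marginal vanishes the density vanishes almost everywhere; without this the convention
    -- `ln 0 = 0` would falsify the pointwise bound.
    · have nullY : ∀ᵐ p ∂(π₁.prod π₂), (Y p.1).toReal = 0 → (X p).toReal = 0 := by
        rw [Measure.ae_prod_iff_ae_ae (by
          have a1 : MeasurableSet {p : T₁ × T₂ | (Y p.1).toReal = 0} :=
            (hYm.comp measurable_fst).ennreal_toReal (measurableSet_singleton 0)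
          have a2 : MeasurableSet {p : T₁ × T₂ | (X p).toReal = 0} :=
            hX.ennreal_toReal (measurableSet_singleton 0)
          exact a1.imp a2)]
        filter_upwards [ae_lt_top hYm (hYtot ▸ hfin)] with s hs
        by_cases h : (Y s).toReal = 0
        · have h' : Y s = 0 := by
            have := (ENNReal.toReal_eq_zero_iff _).mp h
            exact this.resolve_right hs.ne
          have := (lintegral_eq_zero_iff (hX.comp measurable_prodMk_left)).mp h'
          filter_upwards [this] with t ht _
          simp only [Function.comp_apply, Pi.zero_apply] at ht
          simp [ht]
        · exact ae_of_all _ fun t h' => absurd h' h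
      have nullZ : ∀ᵐ p ∂(π₁.prod π₂), (Z p.2).toReal = 0 → (X p).toReal = 0 := by
        rw [Measure.ae_prod_iff_ae_ae (by
          have a1 : MeasurableSet {p : T₁ × T₂ | (Z p.2).toReal = 0} :=
            (hZm.comp measurable_snd).ennreal_toReal (measurableSet_singleton 0)
          have a2 : MeasurableSet {p : T₁ × T₂ | (X p).toReal = 0} :=
            hX.ennreal_toReal (measurableSet_singleton 0)
          exact a1.imp a2), Measure.ae_ae_comm (by
          have a1 : MeasurableSet {p : T₁ × T₂ | (Z p.2).toReal = 0} :=
            (hZm.comp measurable_snd).ennreal_toReal (measurableSet_singleton 0)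
          have a2 : MeasurableSet {p : T₁ × T₂ | (X p).toReal = 0} :=
            hX.ennreal_toReal (measurableSet_singleton 0)
          exact a1.imp a2)]
        filter_upwards [ae_lt_top hZm (hZtot ▸ hfin)] with t ht
        by_cases h : (Z t).toReal = 0
        · have h' : Z t = 0 := by
            have := (ENNReal.toReal_eq_zero_iff _).mp h
            exact this.resolve_right ht.ne
          have := (lintegral_eq_zero_iff (hX.comp measurable_prodMk_right)).mp h'
          filter_upwards [this] with s hs _
          simp only [Function.comp_apply, Pi.zero_apply] at hs
          simp [hs]
        · exact ae_of_all _ fun t h' => absurd h' h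
      have iYZ := integral_prod_mul (μ := π₁) (ν := π₂) (fun s => (Y s).toReal)
        (fun t => (Z t).toReal)
      rw [iY, iZ] at iYZ
      have jYZ := (hY1.mul_prod hZ1).div_const m
      have k1 : Integrable (fun p => (X p).toReal * Real.log (X p).toReal
          + (X p).toReal * Real.log m) (π₁.prod π₂) := g3.add (g1.mul_const _)
      have k2 : Integrable (fun p => (X p).toReal * Real.log (X p).toReal
          + (X p).toReal * Real.log m - (X p).toReal * Real.log (Y p.1).toReal) (π₁.prod π₂) :=
        k1.sub hY4
      -- Pointwise, `x (ln x + ln m - ln y - ln z) ≥ x - y z / m`, from `ln s ≤ s - 1`. The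
      -- right-hand side integrates to zero because all three total masses equal `m`.
      have hineq : ∫ p, ((X p).toReal - (Y p.1).toReal * (Z p.2).toReal / m) ∂(π₁.prod π₂)
          ≤ ∫ p, ((X p).toReal * Real.log (X p).toReal + (X p).toReal * Real.log m
            - (X p).toReal * Real.log (Y p.1).toReal
            - (X p).toReal * Real.log (Z p.2).toReal) ∂(π₁.prod π₂) := by
        refine integral_mono_ae (g1.sub jYZ) (k2.sub hZ4') ?_
        filter_upwards [nullY, nullZ] with p h1 h2
        have hx0 : 0 ≤ (X p).toReal := ENNReal.toReal_nonneg
        have hy0 : 0 ≤ (Y p.1).toReal := ENNReal.toReal_nonneg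
        have hz0 : 0 ≤ (Z p.2).toReal := ENNReal.toReal_nonneg
        rcases hx0.eq_or_lt with h | h
        · rw [← h]
          have : 0 ≤ (Y p.1).toReal * (Z p.2).toReal / m := by positivity
          simp only [zero_mul, zero_sub, add_zero, sub_zero]
          linarith
        · have hy : 0 < (Y p.1).toReal := hy0.lt_of_ne fun e => h.ne' (h1 e.symm)
          have hz : 0 < (Z p.2).toReal := hz0.lt_of_ne fun e => h.ne' (h2 e.symm)
          have h3 := Real.log_le_sub_one_of_pos
            (x := (Y p.1).toReal * (Z p.2).toReal / m / (X p).toReal) (by positivity)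
          rw [Real.log_div (by positivity) h.ne', Real.log_div (by positivity) hm0.ne',
            Real.log_mul hy.ne' hz.ne'] at h3
          have h4 := mul_le_mul_of_nonneg_left h3 h.le
          rw [mul_sub _ (_ / (X p).toReal), mul_div_cancel₀ _ h.ne'] at h4
          linarith
      rw [integral_sub g1 jYZ, iX, integral_div, iYZ, mul_div_cancel_left₀ _ hm0.ne', sub_self,
        integral_sub k2 hZ4', integral_sub k1 hY4, integral_add g3 (g1.mul_const _),
        integral_mul_const, iX, hY5, hZ5] at hineq
      linarith
  have eX : ∫⁻ p, entropyFun (X p) ∂(π₁.prod π₂)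
      = ENNReal.ofReal (∫ p, klFun (X p).toReal ∂(π₁.prod π₂)) :=
    (ofReal_integral_eq_lintegral_ofReal g2
      (ae_of_all _ fun p => klFun_nonneg ENNReal.toReal_nonneg)).symm
  have eY : ∫⁻ s, entropyFun (Y s) ∂π₁ = ENNReal.ofReal (∫ s, klFun (Y s).toReal ∂π₁) :=
    (ofReal_integral_eq_lintegral_ofReal hY2
      (ae_of_all _ fun p => klFun_nonneg ENNReal.toReal_nonneg)).symm
  have eZ : ∫⁻ t, entropyFun (Z t) ∂π₂ = ENNReal.ofReal (∫ t, klFun (Z t).toReal ∂π₂) :=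
    (ofReal_integral_eq_lintegral_ofReal hZ2
      (ae_of_all _ fun p => klFun_nonneg ENNReal.toReal_nonneg)).symm
  have kX : ∫ p, klFun (X p).toReal ∂(π₁.prod π₂)
      = ∫ p, (X p).toReal * Real.log (X p).toReal ∂(π₁.prod π₂) + 1 - m := by
    rw [integral_klFun g1 g3, iX]
  have kY : ∫ s, klFun (Y s).toReal ∂π₁
      = ∫ s, (Y s).toReal * Real.log (Y s).toReal ∂π₁ + 1 - m := by
    rw [integral_klFun hY1 hY3, iY]
  have kZ : ∫ t, klFun (Z t).toReal ∂π₂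
      = ∫ t, (Z t).toReal * Real.log (Z t).toReal ∂π₂ + 1 - m := by
    rw [integral_klFun hZ1 hZ3, iZ]
  have e0 : entropyFun (∫⁻ p, X p ∂(π₁.prod π₂)) = ENNReal.ofReal (m * Real.log m + 1 - m) := rfl
  rw [eX, eY, eZ, e0, ← ENNReal.ofReal_add (integral_nonneg fun s =>
      klFun_nonneg ENNReal.toReal_nonneg) (integral_nonneg fun s =>
      klFun_nonneg ENNReal.toReal_nonneg), ← ENNReal.ofReal_add (integral_nonneg fun s =>
      klFun_nonneg ENNReal.toReal_nonneg) (by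
        rw [← klFun_apply]; exact klFun_nonneg ENNReal.toReal_nonneg), kX, kY, kZ]
  exact ENNReal.ofReal_le_ofReal (by linarith)

end Entropy

/-! ### Entropy along Gaussian martingales of densities -/

section GaussianFamily

variable {𝕜 : Type*} [RCLike 𝕜]

/-- The entropy `E_ξ ∫ dς(y) η(K_t(y, √t ξ))` of a family of densities, with
`η(x) = x ln x + 1 - x`. -/
def familyEntropy (K : ℝ → ℝ → 𝕜 → ℝ≥0∞) (ς : Measure ℝ) (t : ℝ) : ℝ≥0∞ :=
  ∫⁻ p, entropyFun (K t p.2 (((√t : ℝ) : 𝕜) * p.1)) ∂((betaGaussian 𝕜).prod ς)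

/-- A family of densities which is a martingale along Gaussian increments. -/
structure IsGaussianMartingale (K : ℝ → ℝ → 𝕜 → ℝ≥0∞) (ς : Measure ℝ) (I : Set ℝ) : Prop where
  nonneg : ∀ t ∈ I, 0 ≤ t
  down : ∀ t ∈ I, ∀ s, 0 ≤ s → s ≤ t → s ∈ I
  measurable : ∀ t, Measurable fun p : ℝ × 𝕜 => K t p.1 p.2
  step : ∀ t c, 0 ≤ t → 0 ≤ c → t + c ∈ I → ∀ y w,
    ∫⁻ η, K (t + c) y (w + ((√c : ℝ) : 𝕜) * η) ∂(betaGaussian 𝕜) = K t y w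
  finite : ∀ᵐ y ∂ς, K 0 y 0 ≠ ∞

variable {K : ℝ → ℝ → 𝕜 → ℝ≥0∞} {ς : Measure ℝ} {I : Set ℝ}

namespace IsGaussianMartingale

theorem measurable_right (hK : IsGaussianMartingale K ς I) (t y : ℝ) : Measurable (K t y) :=
  (hK.measurable t).comp measurable_prodMk_left

theorem lintegral_eq (hK : IsGaussianMartingale K ς I) {t : ℝ} (ht : t ∈ I) (y : ℝ) :
    ∫⁻ ξ, K t y (((√t : ℝ) : 𝕜) * ξ) ∂(betaGaussian 𝕜) = K 0 y 0 := by
  have := hK.step 0 t le_rfl (hK.nonneg t ht) (by rwa [zero_add]) y 0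
  simpa using this

theorem familyEntropy_eq [SFinite ς] (hK : IsGaussianMartingale K ς I) (t : ℝ) :
    familyEntropy K ς t
      = ∫⁻ y, ∫⁻ ξ, entropyFun (K t y (((√t : ℝ) : 𝕜) * ξ)) ∂(betaGaussian 𝕜) ∂ς := by
  have hg : Measurable fun p : 𝕜 × ℝ => (p.2, ((√t : ℝ) : 𝕜) * p.1) := by fun_prop
  have hm : Measurable fun p : 𝕜 × ℝ => entropyFun (K t p.2 (((√t : ℝ) : 𝕜) * p.1)) :=
    measurable_entropyFun.comp ((hK.measurable t).comp hg)
  rw [familyEntropy, lintegral_prod_symm _ hm.aemeasurable]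

theorem lintegral_entropyFun_add (hK : IsGaussianMartingale K ς I) {t b : ℝ} (ht : 0 ≤ t)
    (hb : 0 ≤ b) (y : ℝ) :
    ∫⁻ ξ, entropyFun (K (t + b) y (((√(t + b) : ℝ) : 𝕜) * ξ)) ∂(betaGaussian 𝕜)
      = ∫⁻ ξ, ∫⁻ η, entropyFun (K (t + b) y (((√t : ℝ) : 𝕜) * ξ + ((√b : ℝ) : 𝕜) * η))
          ∂(betaGaussian 𝕜) ∂(betaGaussian 𝕜) :=
  (lintegral_add_betaGaussian ht hb
    (measurable_entropyFun.comp (hK.measurable_right (t + b) y))).symm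

/-- Conditionally on the first part of the Gaussian variable, `K_t` is the average of `K_{t+b}` over
the increment, so Jensen's inequality applies. -/
theorem familyEntropy_mono [SFinite ς] (hK : IsGaussianMartingale K ς I) {t b : ℝ} (ht : 0 ≤ t)
    (hb : 0 ≤ b) (htb : t + b ∈ I) : familyEntropy K ς t ≤ familyEntropy K ς (t + b) := by
  rw [hK.familyEntropy_eq, hK.familyEntropy_eq]
  refine lintegral_mono_ae ?_
  filter_upwards [hK.finite] with y hy
  rw [hK.lintegral_entropyFun_add ht hb]
  have htI := hK.down _ htb t ht (by linarith)
  have hfin := ae_lt_top ((hK.measurable_right t y).comp (measurable_const_mul ((√t : ℝ) : 𝕜)))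
    (by
      have := hK.lintegral_eq htI y
      simp only [Function.comp_def]
      rw [this]; exact hy)
  refine lintegral_mono_ae ?_
  filter_upwards [hfin] with ξ hξ
  have h1 := hK.step t b ht hb htb y (((√t : ℝ) : 𝕜) * ξ)
  rw [← h1]
  refine entropyFun_lintegral_le ?_ (by rw [h1]; exact hξ.ne)
  exact (hK.measurable_right (t + b) y).comp (by fun_prop)

theorem lintegral_entropyFun_add_add (hK : IsGaussianMartingale K ς I) {t b c : ℝ} (ht : 0 ≤ t)
    (hb : 0 ≤ b) (hc : 0 ≤ c) (y : ℝ) :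
    ∫⁻ ξ, entropyFun (K (t + b + c) y (((√(t + b + c) : ℝ) : 𝕜) * ξ)) ∂(betaGaussian 𝕜)
      = ∫⁻ ξ, ∫⁻ q, entropyFun (K (t + b + c) y (((√t : ℝ) : 𝕜) * ξ
          + ((√b : ℝ) : 𝕜) * q.1 + ((√c : ℝ) : 𝕜) * q.2))
          ∂((betaGaussian 𝕜).prod (betaGaussian 𝕜)) ∂(betaGaussian 𝕜) := by
  rw [hK.lintegral_entropyFun_add (by linarith) hc]
  have hk := measurable_entropyFun.comp (hK.measurable_right (t + b + c) y)
  have hadd : Measurable fun p : 𝕜 × 𝕜 => p.1 + ((√c : ℝ) : 𝕜) * p.2 := by fun_prop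
  have hg : Measurable fun u : 𝕜 => ∫⁻ η, entropyFun (K (t + b + c) y
      (u + ((√c : ℝ) : 𝕜) * η)) ∂(betaGaussian 𝕜) :=
    (hk.comp hadd).lintegral_prod_right'
  rw [← lintegral_add_betaGaussian ht hb hg]
  refine lintegral_congr fun ξ => ?_
  have hq : Measurable fun q : 𝕜 × 𝕜 => ((√t : ℝ) : 𝕜) * ξ
      + ((√b : ℝ) : 𝕜) * q.1 + ((√c : ℝ) : 𝕜) * q.2 := by fun_prop
  exact (lintegral_prod _ (hk.comp hq).aemeasurable).symm

/-- Given `w`, view `K_{t+b+c}` as a density in two independent increments of variances `b` and `c`.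
The martingale property identifies its marginals with `K_{t+b}` and `K_{t+c}` and its total mass
with `K_t`. -/
theorem lintegral_entropyFun_marginals_le (hK : IsGaussianMartingale K ς I) {t b c : ℝ}
    (ht : 0 ≤ t) (hb : 0 ≤ b) (hc : 0 ≤ c) (htI : t + b + c ∈ I) {y : ℝ} {w : 𝕜}
    (hw : K t y w ≠ ∞) :
    ∫⁻ η, entropyFun (K (t + b) y (w + ((√b : ℝ) : 𝕜) * η)) ∂(betaGaussian 𝕜)
        + ∫⁻ η, entropyFun (K (t + c) y (w + ((√c : ℝ) : 𝕜) * η)) ∂(betaGaussian 𝕜)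
      ≤ ∫⁻ q, entropyFun (K (t + b + c) y (w + ((√b : ℝ) : 𝕜) * q.1 + ((√c : ℝ) : 𝕜) * q.2))
          ∂((betaGaussian 𝕜).prod (betaGaussian 𝕜)) + entropyFun (K t y w) := by
  have htb := hK.down _ htI (t + b) (by linarith) (by linarith)
  have hq : Measurable fun q : 𝕜 × 𝕜 => w + ((√b : ℝ) : 𝕜) * q.1 + ((√c : ℝ) : 𝕜) * q.2 := by
    fun_prop
  have hX := (hK.measurable_right (t + b + c) y).comp hq
  have m1 : ∀ η, ∫⁻ η', K (t + b + c) y (w + ((√b : ℝ) : 𝕜) * η + ((√c : ℝ) : 𝕜) * η')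
      ∂(betaGaussian 𝕜) = K (t + b) y (w + ((√b : ℝ) : 𝕜) * η) :=
    fun η => hK.step (t + b) c (by linarith) hc htI y _
  have m2 : ∀ η', ∫⁻ η, K (t + b + c) y (w + ((√b : ℝ) : 𝕜) * η + ((√c : ℝ) : 𝕜) * η')
      ∂(betaGaussian 𝕜) = K (t + c) y (w + ((√c : ℝ) : 𝕜) * η') := by
    intro η'
    rw [← hK.step (t + c) b (by linarith) hb (by rwa [add_right_comm]) y _]
    refine lintegral_congr fun η => ?_
    rw [add_right_comm t b c, add_right_comm w]
  have m3 : ∫⁻ q, K (t + b + c) y (w + ((√b : ℝ) : 𝕜) * q.1 + ((√c : ℝ) : 𝕜) * q.2)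
      ∂((betaGaussian 𝕜).prod (betaGaussian 𝕜)) = K t y w :=
    (lintegral_prod _ hX.aemeasurable).trans
      ((lintegral_congr m1).trans (hK.step t b ht hb htb y _))
  have h := ReplicaGLM.lintegral_entropyFun_marginals_le (π₁ := betaGaussian 𝕜)
    (π₂ := betaGaussian 𝕜) hX (by rw [Function.comp_def, m3]; exact hw)
  simp only [Function.comp_def, m1, m2, m3] at h
  exact h

theorem familyEntropy_add_le [SFinite ς] (hK : IsGaussianMartingale K ς I) {t b c : ℝ} (ht : 0 ≤ t)
    (hb : 0 ≤ b) (hc : 0 ≤ c) (htI : t + b + c ∈ I) :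
    familyEntropy K ς (t + b) + familyEntropy K ς (t + c)
      ≤ familyEntropy K ς (t + b + c) + familyEntropy K ς t := by
  have hme : ∀ s, Measurable fun p : ℝ × 𝕜 => entropyFun (K s p.1 p.2) := fun s =>
    measurable_entropyFun.comp (hK.measurable s)
  have hmy : ∀ s, Measurable fun y =>
      ∫⁻ ξ, entropyFun (K s y (((√s : ℝ) : 𝕜) * ξ)) ∂(betaGaussian 𝕜) := fun s => by
    have hg : Measurable fun p : ℝ × 𝕜 => (p.1, ((√s : ℝ) : 𝕜) * p.2) := by fun_prop
    exact ((hme s).comp hg).lintegral_prod_right'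
  simp only [hK.familyEntropy_eq]
  rw [← lintegral_add_left (hmy _), ← lintegral_add_left (hmy _)]
  refine lintegral_mono_ae ?_
  filter_upwards [hK.finite] with y hy
  rw [hK.lintegral_entropyFun_add_add ht hb hc, hK.lintegral_entropyFun_add ht hb,
    hK.lintegral_entropyFun_add ht hc]
  have hk : ∀ s, Measurable fun w => entropyFun (K s y w) := fun s =>
    measurable_entropyFun.comp (hK.measurable_right s y)
  have hl : ∀ s r : ℝ, Measurable fun ξ => ∫⁻ η, entropyFun (K s y (((√t : ℝ) : 𝕜) * ξ
      + ((√r : ℝ) : 𝕜) * η)) ∂(betaGaussian 𝕜) := fun s r => by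
    have hg : Measurable fun p : 𝕜 × 𝕜 => ((√t : ℝ) : 𝕜) * p.1 + ((√r : ℝ) : 𝕜) * p.2 := by
      fun_prop
    exact ((hk s).comp hg).lintegral_prod_right'
  have hl3 : Measurable fun ξ => ∫⁻ q, entropyFun (K (t + b + c) y (((√t : ℝ) : 𝕜) * ξ
      + ((√b : ℝ) : 𝕜) * q.1 + ((√c : ℝ) : 𝕜) * q.2))
      ∂((betaGaussian 𝕜).prod (betaGaussian 𝕜)) := by
    have hg : Measurable fun q : 𝕜 × 𝕜 × 𝕜 => ((√t : ℝ) : 𝕜) * q.1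
        + ((√b : ℝ) : 𝕜) * q.2.1 + ((√c : ℝ) : 𝕜) * q.2.2 := by fun_prop
    exact ((hk _).comp hg).lintegral_prod_right'
  rw [← lintegral_add_left (hl _ _), ← lintegral_add_left hl3]
  have hmt : Measurable fun ξ : 𝕜 => ((√t : ℝ) : 𝕜) * ξ := by fun_prop
  have hfin := ae_lt_top ((hK.measurable_right t y).comp hmt) (by
    rw [Function.comp_def, hK.lintegral_eq (hK.down _ htI t ht (by linarith)) y]; exact hy)
  refine lintegral_mono_ae ?_
  filter_upwards [hfin] with ξ hξ
  exact hK.lintegral_entropyFun_marginals_le ht hb hc htI hξ.ne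

theorem convexOn [SFinite ς] (hK : IsGaussianMartingale K ς I) (hI : Convex ℝ I)
    (hfin : ∀ t ∈ I, familyEntropy K ς t ≠ ∞) :
    MonotoneOn (fun t => (familyEntropy K ς t).toReal) I ∧
      ConvexOn ℝ I fun t => (familyEntropy K ς t).toReal := by
  have hm : MonotoneOn (fun t => (familyEntropy K ς t).toReal) I := by
    intro s hs t ht hst
    have h := hK.familyEntropy_mono (t := s) (b := t - s) (hK.nonneg s hs) (by linarith)
      (by rwa [add_sub_cancel])
    rw [add_sub_cancel] at h
    exact ENNReal.toReal_mono (hfin t ht) h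
  refine ⟨hm, convexOn_of_increments hI hm fun t b c hb hc ht htbc => ?_⟩
  have ht0 := hK.nonneg t ht
  have h1 := hfin _ (hK.down _ htbc (t + b) (by linarith) (by linarith))
  have h2 := hfin _ (hK.down _ htbc (t + c) (by linarith) (by linarith))
  rw [← ENNReal.toReal_add h1 h2, ← ENNReal.toReal_add (hfin _ htbc) (hfin _ ht)]
  exact ENNReal.toReal_mono (ENNReal.add_ne_top.mpr ⟨hfin _ htbc, hfin _ ht⟩)
    (hK.familyEntropy_add_le ht0 hb hc htbc)

end IsGaussianMartingale

end GaussianFamily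

/-! ### Smoothed and tilted channel densities -/

section Channel

open InformationTheory

variable {𝕜 : Type*} [RCLike 𝕜] {φ : 𝕜 → 𝕜 → ℝ} {PA : Measure 𝕜} {Pout : ℝ → 𝕜 → ℝ} {Q C : ℝ}

theorem measurable_dot : Measurable fun p : 𝕜 × 𝕜 => dot p.1 p.2 := by
  simp_rw [dot_eq_inner]; fun_prop

theorem dot_add_smul (w η z : 𝕜) (c : ℝ) :
    dot (w + (c : 𝕜) * η) z = dot w z + dot ((c : 𝕜) * z) η := by
  simp only [dot_eq_inner, ← RCLike.real_smul_eq_coe_mul, inner_add_left, real_inner_smul_left]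
  rw [real_inner_comm η z]

theorem norm_coe_mul (c : ℝ) (z : 𝕜) : ‖(c : 𝕜) * z‖ ^ 2 = c ^ 2 * ‖z‖ ^ 2 := by
  rw [norm_mul, RCLike.norm_ofReal, mul_pow, sq_abs]

/-- The density `E_z P_out(y | √(Q - s) z + w)`. -/
def smoothedDensity (Pout : ℝ → 𝕜 → ℝ) (Q s y : ℝ) (w : 𝕜) : ℝ≥0∞ :=
  ∫⁻ z, ENNReal.ofReal (Pout y (((√(Q - s) : ℝ) : 𝕜) * z + w)) ∂(betaGaussian 𝕜)

/-- The density `E_z P_out(y | √Q z) exp (-β a |z|² / 2 + β w · z)`. -/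
def tiltedDensity (Pout : ℝ → 𝕜 → ℝ) (Q a y : ℝ) (w : 𝕜) : ℝ≥0∞ :=
  ∫⁻ z, ENNReal.ofReal (Real.exp (-(betaDim 𝕜 / 2) * a * ‖z‖ ^ 2 + betaDim 𝕜 * dot w z)) *
    ENNReal.ofReal (Pout y (((√Q : ℝ) : 𝕜) * z)) ∂(betaGaussian 𝕜)

theorem IsChannelDensity.measurable_ofReal (h : IsChannelDensity φ PA Pout) :
    Measurable fun p : ℝ × 𝕜 => ENNReal.ofReal (Pout p.1 p.2) := h.measurable.ennreal_ofReal

theorem measurable_smoothedDensity (h : IsChannelDensity φ PA Pout) (Q s : ℝ) :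
    Measurable fun p : ℝ × 𝕜 => smoothedDensity Pout Q s p.1 p.2 := by
  have hg : Measurable fun q : (ℝ × 𝕜) × 𝕜 =>
      (q.1.1, ((√(Q - s) : ℝ) : 𝕜) * q.2 + q.1.2) := by fun_prop
  exact (h.measurable_ofReal.comp hg).lintegral_prod_right'

theorem measurable_tiltedDensity (h : IsChannelDensity φ PA Pout) (Q a : ℝ) :
    Measurable fun p : ℝ × 𝕜 => tiltedDensity Pout Q a p.1 p.2 := by
  have hg : Measurable fun q : (ℝ × 𝕜) × 𝕜 => (q.1.1, ((√Q : ℝ) : 𝕜) * q.2) := by fun_prop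
  have hg' : Measurable fun q : (ℝ × 𝕜) × 𝕜 => (q.1.2, q.2) := by fun_prop
  have hd := measurable_dot.comp hg'
  have he : Measurable fun q : (ℝ × 𝕜) × 𝕜 => ENNReal.ofReal
      (Real.exp (-(betaDim 𝕜 / 2) * a * ‖q.2‖ ^ 2 + betaDim 𝕜 * dot q.1.2 q.2)) := by
    have : Measurable fun q : (ℝ × 𝕜) × 𝕜 => -(betaDim 𝕜 / 2) * a * ‖q.2‖ ^ 2 := by fun_prop
    exact (this.add (hd.const_mul _)).exp.ennreal_ofReal
  exact (he.mul (h.measurable_ofReal.comp hg)).lintegral_prod_right'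

theorem IsChannelDensity.setLIntegral (h : IsChannelDensity φ PA Pout) (z : 𝕜) {S : Set ℝ}
    (hS : MeasurableSet S) (hm : Measurable (φ z)) :
    ∫⁻ y in S, ENNReal.ofReal (Pout y z) = PA ((φ z) ⁻¹' S) := by
  rw [← Measure.map_apply hm hS, h.law, withDensity_apply _ hS]

theorem ChannelRegular.measurable (hφ : ChannelRegular φ) (z : 𝕜) : Measurable (φ z) := by
  have h := hφ.contDiff.continuous
  have : Continuous (φ z) := h.comp (Continuous.prodMk_right z)
  exact this.measurable

theorem IsChannelDensity.lintegral_Icc [IsProbabilityMeasure PA] (h : IsChannelDensity φ PA Pout)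
    (hφ : ChannelRegular φ) (hC : ∀ z a, |φ z a| ≤ C) (z : 𝕜) :
    ∫⁻ y in Set.Icc (-C) C, ENNReal.ofReal (Pout y z) = 1 := by
  rw [h.setLIntegral z measurableSet_Icc (hφ.measurable z)]
  convert measure_univ (μ := PA)
  ext a
  simpa [abs_le] using hC z a

theorem IsChannelDensity.lintegral_compl_Icc (h : IsChannelDensity φ PA Pout)
    (hφ : ChannelRegular φ) (hC : ∀ z a, |φ z a| ≤ C) (z : 𝕜) :
    ∫⁻ y in (Set.Icc (-C) C)ᶜ, ENNReal.ofReal (Pout y z) = 0 := by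
  rw [h.setLIntegral z measurableSet_Icc.compl (hφ.measurable z)]
  convert measure_empty (μ := PA)
  ext a
  simpa [abs_le] using hC z a

theorem lintegral_smoothedDensity_of_forall (h : IsChannelDensity φ PA Pout) {S : Set ℝ} {e : ℝ≥0∞}
    (he : ∀ z, ∫⁻ y in S, ENNReal.ofReal (Pout y z) = e) (Q s : ℝ) (w : 𝕜) :
    ∫⁻ y in S, smoothedDensity Pout Q s y w = e := by
  unfold smoothedDensity
  have hg : Measurable fun q : ℝ × 𝕜 => (q.1, ((√(Q - s) : ℝ) : 𝕜) * q.2 + w) := by fun_prop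
  rw [lintegral_lintegral_swap
    (f := fun y z => ENNReal.ofReal (Pout y (((√(Q - s) : ℝ) : 𝕜) * z + w)))
    (h.measurable_ofReal.comp hg).aemeasurable]
  simp [he]

/-- The likelihood of the Gaussian observation `√a z + ξ`. -/
def priorDensity (𝕜 : Type*) [RCLike 𝕜] (a : ℝ) (ξ : 𝕜) : ℝ :=
  (1 + a) ^ (-(betaDim 𝕜 / 2) : ℝ) * Real.exp (betaDim 𝕜 * a * ‖ξ‖ ^ 2 / (2 * (1 + a)))

/-- Tilting a Gaussian by an observation of signal-to-noise ratio `a` leaves a Gaussian posterior of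
variance `1/(1 + a)`. The tilted density is therefore the evidence of that observation times a
smoothed density with residual variance `Q/(1 + a)`. -/
theorem tiltedDensity_eq (h : IsChannelDensity φ PA Pout) (hQ : 0 ≤ Q) {a : ℝ} (ha : 0 ≤ a) (y : ℝ)
    (ξ : 𝕜) : tiltedDensity Pout Q a y (((√a : ℝ) : 𝕜) * ξ)
      = ENNReal.ofReal (priorDensity 𝕜 a ξ) *
        smoothedDensity Pout Q (Q - Q / (1 + a)) y (((√Q * √a / (1 + a) : ℝ) : 𝕜) * ξ) := by
  have hf : Measurable fun z : 𝕜 => ENNReal.ofReal (Pout y (((√Q : ℝ) : 𝕜) * z)) := by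
    have hg : Measurable fun z : 𝕜 => (y, ((√Q : ℝ) : 𝕜) * z) := by fun_prop
    exact h.measurable_ofReal.comp hg
  unfold tiltedDensity smoothedDensity priorDensity
  rw [lintegral_betaGaussian_tilt (by linarith) _ hf, norm_coe_mul, Real.sq_sqrt ha, mul_assoc]
  congr 1
  refine lintegral_congr fun z => ?_
  congr 2
  rw [show Q - (Q - Q / (1 + a)) = Q * (1 / (1 + a)) by ring, Real.sqrt_mul hQ]
  push_cast
  ring

variable [IsProbabilityMeasure PA]

/-- An increment of variance `c` and the residual variance `Q - t - c` add up to `Q - t`. -/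
theorem isGaussianMartingale_smoothedDensity (h : IsChannelDensity φ PA Pout)
    (hφ : ChannelRegular φ) (hC : ∀ z a, |φ z a| ≤ C) (Q : ℝ) :
    IsGaussianMartingale (smoothedDensity Pout Q) (volume.restrict (Set.Icc (-C) C))
      (Set.Icc 0 Q) where
  nonneg t ht := ht.1
  down t ht s h0 hst := ⟨h0, hst.trans ht.2⟩
  measurable := measurable_smoothedDensity h Q
  step t c ht hc htc y w := by
    have hf : Measurable fun u : 𝕜 => ENNReal.ofReal (Pout y (u + w)) := by
      have hg : Measurable fun u : 𝕜 => (y, u + w) := by fun_prop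
      exact h.measurable_ofReal.comp hg
    have h1 := lintegral_add_betaGaussian hc (w := Q - (t + c)) (by linarith [htc.2]) hf
    rw [show c + (Q - (t + c)) = Q - t by ring] at h1
    unfold smoothedDensity
    rw [← h1]
    refine lintegral_congr fun η => lintegral_congr fun z => ?_
    congr 2
    ring
  finite := by
    have hm : Measurable fun y => smoothedDensity Pout Q 0 y 0 :=
      (measurable_smoothedDensity h Q 0).comp measurable_prodMk_right
    filter_upwards [ae_lt_top hm (by
      rw [lintegral_smoothedDensity_of_forall h (h.lintegral_Icc hφ hC)]
      exact ENNReal.one_ne_top)] with y hy using hy.ne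

theorem tiltedDensity_zero (y : ℝ) (Q : ℝ) :
    tiltedDensity Pout Q 0 y 0 = smoothedDensity Pout Q 0 y 0 := by
  simp [tiltedDensity, smoothedDensity, dot]

/-- The increment contributes `E exp(β √c z · η) = exp(β c |z|²/2)`, which exactly compensates the
increase of the quadratic term from `t` to `t + c`. -/
theorem isGaussianMartingale_tiltedDensity (h : IsChannelDensity φ PA Pout)
    (hφ : ChannelRegular φ) (hC : ∀ z a, |φ z a| ≤ C) (Q : ℝ) :
    IsGaussianMartingale (tiltedDensity Pout Q) (volume.restrict (Set.Icc (-C) C))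
      (Set.Ici 0) where
  nonneg t ht := ht
  down t ht s h0 hst := h0
  measurable := measurable_tiltedDensity h Q
  step t c ht hc htc y w := by
    unfold tiltedDensity
    have hg : Measurable fun q : 𝕜 × 𝕜 => (y, ((√Q : ℝ) : 𝕜) * q.2) := by fun_prop
    have hg' : Measurable fun q : 𝕜 × 𝕜 => (w + ((√c : ℝ) : 𝕜) * q.1, q.2) := by fun_prop
    have hd := measurable_dot.comp hg'
    have he : Measurable fun q : 𝕜 × 𝕜 => ENNReal.ofReal (Real.exp (-(betaDim 𝕜 / 2) * (t + c) *
        ‖q.2‖ ^ 2 + betaDim 𝕜 * dot (w + ((√c : ℝ) : 𝕜) * q.1) q.2)) := by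
      have : Measurable fun q : 𝕜 × 𝕜 => -(betaDim 𝕜 / 2) * (t + c) * ‖q.2‖ ^ 2 := by fun_prop
      exact (this.add (hd.const_mul _)).exp.ennreal_ofReal
    rw [lintegral_lintegral_swap (he.mul (h.measurable_ofReal.comp hg)).aemeasurable]
    refine lintegral_congr fun z => ?_
    rw [lintegral_mul_const' _ _ ENNReal.ofReal_ne_top]
    congr 1
    have e1 : ∀ η : 𝕜, ENNReal.ofReal (Real.exp (-(betaDim 𝕜 / 2) * (t + c) *
        ‖z‖ ^ 2 + betaDim 𝕜 * dot (w + ((√c : ℝ) : 𝕜) * η) z))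
        = ENNReal.ofReal (Real.exp (-(betaDim 𝕜 / 2) * (t + c) * ‖z‖ ^ 2 + betaDim 𝕜 * dot w z)) *
          ENNReal.ofReal (Real.exp (-(betaDim 𝕜 / 2) * 0 * ‖η‖ ^ 2
            + betaDim 𝕜 * dot (((√c : ℝ) : 𝕜) * z) η)) := by
      intro η
      rw [← ENNReal.ofReal_mul (Real.exp_pos _).le, ← Real.exp_add, dot_add_smul]
      congr 2
      ring
    simp only [e1]
    rw [lintegral_const_mul' _ _ ENNReal.ofReal_ne_top, lintegral_exp_betaGaussian (by norm_num),
      ← ENNReal.ofReal_mul (Real.exp_pos _).le]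
    simp only [add_zero, Real.one_rpow, one_mul, mul_one]
    rw [← Real.exp_add, norm_coe_mul, Real.sq_sqrt hc]
    congr 2
    ring
  finite := by
    simp only [tiltedDensity_zero]
    exact (isGaussianMartingale_smoothedDensity h hφ hC Q).finite

/-- The weight is the density of `√(1 + a) ξ` relative to `ξ`: it is the law of the observation of
signal-to-noise ratio `a`. -/
theorem lintegral_priorDensity {a : ℝ} (ha : 0 ≤ a) {g : 𝕜 → ℝ≥0∞} (hg : Measurable g) :
    ∫⁻ ξ, ENNReal.ofReal (priorDensity 𝕜 a ξ) * g ξ ∂(betaGaussian 𝕜)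
      = ∫⁻ ξ, g (((√(1 + a) : ℝ) : 𝕜) * ξ) ∂(betaGaussian 𝕜) := by
  have h1 : (0 : ℝ) < 1 + a := by linarith
  have h2 : -1 < -a / (1 + a) := by rw [lt_div_iff₀ h1]; linarith
  have h3 : 1 + -a / (1 + a) = (1 + a)⁻¹ := by field_simp; ring
  have h := lintegral_betaGaussian_tilt h2 (0 : 𝕜) hg
  rw [h3] at h
  simp only [one_div, inv_inv, mul_zero, add_zero, norm_zero, ne_eq, OfNat.ofNat_ne_zero,
    not_false_eq_true, zero_pow, zero_div, Real.exp_zero, mul_one] at h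
  have e : ∀ ξ : 𝕜, ENNReal.ofReal (priorDensity 𝕜 a ξ) * g ξ
      = ENNReal.ofReal ((1 + a) ^ (-(betaDim 𝕜 / 2) : ℝ)) * (ENNReal.ofReal
        (Real.exp (-(betaDim 𝕜 / 2) * (-a / (1 + a)) * ‖ξ‖ ^ 2 + betaDim 𝕜 * dot 0 ξ)) * g ξ) := by
    intro ξ
    rw [priorDensity, ENNReal.ofReal_mul (by positivity), mul_assoc]
    congr 4
    simp only [dot, map_zero, zero_mul, mul_zero, add_zero]
    field_simp
  simp only [e]
  rw [lintegral_const_mul' _ _ ENNReal.ofReal_ne_top, h, ← mul_assoc,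
    ← ENNReal.ofReal_mul (by positivity), ← Real.mul_rpow h1.le (by positivity),
    mul_inv_cancel₀ h1.ne', Real.one_rpow, ENNReal.ofReal_one, one_mul]

theorem priorDensity_pos {a : ℝ} (ha : 0 ≤ a) (ξ : 𝕜) : 0 < priorDensity 𝕜 a ξ := by
  unfold priorDensity; positivity

theorem log_priorDensity {a : ℝ} (ha : 0 ≤ a) (ξ : 𝕜) : Real.log (priorDensity 𝕜 a ξ)
    = -(betaDim 𝕜 / 2 * Real.log (1 + a)) + betaDim 𝕜 * a / (2 * (1 + a)) * ‖ξ‖ ^ 2 := by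
  have h1 : (0 : ℝ) < 1 + a := by linarith
  rw [priorDensity, Real.log_mul (by positivity) (by positivity), Real.log_rpow h1, Real.log_exp]
  ring

theorem measurable_priorDensity (a : ℝ) : Measurable (priorDensity 𝕜 a) := by
  unfold priorDensity; fun_prop

theorem lintegral_priorDensity_one {a : ℝ} (ha : 0 ≤ a) :
    ∫⁻ ξ : 𝕜, ENNReal.ofReal (priorDensity 𝕜 a ξ) ∂(betaGaussian 𝕜) = 1 := by
  have := lintegral_priorDensity (𝕜 := 𝕜) ha (g := fun _ => 1) measurable_const
  simpa using this

theorem lintegral_priorDensity_norm_sq {a c : ℝ} (ha : 0 ≤ a) (hc : 0 ≤ c) :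
    ∫⁻ ξ : 𝕜, ENNReal.ofReal (priorDensity 𝕜 a ξ) * ENNReal.ofReal (c * ‖ξ‖ ^ 2)
      ∂(betaGaussian 𝕜) = ENNReal.ofReal (c * (1 + a)) := by
  have hm : Measurable fun ξ : 𝕜 => ENNReal.ofReal (c * ‖ξ‖ ^ 2) := by fun_prop
  rw [lintegral_priorDensity ha hm]
  have e : ∀ ξ : 𝕜, ENNReal.ofReal (c * ‖((√(1 + a) : ℝ) : 𝕜) * ξ‖ ^ 2)
      = ENNReal.ofReal (c * (1 + a)) * ENNReal.ofReal (‖ξ‖ ^ 2) := by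
    intro ξ
    rw [norm_coe_mul, Real.sq_sqrt (by linarith), ← mul_assoc, ENNReal.ofReal_mul (by positivity)]
  simp only [e]
  rw [lintegral_const_mul' _ _ ENNReal.ofReal_ne_top, lintegral_norm_sq_betaGaussian, mul_one]

end Channel

/-! ### Entropy relation between the two families, and growth of the tilted entropy -/

section Channel

open InformationTheory

variable {𝕜 : Type*} [RCLike 𝕜] {φ : 𝕜 → 𝕜 → ℝ} {PA : Measure 𝕜} [IsProbabilityMeasure PA]
  {Pout : ℝ → 𝕜 → ℝ} {Q C : ℝ}

theorem measurable_smoothedDensity_prod {PA : Measure 𝕜} (h : IsChannelDensity φ PA Pout)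
    (Q s κ : ℝ) :
    Measurable fun p : 𝕜 × ℝ => smoothedDensity Pout Q s p.2 ((κ : 𝕜) * p.1) := by
  have hg : Measurable fun p : 𝕜 × ℝ => (p.2, (κ : 𝕜) * p.1) := by fun_prop
  exact (measurable_smoothedDensity h Q s).comp hg

theorem lintegral_mul_smoothedDensity {PA : Measure 𝕜} (h : IsChannelDensity φ PA Pout) {S : Set ℝ}
    {e : ℝ≥0∞} (he : ∀ z, ∫⁻ y in S, ENNReal.ofReal (Pout y z) = e) (Q s κ : ℝ) {r : 𝕜 → ℝ≥0∞}
    (hr : Measurable r) :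
    ∫⁻ p, r p.1 * smoothedDensity Pout Q s p.2 ((κ : 𝕜) * p.1)
      ∂((betaGaussian 𝕜).prod (volume.restrict S)) = (∫⁻ ξ, r ξ ∂(betaGaussian 𝕜)) * e := by
  have hm := measurable_smoothedDensity_prod h Q s κ
  have hr1 : Measurable fun p : 𝕜 × ℝ => r p.1 := hr.comp measurable_fst
  have hrm : Measurable fun p : 𝕜 × ℝ => r p.1 * smoothedDensity Pout Q s p.2 ((κ : 𝕜) * p.1) :=
    hr1.mul hm
  rw [lintegral_prod _ hrm.aemeasurable, ← lintegral_mul_const _ hr]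
  refine lintegral_congr fun ξ => ?_
  have hmξ : Measurable fun y => smoothedDensity Pout Q s y ((κ : 𝕜) * ξ) :=
    (measurable_smoothedDensity h Q s).comp measurable_prodMk_right
  simp only
  rw [lintegral_const_mul _ hmξ, lintegral_smoothedDensity_of_forall h he]

theorem ae_smoothedDensity_lt_top (h : IsChannelDensity φ PA Pout) (hφ : ChannelRegular φ)
    (hC : ∀ z a, |φ z a| ≤ C) (Q s κ : ℝ) :
    ∀ᵐ p ∂((betaGaussian 𝕜).prod (volume.restrict (Set.Icc (-C) C))),
      smoothedDensity Pout Q s p.2 ((κ : 𝕜) * p.1) < ∞ := by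
  refine ae_lt_top (measurable_smoothedDensity_prod h Q s κ) ?_
  have := lintegral_mul_smoothedDensity h (h.lintegral_Icc hφ hC) Q s κ (r := fun _ => 1)
    measurable_const
  simp only [one_mul, lintegral_const, measure_univ] at this
  rw [this]
  exact ENNReal.one_ne_top

/-- The rule `ln(pS) = ln p + ln S`, with `ln p` split into two nonnegative parts so that no
subtraction occurs in `[0, ∞]`. -/
theorem entropyFun_mul_identity {p c0 c1 : ℝ} (hp : 0 < p) (hc0 : 0 ≤ c0) (hc1 : 0 ≤ c1)
    (hlog : Real.log p = -c0 + c1) {S : ℝ≥0∞} (hS : S ≠ ∞) :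
    entropyFun (ENNReal.ofReal p * S) + ENNReal.ofReal p * S * ENNReal.ofReal c0 + ENNReal.ofReal p
      = ENNReal.ofReal p * entropyFun S + ENNReal.ofReal p * ENNReal.ofReal c1 * S + 1 := by
  obtain ⟨r, hr, rfl⟩ : ∃ r : ℝ, 0 ≤ r ∧ S = ENNReal.ofReal r :=
    ⟨S.toReal, ENNReal.toReal_nonneg, (ENNReal.ofReal_toReal hS).symm⟩
  have k1 := klFun_nonneg (mul_nonneg hp.le hr)
  have k2 := klFun_nonneg hr
  unfold entropyFun
  rw [← ENNReal.ofReal_mul hp.le, ENNReal.toReal_ofReal (by positivity), ENNReal.toReal_ofReal hr,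
    ← ENNReal.ofReal_mul (by positivity), ← ENNReal.ofReal_mul hp.le, ← ENNReal.ofReal_mul hp.le,
    ← ENNReal.ofReal_mul (by positivity), ← ENNReal.ofReal_one,
    ← ENNReal.ofReal_add k1 (by positivity), ← ENNReal.ofReal_add (by positivity) hp.le,
    ← ENNReal.ofReal_add (by positivity) (by positivity),
    ← ENNReal.ofReal_add (by positivity) zero_le_one]
  congr 1
  rcases hr.eq_or_lt with rfl | hr
  · simp [klFun_apply, add_comm]
  · rw [klFun_apply, klFun_apply, Real.log_mul hp.ne' hr.ne', hlog]
    ring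

/-- A chain rule: the joint entropy of the channel output and the side observation is the entropy of
the observation plus the smoothed entropy at residual variance `Q/(1 + a)`. It transports convexity
in `a` back to the channel. -/
theorem familyEntropy_tiltedDensity (h : IsChannelDensity φ PA Pout) (hφ : ChannelRegular φ)
    (hC : ∀ z a, |φ z a| ≤ C) (hQ : 0 ≤ Q) {a : ℝ} (ha : 0 ≤ a) :
    familyEntropy (tiltedDensity Pout Q) (volume.restrict (Set.Icc (-C) C)) a
        + ENNReal.ofReal (betaDim 𝕜 / 2 * Real.log (1 + a))
      = familyEntropy (smoothedDensity Pout Q) (volume.restrict (Set.Icc (-C) C))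
          (Q - Q / (1 + a)) + ENNReal.ofReal (betaDim 𝕜 * a / 2) := by
  have hβ := betaDim_pos 𝕜
  set ς : Measure ℝ := volume.restrict (Set.Icc (-C) C) with hς
  set s := Q - Q / (1 + a) with hs
  set κ := √Q * √a / (1 + a) with hκ
  set c0 := betaDim 𝕜 / 2 * Real.log (1 + a) with hc0
  have hc0' : 0 ≤ c0 := mul_nonneg (by positivity) (Real.log_nonneg (by linarith))
  have hmS := measurable_smoothedDensity_prod h Q s κ
  have hmp : Measurable fun p : 𝕜 × ℝ => ENNReal.ofReal (priorDensity 𝕜 a p.1) :=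
    ((measurable_priorDensity a).comp measurable_fst).ennreal_ofReal
  have hm1 : Measurable fun ξ : 𝕜 => ENNReal.ofReal (betaDim 𝕜 * a / (2 * (1 + a)) * ‖ξ‖ ^ 2) := by
    fun_prop
  have hone := h.lintegral_Icc hφ hC
  have T1 : familyEntropy (tiltedDensity Pout Q) ς a
      = ∫⁻ p, entropyFun (ENNReal.ofReal (priorDensity 𝕜 a p.1) *
          smoothedDensity Pout Q s p.2 ((κ : 𝕜) * p.1)) ∂((betaGaussian 𝕜).prod ς) := by
    refine lintegral_congr fun p => ?_
    rw [tiltedDensity_eq h hQ ha]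
  have T2 : ∫⁻ p, ENNReal.ofReal (priorDensity 𝕜 a p.1) *
      smoothedDensity Pout Q s p.2 ((κ : 𝕜) * p.1) * ENNReal.ofReal c0
        ∂((betaGaussian 𝕜).prod ς) = ENNReal.ofReal c0 := by
    rw [lintegral_mul_const' _ _ ENNReal.ofReal_ne_top, lintegral_mul_smoothedDensity h hone Q s κ
      (r := fun ξ => ENNReal.ofReal (priorDensity 𝕜 a ξ))
      (measurable_priorDensity a).ennreal_ofReal, lintegral_priorDensity_one ha, one_mul, one_mul]
  have T3 : ∫⁻ p, ENNReal.ofReal (priorDensity 𝕜 a p.1) ∂((betaGaussian 𝕜).prod ς)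
      = ς Set.univ := by
    rw [lintegral_prod _ hmp.aemeasurable]
    simp only [lintegral_const]
    rw [lintegral_mul_const _ (measurable_priorDensity a).ennreal_ofReal,
      lintegral_priorDensity_one ha, one_mul]
  have hmE : Measurable fun p : 𝕜 × ℝ => entropyFun (ENNReal.ofReal (priorDensity 𝕜 a p.1) *
      smoothedDensity Pout Q s p.2 ((κ : 𝕜) * p.1)) := measurable_entropyFun.comp (hmp.mul hmS)
  have hmE' : Measurable fun p : 𝕜 × ℝ => ENNReal.ofReal (priorDensity 𝕜 a p.1) *
      entropyFun (smoothedDensity Pout Q s p.2 ((κ : 𝕜) * p.1)) :=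
    hmp.mul (measurable_entropyFun.comp hmS)
  have T4 : ∫⁻ p, ENNReal.ofReal (priorDensity 𝕜 a p.1) *
      entropyFun (smoothedDensity Pout Q s p.2 ((κ : 𝕜) * p.1)) ∂((betaGaussian 𝕜).prod ς)
      = familyEntropy (smoothedDensity Pout Q) ς s := by
    rw [lintegral_prod_symm _ hmE'.aemeasurable,
      (isGaussianMartingale_smoothedDensity h hφ hC Q).familyEntropy_eq]
    refine lintegral_congr fun y => ?_
    have hmy : Measurable fun ξ : 𝕜 => entropyFun (smoothedDensity Pout Q s y ((κ : 𝕜) * ξ)) :=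
      measurable_entropyFun.comp (hmS.comp measurable_prodMk_right)
    rw [lintegral_priorDensity ha hmy]
    refine lintegral_congr fun ξ => ?_
    have e : κ * √(1 + a) = √s := by
      have h1 : (0 : ℝ) < 1 + a := by linarith
      have e1 : s = Q * a / (1 + a) := by rw [hs]; field_simp; ring
      rw [e1, Real.sqrt_div (by positivity), Real.sqrt_mul hQ, hκ]
      have h2 : 0 < √(1 + a) := Real.sqrt_pos.mpr h1
      rw [div_mul_eq_mul_div, div_eq_div_iff h1.ne' h2.ne', mul_assoc, Real.mul_self_sqrt h1.le]
    rw [← mul_assoc, ← RCLike.ofReal_mul, e]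
  have T5 : ∫⁻ p, ENNReal.ofReal (priorDensity 𝕜 a p.1) *
      ENNReal.ofReal (betaDim 𝕜 * a / (2 * (1 + a)) * ‖p.1‖ ^ 2) *
      smoothedDensity Pout Q s p.2 ((κ : 𝕜) * p.1) ∂((betaGaussian 𝕜).prod ς)
      = ENNReal.ofReal (betaDim 𝕜 * a / 2) := by
    rw [lintegral_mul_smoothedDensity h hone Q s κ
      (r := fun ξ => ENNReal.ofReal (priorDensity 𝕜 a ξ) *
        ENNReal.ofReal (betaDim 𝕜 * a / (2 * (1 + a)) * ‖ξ‖ ^ 2))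
      ((measurable_priorDensity a).ennreal_ofReal.mul hm1),
      lintegral_priorDensity_norm_sq ha (by positivity), mul_one]
    congr 1
    have h1 : (0 : ℝ) < 1 + a := by linarith
    field_simp
  -- The pointwise identity is integrated. The finite mass of `ς` occurs on both sides and is
  -- cancelled at the end.
  have hmid : ∫⁻ p, (entropyFun (ENNReal.ofReal (priorDensity 𝕜 a p.1) *
          smoothedDensity Pout Q s p.2 ((κ : 𝕜) * p.1))
        + ENNReal.ofReal (priorDensity 𝕜 a p.1) *
          smoothedDensity Pout Q s p.2 ((κ : 𝕜) * p.1) * ENNReal.ofReal c0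
        + ENNReal.ofReal (priorDensity 𝕜 a p.1)) ∂((betaGaussian 𝕜).prod ς)
      = ∫⁻ p, (ENNReal.ofReal (priorDensity 𝕜 a p.1) *
          entropyFun (smoothedDensity Pout Q s p.2 ((κ : 𝕜) * p.1))
        + ENNReal.ofReal (priorDensity 𝕜 a p.1) *
          ENNReal.ofReal (betaDim 𝕜 * a / (2 * (1 + a)) * ‖p.1‖ ^ 2) *
          smoothedDensity Pout Q s p.2 ((κ : 𝕜) * p.1) + 1) ∂((betaGaussian 𝕜).prod ς) := by
    refine lintegral_congr_ae ?_
    filter_upwards [ae_smoothedDensity_lt_top h hφ hC Q s κ] with p hp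
    exact entropyFun_mul_identity (priorDensity_pos ha p.1) hc0' (by positivity)
      (log_priorDensity ha p.1) hp.ne
  rw [lintegral_add_right _ hmp, lintegral_add_left hmE, T2, T3, ← T1,
    lintegral_add_right _ measurable_const, lintegral_add_left hmE', T4, T5, lintegral_const, one_mul,
    ← Set.univ_prod_univ, Measure.prod_prod, measure_univ (μ := betaGaussian 𝕜), one_mul] at hmid
  exact (ENNReal.add_left_inj (measure_ne_top ς _)).mp hmid

theorem entropyFun_le_of_le {F f : ℝ≥0∞} {c : ℝ} (hc : 0 ≤ c) (hf : f ≠ ∞)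
    (hF : F ≤ ENNReal.ofReal (Real.exp c) * f) :
    entropyFun F ≤ F * ENNReal.ofReal c + F * ENNReal.ofReal (Real.log f.toReal) + 1 := by
  have hF' : F ≠ ∞ := ne_top_of_le_ne_top (ENNReal.mul_ne_top ENNReal.ofReal_ne_top hf) hF
  obtain ⟨x, hx, rfl⟩ : ∃ r : ℝ, 0 ≤ r ∧ F = ENNReal.ofReal r :=
    ⟨F.toReal, ENNReal.toReal_nonneg, (ENNReal.ofReal_toReal hF').symm⟩
  obtain ⟨g, hg, rfl⟩ : ∃ r : ℝ, 0 ≤ r ∧ f = ENNReal.ofReal r :=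
    ⟨f.toReal, ENNReal.toReal_nonneg, (ENNReal.ofReal_toReal hf).symm⟩
  rw [← ENNReal.ofReal_mul (Real.exp_pos _).le, ENNReal.ofReal_le_ofReal_iff (by positivity)] at hF
  rw [entropyFun, ENNReal.toReal_ofReal hx, ENNReal.toReal_ofReal hg, ← ENNReal.ofReal_mul hx]
  rcases hx.eq_or_lt with rfl | hx0
  · simp [klFun_apply]
  · have hg0 : 0 < g := by
      rcases hg.eq_or_lt with rfl | h
      · simp only [mul_zero] at hF; linarith
      · exact h
    have h1 : Real.log x ≤ c + Real.log g := by
      rw [← Real.log_exp c, ← Real.log_mul (Real.exp_pos _).ne' hg0.ne']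
      exact Real.log_le_log hx0 hF
    have h2 : klFun x ≤ x * c + x * max (Real.log g) 0 + 1 := by
      rw [klFun_apply]
      have h3 : x * Real.log x ≤ x * (c + max (Real.log g) 0) := by
        gcongr
        linarith [le_max_left (Real.log g) 0]
      nlinarith
    refine (ENNReal.ofReal_le_ofReal h2).trans (le_of_eq ?_)
    rw [ENNReal.ofReal_add (by positivity) zero_le_one, ENNReal.ofReal_add (by positivity)
      (by positivity), ENNReal.ofReal_mul (q := max _ _) hx, ENNReal.ofReal_max,
      ENNReal.ofReal_zero, max_eq_left (by simp), ENNReal.ofReal_one]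

theorem mul_ofReal_log_le (f : ℝ≥0∞) (hf : f ≠ ∞) :
    f * ENNReal.ofReal (Real.log f.toReal) ≤ entropyFun f + f := by
  obtain ⟨g, hg, rfl⟩ : ∃ r : ℝ, 0 ≤ r ∧ f = ENNReal.ofReal r :=
    ⟨f.toReal, ENNReal.toReal_nonneg, (ENNReal.ofReal_toReal hf).symm⟩
  have h1 := klFun_nonneg hg
  rw [entropyFun, ENNReal.toReal_ofReal hg, ← ENNReal.ofReal_mul hg, ← ENNReal.ofReal_add h1 hg]
  refine ENNReal.ofReal_le_ofReal ?_
  rw [klFun_apply]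
  linarith

/-- From `√a ξ · z - a |z|²/2 ≤ |ξ|²/2`. -/
theorem tiltedDensity_le (Pout : ℝ → 𝕜 → ℝ) (Q : ℝ) {a : ℝ} (ha : 0 ≤ a) (y : ℝ) (ξ : 𝕜) :
    tiltedDensity Pout Q a y (((√a : ℝ) : 𝕜) * ξ)
      ≤ ENNReal.ofReal (Real.exp (betaDim 𝕜 / 2 * ‖ξ‖ ^ 2)) * tiltedDensity Pout Q 0 y 0 := by
  have hβ := betaDim_pos 𝕜
  unfold tiltedDensity
  rw [← lintegral_const_mul' _ _ ENNReal.ofReal_ne_top]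
  refine lintegral_mono fun z => ?_
  rw [← mul_assoc]
  gcongr
  rw [← ENNReal.ofReal_mul (Real.exp_pos _).le, ← Real.exp_add]
  refine ENNReal.ofReal_le_ofReal (Real.exp_le_exp.mpr ?_)
  have h1 : 0 ≤ ‖ξ - ((√a : ℝ) : 𝕜) * z‖ ^ 2 := by positivity
  have h2 : dot (((√a : ℝ) : 𝕜) * ξ) z = inner ℝ ξ (((√a : ℝ) : 𝕜) * z) := by
    simp only [dot_eq_inner, ← RCLike.real_smul_eq_coe_mul, real_inner_smul_left,
      real_inner_smul_right]
  rw [@norm_sub_sq_real, norm_coe_mul, Real.sq_sqrt ha] at h1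
  rw [h2]
  simp only [dot, map_zero, zero_mul, mul_zero, add_zero]
  nlinarith

theorem measurable_tiltedDensity_prod {PA : Measure 𝕜} (h : IsChannelDensity φ PA Pout)
    (Q a κ : ℝ) :
    Measurable fun p : 𝕜 × ℝ => tiltedDensity Pout Q a p.2 ((κ : 𝕜) * p.1) := by
  have hg : Measurable fun p : 𝕜 × ℝ => (p.2, (κ : 𝕜) * p.1) := by fun_prop
  have hm := (measurable_tiltedDensity h Q a).comp hg
  exact hm

theorem measurable_tiltedDensity_left {PA : Measure 𝕜} (h : IsChannelDensity φ PA Pout)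
    (Q a : ℝ) (w : 𝕜) : Measurable fun y => tiltedDensity Pout Q a y w := by
  have hg : Measurable fun y : ℝ => (y, w) := by fun_prop
  have hm := (measurable_tiltedDensity h Q a).comp hg
  exact hm

theorem lintegral_tiltedDensity_mul_norm_sq (h : IsChannelDensity φ PA Pout)
    (hφ : ChannelRegular φ) (hC : ∀ z a, |φ z a| ≤ C) (hQ : 0 ≤ Q) {a : ℝ} (ha : 0 ≤ a) :
    ∫⁻ p, tiltedDensity Pout Q a p.2 (((√a : ℝ) : 𝕜) * p.1) *
      ENNReal.ofReal (betaDim 𝕜 / 2 * ‖p.1‖ ^ 2)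
        ∂((betaGaussian 𝕜).prod (volume.restrict (Set.Icc (-C) C)))
      = ENNReal.ofReal (betaDim 𝕜 / 2 * (1 + a)) := by
  have hβ := betaDim_pos 𝕜
  have hr : Measurable fun ξ : 𝕜 => ENNReal.ofReal (priorDensity 𝕜 a ξ) *
      ENNReal.ofReal (betaDim 𝕜 / 2 * ‖ξ‖ ^ 2) := by
    have h1 : Measurable fun ξ : 𝕜 => ENNReal.ofReal (betaDim 𝕜 / 2 * ‖ξ‖ ^ 2) := by fun_prop
    exact (measurable_priorDensity a).ennreal_ofReal.mul h1
  have h1 := lintegral_mul_smoothedDensity h (h.lintegral_Icc hφ hC) Q (Q - Q / (1 + a))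
    (√Q * √a / (1 + a)) hr
  rw [mul_one, lintegral_priorDensity_norm_sq (𝕜 := 𝕜) ha (by positivity)] at h1
  rw [← h1]
  refine lintegral_congr fun p => ?_
  rw [tiltedDensity_eq h hQ ha, mul_right_comm]

/-- The logarithm does not depend on `ξ`, so the martingale property replaces the tilt at `a` by the
one at zero. -/
theorem lintegral_tiltedDensity_mul_log_le (h : IsChannelDensity φ PA Pout)
    (hφ : ChannelRegular φ) (hC : ∀ z a, |φ z a| ≤ C) {a : ℝ} (ha : 0 ≤ a) :
    ∫⁻ p, tiltedDensity Pout Q a p.2 (((√a : ℝ) : 𝕜) * p.1) *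
      ENNReal.ofReal (Real.log (tiltedDensity Pout Q 0 p.2 (0 : 𝕜)).toReal)
        ∂((betaGaussian 𝕜).prod (volume.restrict (Set.Icc (-C) C)))
      ≤ familyEntropy (tiltedDensity Pout Q) (volume.restrict (Set.Icc (-C) C)) 0 + 1 := by
  have hM := isGaussianMartingale_tiltedDensity h hφ hC Q
  have hmF := measurable_tiltedDensity_prod h Q a √a
  have hmf := measurable_tiltedDensity_left h Q 0 (0 : 𝕜)
  have hmFf : Measurable fun p : 𝕜 × ℝ => tiltedDensity Pout Q a p.2 (((√a : ℝ) : 𝕜) * p.1) *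
      ENNReal.ofReal (Real.log (tiltedDensity Pout Q 0 p.2 (0 : 𝕜)).toReal) := by
    have h1 : Measurable fun p : 𝕜 × ℝ => p.2 := measurable_snd
    have h2 := (hmf.comp h1).ennreal_toReal.log.ennreal_ofReal
    have h3 := hmF.mul h2
    exact h3
  have e1 : ∫⁻ y in Set.Icc (-C) C, tiltedDensity Pout Q 0 y (0 : 𝕜) = 1 := by
    simp only [tiltedDensity_zero]
    exact lintegral_smoothedDensity_of_forall h (h.lintegral_Icc hφ hC) Q 0 0
  rw [lintegral_prod_symm _ hmFf.aemeasurable, hM.familyEntropy_eq, ← e1,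
    ← lintegral_add_right _ hmf]
  refine lintegral_mono_ae ?_
  filter_upwards [hM.finite] with y hy
  have hmy : Measurable fun ξ : 𝕜 => tiltedDensity Pout Q a y (((√a : ℝ) : 𝕜) * ξ) := by
    have h1 : Measurable fun ξ : 𝕜 => (ξ, y) := by fun_prop
    have h2 := hmF.comp h1
    exact h2
  rw [lintegral_mul_const _ hmy, hM.lintegral_eq ha y]
  simp only [Real.sqrt_zero, map_zero, zero_mul, lintegral_const, measure_univ, mul_one]
  exact mul_ofReal_log_le _ hy

/-- Two consequences matter: finiteness at `a = 0` propagates to all `a`, and the growth rate in `a`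
is at most `β/2`, since `|ξ|²` has mean `1 + a` under the tilted law. -/
theorem familyEntropy_tiltedDensity_le (h : IsChannelDensity φ PA Pout) (hφ : ChannelRegular φ)
    (hC : ∀ z a, |φ z a| ≤ C) (hQ : 0 ≤ Q) {a : ℝ} (ha : 0 ≤ a) :
    familyEntropy (tiltedDensity Pout Q) (volume.restrict (Set.Icc (-C) C)) a
      ≤ ENNReal.ofReal (betaDim 𝕜 / 2 * (1 + a))
        + (familyEntropy (tiltedDensity Pout Q) (volume.restrict (Set.Icc (-C) C)) 0 + 1)
        + volume (Set.Icc (-C) C) := by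
  have hβ := betaDim_pos 𝕜
  have hM := isGaussianMartingale_tiltedDensity h hφ hC Q
  have hfin : ∀ᵐ p ∂((betaGaussian 𝕜).prod (volume.restrict (Set.Icc (-C) C))),
      tiltedDensity Pout Q 0 p.2 (0 : 𝕜) ≠ ∞ :=
    Measure.quasiMeasurePreserving_snd.ae hM.finite
  have hmn : Measurable fun p : 𝕜 × ℝ => ENNReal.ofReal (betaDim 𝕜 / 2 * ‖p.1‖ ^ 2) := by fun_prop
  have hmFn : Measurable fun p : 𝕜 × ℝ => tiltedDensity Pout Q a p.2 (((√a : ℝ) : 𝕜) * p.1) *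
      ENNReal.ofReal (betaDim 𝕜 / 2 * ‖p.1‖ ^ 2) :=
    (measurable_tiltedDensity_prod h Q a √a).mul hmn
  have hle : familyEntropy (tiltedDensity Pout Q) (volume.restrict (Set.Icc (-C) C)) a
      ≤ ∫⁻ p, (tiltedDensity Pout Q a p.2 (((√a : ℝ) : 𝕜) * p.1) *
          ENNReal.ofReal (betaDim 𝕜 / 2 * ‖p.1‖ ^ 2)
        + tiltedDensity Pout Q a p.2 (((√a : ℝ) : 𝕜) * p.1) *
          ENNReal.ofReal (Real.log (tiltedDensity Pout Q 0 p.2 (0 : 𝕜)).toReal) + 1)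
        ∂((betaGaussian 𝕜).prod (volume.restrict (Set.Icc (-C) C))) := by
    refine lintegral_mono_ae ?_
    filter_upwards [hfin] with p hp
    exact entropyFun_le_of_le (by positivity) hp (tiltedDensity_le Pout Q ha p.2 p.1)
  rw [lintegral_add_right _ measurable_const, lintegral_add_left hmFn,
    lintegral_tiltedDensity_mul_norm_sq h hφ hC hQ ha, lintegral_const, one_mul,
    ← Set.univ_prod_univ, Measure.prod_prod, measure_univ (μ := betaGaussian 𝕜), one_mul,
    Measure.restrict_apply_univ] at hle
  have h2 := lintegral_tiltedDensity_mul_log_le (Q := Q) h hφ hC ha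
  exact hle.trans (by gcongr)

end Channel

/-! ### Channel entropy as a family entropy, and slope bounds -/

section Channel

open InformationTheory

variable {𝕜 : Type*} [RCLike 𝕜] {φ : 𝕜 → 𝕜 → ℝ} {PA : Measure 𝕜} [IsProbabilityMeasure PA]
  {Pout : ℝ → 𝕜 → ℝ} {Q C : ℝ}

theorem Zout_eq_toReal {PA : Measure 𝕜} (h : IsChannelDensity φ PA Pout) (Q s y : ℝ) (w : 𝕜) :
    Zout Pout y w (Q - s) = (smoothedDensity Pout Q s y w).toReal := by
  rw [Zout, integral_eq_lintegral_of_nonneg_ae (ae_of_all _ fun z => h.nonneg _ _)]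
  · rfl
  · have hg : Measurable fun z : 𝕜 => (y, ((√(Q - s) : ℝ) : 𝕜) * z + w) := by fun_prop
    have := h.measurable.comp hg
    exact this.aestronglyMeasurable

/-- Extended entropy integrals through the nonnegative function `x ln x + 1 - x`. -/
theorem eintegral_mul_log {X : Type*} [MeasurableSpace X] {μ : Measure X} {S : Set X}
    (hS : MeasurableSet S) (hμS : μ S ≠ ∞) {F : X → ℝ≥0∞} (hF : Measurable F)
    (hout : ∫⁻ x in Sᶜ, F x ∂μ = 0) (hin : ∫⁻ x in S, F x ∂μ = 1) :
    eintegral μ (fun x => (F x).toReal * Real.log (F x).toReal)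
      = ((∫⁻ x in S, entropyFun (F x) ∂μ : ℝ≥0∞) : EReal) + ((1 - (μ S).toReal : ℝ) : EReal) := by
  have hf0 : ∀ᵐ x ∂(μ.restrict Sᶜ), F x = 0 := (lintegral_eq_zero_iff hF).mp hout
  have hred : ∀ g : ℝ → ℝ, g 0 = 0 →
      ∫⁻ x, ENNReal.ofReal (g (F x).toReal) ∂μ = ∫⁻ x in S, ENNReal.ofReal (g (F x).toReal) ∂μ := by
    intro g hg
    rw [← lintegral_add_compl _ hS]
    have : ∫⁻ x in Sᶜ, ENNReal.ofReal (g (F x).toReal) ∂μ = ∫⁻ x in Sᶜ, 0 ∂μ := by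
      refine lintegral_congr_ae ?_
      filter_upwards [hf0] with x hx
      simp [hx, hg]
    rw [this, lintegral_zero, add_zero]
  unfold eintegral
  rw [hred (fun x => x * Real.log x) (by simp), hred (fun x => -(x * Real.log x)) (by simp)]
  have hmr : Measurable fun x => (F x).toReal := hF.ennreal_toReal
  have hml : Measurable fun x => (F x).toReal * Real.log (F x).toReal := hmr.mul hmr.log
  have hb : ∫⁻ x in S, ENNReal.ofReal (-((F x).toReal * Real.log (F x).toReal)) ∂μ ≠ ∞ := by
    refine ne_top_of_le_ne_top (b := ∫⁻ x in S, 1 ∂μ) (by simpa using hμS) ?_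
    refine lintegral_mono fun x => ?_
    rw [← ENNReal.ofReal_one]
    refine ENNReal.ofReal_le_ofReal ?_
    have h1 := klFun_nonneg (x := (F x).toReal) ENNReal.toReal_nonneg
    have h2 : 0 ≤ (F x).toReal := ENNReal.toReal_nonneg
    rw [klFun_apply] at h1
    linarith
  have hfin : ∀ᵐ x ∂(μ.restrict S), F x < ∞ := ae_lt_top hF (by rw [hin]; exact ENNReal.one_ne_top)
  -- The identity `(x ln x + 1 - x) + x + (x ln x)⁻ = (x ln x)⁺ + 1`, arranged additively so that it
  -- survives infinite values.
  have key : ∫⁻ x in S, (entropyFun (F x) + F x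
        + ENNReal.ofReal (-((F x).toReal * Real.log (F x).toReal))) ∂μ
      = ∫⁻ x in S, (ENNReal.ofReal ((F x).toReal * Real.log (F x).toReal) + 1) ∂μ := by
    refine lintegral_congr_ae ?_
    filter_upwards [hfin] with x hx
    have h1 := klFun_nonneg (x := (F x).toReal) ENNReal.toReal_nonneg
    have h2 : 0 ≤ (F x).toReal := ENNReal.toReal_nonneg
    have h3 : F x = ENNReal.ofReal (F x).toReal := (ENNReal.ofReal_toReal hx.ne).symm
    have h4 : klFun (F x).toReal + (F x).toReal = (F x).toReal * Real.log (F x).toReal + 1 := by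
      rw [klFun_apply]; ring
    have h5 : entropyFun (F x) + F x
        = ENNReal.ofReal ((F x).toReal * Real.log (F x).toReal + 1) := by
      rw [← h4, ENNReal.ofReal_add h1 h2, ← h3, entropyFun]
    rw [h5]
    rcases le_total 0 ((F x).toReal * Real.log (F x).toReal) with h | h
    · rw [ENNReal.ofReal_of_nonpos (neg_nonpos.mpr h), add_zero,
        ENNReal.ofReal_add h zero_le_one, ENNReal.ofReal_one]
    · rw [ENNReal.ofReal_of_nonpos h, ← ENNReal.ofReal_add (by linarith) (by linarith)]
      simp
  have hmln : Measurable fun x => ENNReal.ofReal (-((F x).toReal * Real.log (F x).toReal)) := by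
    have hm := hml.neg.ennreal_ofReal
    exact hm
  rw [lintegral_add_right _ hmln, lintegral_add_right _ hF, hin,
    lintegral_add_right _ measurable_const, lintegral_const, one_mul,
    Measure.restrict_apply_univ] at key
  set A := ∫⁻ x in S, ENNReal.ofReal ((F x).toReal * Real.log (F x).toReal) ∂μ
  set D := ∫⁻ x in S, ENNReal.ofReal (-((F x).toReal * Real.log (F x).toReal)) ∂μ
  set E := ∫⁻ x in S, entropyFun (F x) ∂μ
  set L := μ S
  by_cases hE : E = ∞
  · have hA : A = ∞ := by
      rw [hE, top_add, top_add] at key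
      by_contra hA
      exact (ENNReal.add_ne_top.mpr ⟨hA, hμS⟩) key.symm
    rw [hA, hE, EReal.coe_ennreal_top, EReal.top_add_coe]
    have c : (D : EReal) = ((D.toReal : ℝ) : EReal) := (EReal.coe_ennreal_toReal hb).symm
    rw [c]
    exact EReal.top_sub_coe _
  · have hA : A ≠ ∞ := by
      intro hA
      rw [hA, top_add] at key
      exact (ENNReal.add_ne_top.mpr ⟨ENNReal.add_ne_top.mpr ⟨hE, ENNReal.one_ne_top⟩, hb⟩) key
    have key' := congrArg ENNReal.toReal key
    rw [ENNReal.toReal_add (ENNReal.add_ne_top.mpr ⟨hE, ENNReal.one_ne_top⟩) hb,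
      ENNReal.toReal_add hE ENNReal.one_ne_top, ENNReal.toReal_add hA hμS,
      ENNReal.toReal_one] at key'
    have c : ∀ x : ℝ≥0∞, x ≠ ∞ → (x : EReal) = ((x.toReal : ℝ) : EReal) := fun x hx =>
      (EReal.coe_ennreal_toReal hx).symm
    rw [c A hA, c D hb, c E hE, ← EReal.coe_sub, ← EReal.coe_add]
    congr 1
    linarith

/-- The output lies in `[-C, C]` and has total mass one. Replacing `x ln x` by `x ln x + 1 - x` on
this interval costs the constant `1 - |[-C, C]|`. -/
theorem channelEntropy_eq (h : IsChannelDensity φ PA Pout) (hφ : ChannelRegular φ)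
    (hC : ∀ z a, |φ z a| ≤ C) (Q s : ℝ) :
    channelEntropy Pout s (Q - s)
      = ((familyEntropy (smoothedDensity Pout Q) (volume.restrict (Set.Icc (-C) C)) s : ℝ≥0∞)
          : EReal) + ((1 - (volume (Set.Icc (-C) C)).toReal : ℝ) : EReal) := by
  have hm := measurable_smoothedDensity_prod h Q s √s
  have hrestr : ∀ S : Set ℝ, ((betaGaussian 𝕜).prod (volume : Measure ℝ)).restrict
      (Set.univ ×ˢ S) = (betaGaussian 𝕜).prod (volume.restrict S) := fun S => by
    rw [← Measure.prod_restrict, Measure.restrict_univ]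
  have hmass : ∀ {S : Set ℝ} {e : ℝ≥0∞} (_ : ∀ z, ∫⁻ y in S, ENNReal.ofReal (Pout y z) = e),
      ∫⁻ p, smoothedDensity Pout Q s p.2 (((√s : ℝ) : 𝕜) * p.1)
        ∂((betaGaussian 𝕜).prod (volume.restrict S)) = e := by
    intro S e he
    have := lintegral_mul_smoothedDensity h he Q s √s (r := fun _ => 1) measurable_const
    simpa using this
  have hS : MeasurableSet ((Set.univ : Set 𝕜) ×ˢ Set.Icc (-C) C) :=
    MeasurableSet.univ.prod measurableSet_Icc
  have hvol : (betaGaussian 𝕜).prod (volume : Measure ℝ) (Set.univ ×ˢ Set.Icc (-C) C)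
      = volume (Set.Icc (-C) C) := by
    rw [Measure.prod_prod, measure_univ, one_mul]
  have hcompl : ((Set.univ : Set 𝕜) ×ˢ Set.Icc (-C) C)ᶜ = Set.univ ×ˢ (Set.Icc (-C) C)ᶜ := by
    ext p; simp
  have key := eintegral_mul_log (μ := (betaGaussian 𝕜).prod (volume : Measure ℝ)) hS
    (by rw [hvol]; exact measure_Icc_lt_top.ne) hm
    (by rw [hcompl, hrestr]; exact hmass (h.lintegral_compl_Icc hφ hC))
    (by rw [hrestr]; exact hmass (h.lintegral_Icc hφ hC))
  rw [hvol, hrestr] at key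
  rw [channelEntropy]
  simp only [Zout_eq_toReal h Q s]
  exact key

/-- For `a > 0`, the lower bound on increments, applied as `b` increases to `a`, bounds a
subgradient from below; the linear growth bound at infinity bounds it from above. At `a = 0` slope
zero works by monotonicity. -/
theorem exists_slope_bounds {θ : ℝ → ℝ} {κ c : ℝ} (hκ : 0 ≤ κ) (hθm : MonotoneOn θ (Set.Ici 0))
    (hθc : ConvexOn ℝ (Set.Ici 0) θ) (hθb : ∀ a, 0 ≤ a → θ a ≤ κ * a + c)
    (hθl : ∀ a b, 0 ≤ a → a ≤ b → κ * ((b - a) - Real.log ((1 + b) / (1 + a))) ≤ θ b - θ a)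
    {a : ℝ} (ha : 0 ≤ a) :
    ∃ g : ℝ, κ * (a / (1 + a)) ≤ g ∧ g ≤ κ ∧ ∀ b, 0 ≤ b → θ a + g * (b - a) ≤ θ b := by
  rcases ha.eq_or_lt with rfl | ha
  · refine ⟨0, by simp, hκ, fun b hb => ?_⟩
    have := hθm (Set.mem_Ici.mpr le_rfl) (Set.mem_Ici.mpr hb) hb
    linarith
  · obtain ⟨g, hg⟩ := exists_subgradient hθc (x := a) (by rw [interior_Ici]; exact ha)
    refine ⟨g, ?_, ?_, fun b hb => hg b hb⟩
    · have key : ∀ b, 0 ≤ b → b < a → κ * (1 - 1 / (1 + b)) ≤ g := by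
        intro b hb hba
        have h1 := hg b hb
        have h2 := hθl b a hb hba.le
        have h3 : Real.log ((1 + a) / (1 + b)) ≤ (a - b) * (1 / (1 + b)) := by
          have h4 := Real.log_le_sub_one_of_pos (x := (1 + a) / (1 + b)) (by positivity)
          have h5 : (1 + a) / (1 + b) - 1 = (a - b) * (1 / (1 + b)) := by
            field_simp; ring
          linarith
        have h6 : κ * ((a - b) * (1 - 1 / (1 + b))) ≤ κ * ((a - b) -
            Real.log ((1 + a) / (1 + b))) := by
          gcongr
          linarith
        have h7 : (a - b) * (κ * (1 - 1 / (1 + b))) ≤ (a - b) * g := by linarith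
        exact le_of_mul_le_mul_left h7 (by linarith)
      have hcont : Tendsto (fun b : ℝ => κ * (1 - 1 / (1 + b))) (𝓝[<] a)
          (𝓝 (κ * (1 - 1 / (1 + a)))) := by
        have : ContinuousAt (fun b : ℝ => κ * (1 - 1 / (1 + b))) a := by
          have h0 : 1 + a ≠ 0 := by positivity
          fun_prop (disch := assumption)
        exact this.tendsto.mono_left nhdsWithin_le_nhds
      have h1 := le_of_tendsto hcont (by
        filter_upwards [Ioo_mem_nhdsLT ha] with b hb
        exact key b hb.1.le hb.2)
      have h2 : 1 - 1 / (1 + a) = a / (1 + a) := by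
        have h0 : 1 + a ≠ 0 := by positivity
        field_simp; ring
      rwa [h2] at h1
    · by_contra! hlt
      -- A point so far away that a slope above `κ` would violate the linear growth bound.
      set b := a + (|c - θ a + κ * a| + 1) / (g - κ) with hb
      have hgk : 0 < g - κ := by linarith
      have hpos : 0 < (|c - θ a + κ * a| + 1) / (g - κ) := by positivity
      have h1 := hg b (Set.mem_Ici.mpr (by linarith))
      have h2 := hθb b (by linarith)
      have h3 : (g - κ) * (b - a) = |c - θ a + κ * a| + 1 := by
        rw [hb]; field_simp; ring
      have h4 := le_abs_self (c - θ a + κ * a)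
      nlinarith

end Channel

/-! ### The channel potential -/

section Channel

variable {𝕜 : Type*} [RCLike 𝕜] {φ : 𝕜 → 𝕜 → ℝ} {PA : Measure 𝕜} [IsProbabilityMeasure PA]
  {Pout : ℝ → 𝕜 → ℝ} {Q C : ℝ}

theorem IsGaussianMartingale.restrict {K : ℝ → ℝ → 𝕜 → ℝ≥0∞} {ς : Measure ℝ} {I J : Set ℝ}
    (hK : IsGaussianMartingale K ς I) (hJI : J ⊆ I)
    (hJ : ∀ t ∈ J, ∀ s, 0 ≤ s → s ≤ t → s ∈ J) : IsGaussianMartingale K ς J where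
  nonneg t ht := hK.nonneg t (hJI ht)
  down := hJ
  measurable := hK.measurable
  step t c ht hc htc := hK.step t c ht hc (hJI htc)
  finite := hK.finite

theorem familyEntropy_tiltedDensity_ne_top (h : IsChannelDensity φ PA Pout)
    (hφ : ChannelRegular φ) (hC : ∀ z a, |φ z a| ≤ C) (hQ : 0 ≤ Q)
    (h0 : familyEntropy (smoothedDensity Pout Q) (volume.restrict (Set.Icc (-C) C)) 0 ≠ ∞)
    {a : ℝ} (ha : 0 ≤ a) :
    familyEntropy (tiltedDensity Pout Q) (volume.restrict (Set.Icc (-C) C)) a ≠ ∞ := by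
  have h1 := familyEntropy_tiltedDensity h hφ hC hQ (le_refl (0 : ℝ))
  simp only [add_zero, Real.log_one, mul_zero, ENNReal.ofReal_zero, div_one, sub_self,
    zero_div] at h1
  refine ne_top_of_le_ne_top ?_ (familyEntropy_tiltedDensity_le h hφ hC hQ ha)
  rw [h1]
  exact ENNReal.add_ne_top.mpr ⟨ENNReal.add_ne_top.mpr ⟨ENNReal.ofReal_ne_top,
    ENNReal.add_ne_top.mpr ⟨h0, ENNReal.one_ne_top⟩⟩, measure_Icc_lt_top.ne⟩

theorem familyEntropy_smoothedDensity_ne_top (h : IsChannelDensity φ PA Pout)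
    (hφ : ChannelRegular φ) (hC : ∀ z a, |φ z a| ≤ C) (hQ : 0 ≤ Q)
    (h0 : familyEntropy (smoothedDensity Pout Q) (volume.restrict (Set.Icc (-C) C)) 0 ≠ ∞)
    {a : ℝ} (ha : 0 ≤ a) :
    familyEntropy (smoothedDensity Pout Q) (volume.restrict (Set.Icc (-C) C))
      (Q - Q / (1 + a)) ≠ ∞ := by
  have h1 := familyEntropy_tiltedDensity h hφ hC hQ ha
  have h2 := familyEntropy_tiltedDensity_ne_top h hφ hC hQ h0 ha
  intro htop
  rw [htop, top_add] at h1
  exact ENNReal.add_ne_top.mpr ⟨h2, ENNReal.ofReal_ne_top⟩ h1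

theorem toReal_familyEntropy_tiltedDensity (h : IsChannelDensity φ PA Pout)
    (hφ : ChannelRegular φ) (hC : ∀ z a, |φ z a| ≤ C) (hQ : 0 ≤ Q)
    (h0 : familyEntropy (smoothedDensity Pout Q) (volume.restrict (Set.Icc (-C) C)) 0 ≠ ∞)
    {a : ℝ} (ha : 0 ≤ a) :
    (familyEntropy (tiltedDensity Pout Q) (volume.restrict (Set.Icc (-C) C)) a).toReal
        + betaDim 𝕜 / 2 * Real.log (1 + a)
      = (familyEntropy (smoothedDensity Pout Q) (volume.restrict (Set.Icc (-C) C))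
          (Q - Q / (1 + a))).toReal + betaDim 𝕜 * a / 2 := by
  have hβ := betaDim_pos 𝕜
  have h1 := congrArg ENNReal.toReal (familyEntropy_tiltedDensity h hφ hC hQ ha)
  rw [ENNReal.toReal_add (familyEntropy_tiltedDensity_ne_top h hφ hC hQ h0 ha)
      ENNReal.ofReal_ne_top,
    ENNReal.toReal_add (familyEntropy_smoothedDensity_ne_top h hφ hC hQ h0 ha)
      ENNReal.ofReal_ne_top, ENNReal.toReal_ofReal, ENNReal.toReal_ofReal] at h1
  · exact h1
  · positivity
  · exact mul_nonneg (by positivity) (Real.log_nonneg (by linarith))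

/-- Either the channel entropy is infinite everywhere, or it is a real potential, convex and
nondecreasing in the overlap, with a one-sided curvature bound in the inverse variance. -/
theorem exists_channel_potential (h : IsChannelDensity φ PA Pout) (hφ : ChannelRegular φ)
    {α : ℝ} (hα : 0 < α) (hQ : 0 < Q) :
    (∀ s ∈ Set.Icc 0 Q, channelEntropy Pout s (Q - s) = ⊤) ∨
    ∃ ψ : ℝ → ℝ,
      (∀ u, 0 < u → u ≤ Q →
        (α : EReal) * channelEntropy Pout (Q - u) u = ((betaDim 𝕜 / 2 * ψ u : ℝ) : EReal)) ∧
      (∀ u, 0 < u → u ≤ Q →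
        ((betaDim 𝕜 / 2 * ψ u : ℝ) : EReal) ≤ (α : EReal) * channelEntropy Pout Q 0) ∧
      (∀ u, 0 < u → u ≤ Q → ∃ c : ℝ, 0 ≤ c ∧ ∀ u', 0 < u' → u' ≤ Q →
        ψ u - c * (u' - u) ≤ ψ u') ∧
      (∀ u, 0 < u → u ≤ Q → ∃ t : ℝ, 0 ≤ t ∧ t ≤ u ∧ ∀ u', 0 < u' → u' ≤ Q →
        ψ u + α * Real.log u - α * t * (1 / u' - 1 / u) ≤ ψ u' + α * Real.log u') := by
  have hβ := betaDim_pos 𝕜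
  obtain ⟨C, hC⟩ := hφ.bounded
  set L := (volume (Set.Icc (-C) C)).toReal with hL
  set ς : Measure ℝ := volume.restrict (Set.Icc (-C) C) with hς
  set E1 := familyEntropy (smoothedDensity Pout Q) ς with hE1
  have hM := isGaussianMartingale_smoothedDensity h hφ hC Q
  rw [← hς] at hM
  have hmono : ∀ s t, 0 ≤ s → s ≤ t → t ≤ Q → E1 s ≤ E1 t := by
    intro s t hs hst ht
    have := hM.familyEntropy_mono hs (sub_nonneg.mpr hst) (by
      rw [add_sub_cancel]; exact ⟨hs.trans hst, ht⟩)
    rwa [add_sub_cancel] at this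
  -- The entropy is nondecreasing in the overlap, so an infinite value at zero is infinite
  -- everywhere.
  by_cases h0 : E1 0 = ∞
  · left
    intro s hs
    rw [channelEntropy_eq h hφ hC]
    have : E1 s = ∞ := top_le_iff.mp (h0 ▸ hmono 0 s le_rfl hs.1 hs.2)
    have h2 : familyEntropy (smoothedDensity Pout Q) (volume.restrict (Set.Icc (-C) C)) s
        = ∞ := this
    rw [h2]
    exact EReal.top_add_coe _
  right
  set F := familyEntropy (tiltedDensity Pout Q) ς with hF
  have hFfin : ∀ a, 0 ≤ a → F a ≠ ∞ := fun a ha =>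
    familyEntropy_tiltedDensity_ne_top h hφ hC hQ.le h0 ha
  have hdiv : ∀ u, 0 < u → Q - Q / (1 + (Q / u - 1)) = Q - u := fun u hu => by
    rw [add_sub_cancel, div_div_cancel₀ hQ.ne']
  have hane : ∀ u, 0 < u → u ≤ Q → 0 ≤ Q / u - 1 := fun u hu huQ => by
    rw [sub_nonneg, one_le_div hu]; exact huQ
  have hfin : ∀ u, 0 < u → u ≤ Q → E1 (Q - u) ≠ ∞ := by
    intro u hu huQ
    have := familyEntropy_smoothedDensity_ne_top h hφ hC hQ.le h0 (hane u hu huQ)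
    rwa [hdiv u hu] at this
  have hrel : ∀ a, 0 ≤ a → (F a).toReal + betaDim 𝕜 / 2 * Real.log (1 + a)
      = (E1 (Q - Q / (1 + a))).toReal + betaDim 𝕜 * a / 2 := fun a ha =>
    toReal_familyEntropy_tiltedDensity h hφ hC hQ.le h0 ha
  set ψ : ℝ → ℝ := fun u => 2 * α / betaDim 𝕜 * ((E1 (Q - u)).toReal + (1 - L)) with hψ
  have hval : ∀ u, 0 < u → u ≤ Q →
      (α : EReal) * channelEntropy Pout (Q - u) u = ((betaDim 𝕜 / 2 * ψ u : ℝ) : EReal) := by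
    intro u hu huQ
    have h1 := channelEntropy_eq h hφ hC Q (Q - u)
    rw [sub_sub_cancel] at h1
    rw [h1]
    have h2 : familyEntropy (smoothedDensity Pout Q) (volume.restrict (Set.Icc (-C) C)) (Q - u)
      = E1 (Q - u) := rfl
    rw [h2, ← EReal.coe_ennreal_toReal (hfin u hu huQ), ← EReal.coe_add, ← EReal.coe_mul]
    congr 1
    simp only [hψ, hL]
    field_simp
  refine ⟨ψ, hval, fun u hu huQ => ?_, fun u hu huQ => ?_, fun u hu huQ => ?_⟩
  · rw [← hval u hu huQ]
    refine mul_le_mul_of_nonneg_left ?_ (by exact_mod_cast hα.le)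
    have h1 := channelEntropy_eq h hφ hC Q (Q - u)
    have h2 := channelEntropy_eq h hφ hC Q Q
    rw [sub_sub_cancel] at h1
    rw [sub_self] at h2
    rw [h1, h2]
    refine add_le_add_left ?_ _
    exact_mod_cast hmono (Q - u) Q (by linarith) (by linarith) le_rfl
  -- The endpoint `s = Q`, of zero residual variance, is excluded because the entropy may be
  -- infinite there.
  · have hM' := hM.restrict (J := Set.Ico 0 Q) Set.Ico_subset_Icc_self
      fun t ht s h0 hst => ⟨h0, hst.trans_lt ht.2⟩
    obtain ⟨hm, hc⟩ := hM'.convexOn (convex_Ico 0 Q) fun t ht => by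
      have := hfin (Q - t) (by linarith [ht.2]) (by linarith [ht.1])
      rwa [sub_sub_cancel] at this
    obtain ⟨c, hc0, hsub⟩ := exists_nonneg_subgradient hc hm (x := Q - u)
      ⟨by linarith, by linarith⟩
    refine ⟨2 * α / betaDim 𝕜 * c, by positivity, fun u' hu' hu'Q => ?_⟩
    have h1 := hsub (Q - u') ⟨by linarith, by linarith⟩
    have h2 := mul_le_mul_of_nonneg_left h1 (show 0 ≤ 2 * α / betaDim 𝕜 by positivity)
    simp only [hψ]
    linear_combination h2
  · have hMF := isGaussianMartingale_tiltedDensity h hφ hC Q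
    obtain ⟨hm, hc⟩ := hMF.convexOn (convex_Ici 0) fun t ht => hFfin t ht
    have hb : ∀ a, 0 ≤ a → (F a).toReal
        ≤ betaDim 𝕜 / 2 * a + (betaDim 𝕜 / 2 + ((F 0).toReal + 1) + L) := by
      intro a ha
      have h1 := familyEntropy_tiltedDensity_le h hφ hC hQ.le ha
      have h01 : familyEntropy (tiltedDensity Pout Q) (volume.restrict (Set.Icc (-C) C)) 0 + 1
          ≠ ∞ := ENNReal.add_ne_top.mpr ⟨hFfin 0 le_rfl, ENNReal.one_ne_top⟩
      have h2 := ENNReal.toReal_mono (ENNReal.add_ne_top.mpr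
        ⟨ENNReal.add_ne_top.mpr ⟨ENNReal.ofReal_ne_top, h01⟩, measure_Icc_lt_top.ne⟩) h1
      rw [ENNReal.toReal_add (ENNReal.add_ne_top.mpr ⟨ENNReal.ofReal_ne_top, h01⟩)
          measure_Icc_lt_top.ne, ENNReal.toReal_add ENNReal.ofReal_ne_top h01,
        ENNReal.toReal_add (hFfin 0 le_rfl) ENNReal.one_ne_top,
        ENNReal.toReal_ofReal (by positivity), ENNReal.toReal_one] at h2
      have h3 : (F a).toReal ≤ betaDim 𝕜 / 2 * (1 + a) + ((F 0).toReal + 1) + L := h2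
      linarith
    have hl : ∀ a b, 0 ≤ a → a ≤ b →
        betaDim 𝕜 / 2 * ((b - a) - Real.log ((1 + b) / (1 + a)))
          ≤ (F b).toReal - (F a).toReal := by
      intro a b ha hab
      have h1 := hrel a ha
      have h2 := hrel b (ha.trans hab)
      have h3 : (E1 (Q - Q / (1 + a))).toReal ≤ (E1 (Q - Q / (1 + b))).toReal := by
        refine ENNReal.toReal_mono
          (familyEntropy_smoothedDensity_ne_top h hφ hC hQ.le h0 (ha.trans hab)) ?_
        refine hmono _ _ ?_ ?_ ?_
        · rw [sub_nonneg]
          exact div_le_self hQ.le (by linarith)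
        · gcongr
        · have : 0 ≤ Q / (1 + b) := div_nonneg hQ.le (by linarith)
          linarith
      rw [Real.log_div (by linarith) (by linarith)]
      linarith
    obtain ⟨g, hg1, hg2, hg⟩ := exists_slope_bounds (by positivity) hm hc hb hl (hane u hu huQ)
    -- With `a = Q/v - 1` one has `ln v = ln Q - ln(1 + a)`. The chain rule then turns `ψ + α ln v`
    -- into a multiple of the tilted entropy `F a` minus an affine function of `a`, that is of
    -- `1/v`.
    have hlog : ∀ v, 0 < v → v ≤ Q → ψ v + α * Real.log v
        = 2 * α / betaDim 𝕜 * (F (Q / v - 1)).toReal - α * (Q / v - 1)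
          + (α * Real.log Q + 2 * α / betaDim 𝕜 * (1 - L)) := by
      intro v hv hvQ
      have h1 := hrel (Q / v - 1) (hane v hv hvQ)
      rw [hdiv v hv, add_sub_cancel, Real.log_div hQ.ne' hv.ne'] at h1
      have h2 : (E1 (Q - v)).toReal = (F (Q / v - 1)).toReal
          + betaDim 𝕜 / 2 * (Real.log Q - Real.log v) - betaDim 𝕜 * (Q / v - 1) / 2 := by linarith
      simp only [hψ]
      rw [h2]
      field_simp
      ring
    -- Read off from the slope `2αg/β - α` in `a`: `g ≤ β/2` gives nonnegativity, and `g ≥ (β/2)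
    -- a/(1 + a)` gives the bound by `u = Q/(1 + a)`.
    refine ⟨Q * (1 - 2 / betaDim 𝕜 * g), ?_, ?_, fun u' hu' hu'Q => ?_⟩
    · have h1 : 2 / betaDim 𝕜 * g ≤ 2 / betaDim 𝕜 * (betaDim 𝕜 / 2) := by gcongr
      have h2 : 2 / betaDim 𝕜 * (betaDim 𝕜 / 2) = 1 := by field_simp
      exact mul_nonneg hQ.le (by linarith)
    · have h1 : 2 / betaDim 𝕜 * (betaDim 𝕜 / 2 * ((Q / u - 1) / (1 + (Q / u - 1))))
          ≤ 2 / betaDim 𝕜 * g := by gcongr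
      have h2 : 2 / betaDim 𝕜 * (betaDim 𝕜 / 2 * ((Q / u - 1) / (1 + (Q / u - 1))))
          = 1 - u / Q := by rw [add_sub_cancel]; field_simp
      have h3 : Q * (1 - 2 / betaDim 𝕜 * g) ≤ Q * (u / Q) := by
        gcongr
        linarith
      have h4 : Q * (u / Q) = u := by field_simp
      linarith
    · rw [hlog u hu huQ, hlog u' hu' hu'Q]
      have h1 := mul_le_mul_of_nonneg_left (hg (Q / u' - 1) (hane u' hu' hu'Q))
        (show 0 ≤ 2 * α / betaDim 𝕜 by positivity)
      have h2 : (Q / u' - 1) - (Q / u - 1) = Q * (1 / u' - 1 / u) := by ring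
      have h3 : α * (Q * (1 - 2 / betaDim 𝕜 * g)) * (1 / u' - 1 / u)
          = α * ((Q / u' - 1) - (Q / u - 1))
            - 2 * α / betaDim 𝕜 * (g * ((Q / u' - 1) - (Q / u - 1))) := by rw [h2]; ring
      rw [h3]
      linarith

end Channel

theorem eintegral_eq_integral {X : Type*} [MeasurableSpace X] {μ : Measure X} {f : X → ℝ}
    (hf : Integrable f μ) : eintegral μ f = ((∫ x, f x ∂μ : ℝ) : EReal) := by
  have hneg : ∫⁻ x, ENNReal.ofReal (-f x) ∂μ ≠ ∞ := hf.neg.lintegral_lt_top.ne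
  rw [eintegral, integral_eq_lintegral_pos_part_sub_lintegral_neg_part hf, EReal.coe_sub,
    EReal.coe_ennreal_toReal hf.lintegral_lt_top.ne, EReal.coe_ennreal_toReal hneg]

theorem elog_of_pos {x : ℝ} (hx : 0 < x) : elog x = ((Real.log x : ℝ) : EReal) :=
  ENNReal.log_ofReal_of_pos hx

/-! ### The Gaussian prior term -/

section Prior

variable {𝕜 : Type*} [RCLike 𝕜]

/-- `Z_0` is the evidence `priorDensity`. Using it as a change of measure reduces `E Z ln Z` to the
second moment of `ξ`. -/
theorem priorEntropy_betaGaussian {q : ℝ} (hq : 0 ≤ q) :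
    priorEntropy (betaGaussian 𝕜) q
      = ((betaDim 𝕜 / 2 * (q - Real.log (1 + q)) : ℝ) : EReal) := by
  have hβ := betaDim_pos 𝕜
  have h1 : (0 : ℝ) < 1 + q := by linarith
  have hZ : ∀ ξ : 𝕜, Zprior (betaGaussian 𝕜) (((√q : ℝ) : 𝕜) * ξ) q = priorDensity 𝕜 q ξ := by
    intro ξ
    rw [Zprior_betaGaussian _ (by linarith), priorDensity, norm_coe_mul, Real.sq_sqrt hq]
    congr 3
    ring
  set ℓ : 𝕜 → ℝ := fun ξ => Real.log (priorDensity 𝕜 q (((√(1 + q) : ℝ) : 𝕜) * ξ)) with hℓ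
  have hℓ' : ∀ ξ, ℓ ξ = -(betaDim 𝕜 / 2 * Real.log (1 + q)) + betaDim 𝕜 * q / 2 * ‖ξ‖ ^ 2 := by
    intro ξ
    simp only [hℓ]
    rw [log_priorDensity hq, norm_coe_mul, Real.sq_sqrt h1.le]
    field_simp
  have hm : Measurable fun ξ : 𝕜 => Real.log (priorDensity 𝕜 q ξ) :=
    (measurable_priorDensity q).log
  have e1 : eintegral (betaGaussian 𝕜)
      (fun ξ => priorDensity 𝕜 q ξ * Real.log (priorDensity 𝕜 q ξ))
      = eintegral (betaGaussian 𝕜) ℓ := by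
    have hm1 := hm.ennreal_ofReal
    have hm2 : Measurable fun ξ : 𝕜 => ENNReal.ofReal (-Real.log (priorDensity 𝕜 q ξ)) := by
      have := hm.neg.ennreal_ofReal
      exact this
    have h2 := lintegral_priorDensity (𝕜 := 𝕜) hq hm1
    have h3 := lintegral_priorDensity (𝕜 := 𝕜) hq hm2
    simp only [← ENNReal.ofReal_mul (priorDensity_pos (𝕜 := 𝕜) hq _).le, mul_neg] at h2 h3
    rw [eintegral, eintegral, h2, h3]
  have hint : Integrable ℓ (betaGaussian 𝕜) := by
    have h2 : Integrable (fun ξ : 𝕜 => -(betaDim 𝕜 / 2 * Real.log (1 + q))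
        + betaDim 𝕜 * q / 2 * ‖ξ‖ ^ 2) (betaGaussian 𝕜) :=
      (integrable_const _).add (integrable_norm_sq_betaGaussian.const_mul _)
    exact h2.congr (ae_of_all _ fun ξ => (hℓ' ξ).symm)
  rw [priorEntropy]
  simp only [hZ]
  rw [e1, eintegral_eq_integral hint]
  congr 1
  simp only [hℓ']
  rw [integral_add (integrable_const _) (integrable_norm_sq_betaGaussian.const_mul _),
    integral_const_mul]
  have h4 : ∫ z : 𝕜, ‖z‖ ^ 2 ∂(betaGaussian 𝕜) = 1 := secondMoment_betaGaussian
  rw [h4]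
  simp
  ring

/-- Evaluated at the stationary `q̂ = q/(1 - q)`. The value is exactly what cancels the `q_x` terms
of `I_int`. -/
theorem I0_betaGaussian_le {q : ℝ} (hq : 0 ≤ q) (hq1 : q < 1) :
    I0 (betaGaussian 𝕜) q ≤ ((betaDim 𝕜 / 2 * (q + Real.log (1 - q)) : ℝ) : EReal) := by
  have h1 : 0 < 1 - q := by linarith
  have h2 : 0 ≤ q / (1 - q) := by positivity
  refine (iInf₂_le (q / (1 - q)) h2).trans (le_of_eq ?_)
  rw [priorEntropy_betaGaussian h2, ← EReal.coe_add]
  congr 1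
  have h3 : 1 + q / (1 - q) = (1 - q)⁻¹ := by field_simp; ring
  rw [h3, Real.log_inv]
  field_simp
  ring

theorem I0_betaGaussian_zero_nonneg : 0 ≤ I0 (betaGaussian 𝕜) 0 := by
  have hβ := betaDim_pos 𝕜
  refine le_iInf₂ fun q hq => ?_
  have hq0 : (0 : ℝ) ≤ q := hq
  rw [priorEntropy_betaGaussian hq0, ← EReal.coe_add, ← EReal.coe_zero, EReal.coe_le_coe_iff]
  have h1 := Real.log_le_sub_one_of_pos (x := 1 + q) (by linarith)
  have h2 : 0 ≤ betaDim 𝕜 / 2 * (q - Real.log (1 + q)) :=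
    mul_nonneg (by positivity) (by linarith)
  linarith

end Prior

/-! ### The channel and interaction terms -/

section Interaction

variable {𝕜 : Type*} [RCLike 𝕜] {Pout : ℝ → 𝕜 → ℝ} {Q t u : ℝ}

/-- The change of variable `u = 1/(Q̂_z + q̂_z)`, the conditional variance, maps `q̂_z ∈ [0, ∞)`
onto `u ∈ (0, Q]`. -/
theorem Iout_term_eq (hQ : 0 < Q) (hu : 0 < u) :
    ((-(betaDim 𝕜 * (1 / u - 1 / Q) * (Q - t) / 2)
        - betaDim 𝕜 / 2 * Real.log (1 / Q + (1 / u - 1 / Q))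
        + betaDim 𝕜 * (1 / u - 1 / Q) / (2 * (1 / Q)) : ℝ) : EReal)
      + channelEntropy Pout ((1 / u - 1 / Q) / ((1 / Q) * (1 / Q + (1 / u - 1 / Q))))
        (1 / (1 / Q + (1 / u - 1 / Q)))
      = ((betaDim 𝕜 / 2 * ((1 / u - 1 / Q) * t + Real.log u) : ℝ) : EReal)
        + channelEntropy Pout (Q - u) u := by
  have h1 : 1 / Q + (1 / u - 1 / Q) = 1 / u := by ring
  have h2 : (1 / u - 1 / Q) / ((1 / Q) * (1 / u)) = Q - u := by field_simp
  rw [h1, h2, one_div_one_div]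
  congr 2
  rw [one_div u, Real.log_inv]
  field_simp
  ring

theorem Iout_le (hQ : 0 < Q) (hu : 0 < u) (huQ : u ≤ Q) :
    Iout Pout Q (Q - t) ≤ ((betaDim 𝕜 / 2 * ((1 / u - 1 / Q) * t + Real.log u) : ℝ) : EReal)
      + channelEntropy Pout (Q - u) u := by
  have h : 1 / Q ≤ 1 / u := one_div_le_one_div_of_le hu huQ
  exact (iInf₂_le (1 / u - 1 / Q) (Set.mem_Ici.mpr (sub_nonneg.mpr h))).trans
    (Iout_term_eq hQ hu).le

theorem le_Iout (hQ : 0 < Q) {c : EReal} (h : ∀ u, 0 < u → u ≤ Q →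
      c ≤ ((betaDim 𝕜 / 2 * ((1 / u - 1 / Q) * t + Real.log u) : ℝ) : EReal)
        + channelEntropy Pout (Q - u) u) : c ≤ Iout Pout Q (Q - t) := by
  refine le_iInf₂ fun q hq => ?_
  have hq0 : (0 : ℝ) ≤ q := hq
  have hs : 0 < 1 / Q + q := by positivity
  set u := 1 / (1 / Q + q) with hu
  have hu0 : 0 < u := by positivity
  have hq' : q = 1 / u - 1 / Q := by rw [hu, one_div_one_div]; ring
  have huQ : u ≤ Q := by
    rw [hu, div_le_iff₀ hs]
    have : Q * (1 / Q + q) = 1 + Q * q := by field_simp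
    nlinarith [mul_nonneg hQ.le hq0]
  refine (h u hu0 huQ).trans (le_of_eq ?_)
  rw [← Iout_term_eq hQ hu0, ← hq']

variable {ν : Measure ℝ} [IsProbabilityMeasure ν] {α R qx qz : ℝ}

theorem Iint_eq_bot_of_fst : Iint 𝕜 1 α Q ν 1 qz = ⊥ := by
  have hβ := betaDim_pos 𝕜
  have h : (⨅ γx ∈ Set.Ici (0 : ℝ), ⨅ γz ∈ Set.Ici (0 : ℝ),
      ((betaDim 𝕜 / 2 * (1 - 1) * γx + α * betaDim 𝕜 / 2 * (Q - qz) * γz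
          - betaDim 𝕜 / 2 * ∫ l, Real.log ((1 : ℝ)⁻¹ + γx + l * γz) ∂ν : ℝ) : EReal)) = ⊥ := by
    rw [EReal.eq_bot_iff_forall_lt]
    intro y
    have hx : 0 ≤ Real.exp (2 / betaDim 𝕜 * (|y| + 1)) := (Real.exp_pos _).le
    refine lt_of_le_of_lt ((iInf₂_le _ (Set.mem_Ici.mpr hx)).trans
      (iInf₂_le 0 (Set.mem_Ici.mpr le_rfl))) ?_
    rw [EReal.coe_lt_coe_iff]
    simp only [sub_self, mul_zero, zero_mul, add_zero, inv_one, zero_sub, integral_const,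
      probReal_univ, one_smul]
    have h1 : 2 / betaDim 𝕜 * (|y| + 1)
        ≤ Real.log (1 + Real.exp (2 / betaDim 𝕜 * (|y| + 1))) := by
      rw [Real.le_log_iff_exp_le (by positivity)]
      linarith
    have h2 := mul_le_mul_of_nonneg_left h1 (show 0 ≤ betaDim 𝕜 / 2 by positivity)
    have h3 : betaDim 𝕜 / 2 * (2 / betaDim 𝕜 * (|y| + 1)) = |y| + 1 := by field_simp
    have h4 := neg_abs_le y
    linarith
  rw [Iint, h]
  simp

/-- By concavity the logarithm lies above its chord on `[0, R]`. The resulting divergence in `γ`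
makes the infimum `-∞` on the edge `q_z = Q`. -/
theorem le_integral_log_one_add_mul (h0 : ∀ᵐ x ∂ν, 0 ≤ x) (hR : ∀ᵐ x ∂ν, x ≤ R) (hR0 : 0 < R)
    {γ : ℝ} (hγ : 0 ≤ γ) :
    (∫ l, l ∂ν) / R * Real.log (1 + γ * R) ≤ ∫ l, Real.log (1 + γ * l) ∂ν := by
  have hi : Integrable (fun l : ℝ => l) ν := integrable_of_continuousOn h0 hR continuousOn_id
  have hi2 := integrable_of_continuousOn h0 hR (continuousOn_log_one_add_mul hγ)
  have e : (∫ l, l ∂ν) / R * Real.log (1 + γ * R) = ∫ l, l * (Real.log (1 + γ * R) / R) ∂ν := by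
    rw [integral_mul_const]; ring
  rw [e]
  refine integral_mono_ae (hi.mul_const _) hi2 ?_
  filter_upwards [h0, hR] with l hl hlR
  have h1 : 0 < 1 + γ * R := by positivity
  have h2 := rpow_one_add_le_one_add_mul_self (s := γ * R) (by nlinarith [mul_nonneg hγ hR0.le])
    (p := l / R) (by positivity) (by rw [div_le_one hR0]; exact hlR)
  have h3 : l / R * (γ * R) = γ * l := by field_simp
  rw [h3] at h2
  have h4 := Real.log_le_log (by positivity) h2
  rw [Real.log_rpow h1] at h4
  calc l * (Real.log (1 + γ * R) / R) = l / R * Real.log (1 + γ * R) := by ring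
    _ ≤ _ := h4

theorem Iint_eq_bot_of_snd (h0 : ∀ᵐ x ∂ν, 0 ≤ x) (hR : ∀ᵐ x ∂ν, x ≤ R) (hR0 : 0 < R)
    (hν : 0 < ∫ l, l ∂ν) : Iint 𝕜 1 α Q ν qx Q = ⊥ := by
  have hβ := betaDim_pos 𝕜
  have h : (⨅ γx ∈ Set.Ici (0 : ℝ), ⨅ γz ∈ Set.Ici (0 : ℝ),
      ((betaDim 𝕜 / 2 * (1 - qx) * γx + α * betaDim 𝕜 / 2 * (Q - Q) * γz
          - betaDim 𝕜 / 2 * ∫ l, Real.log ((1 : ℝ)⁻¹ + γx + l * γz) ∂ν : ℝ) : EReal)) = ⊥ := by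
    rw [EReal.eq_bot_iff_forall_lt]
    intro y
    set c := betaDim 𝕜 / 2 * ((∫ l, l ∂ν) / R) with hc
    have hc0 : 0 < c := by positivity
    set γ := Real.exp ((|y| + 1) / c) / R with hγ
    have hγ0 : 0 ≤ γ := by positivity
    refine lt_of_le_of_lt ((iInf₂_le 0 (Set.mem_Ici.mpr le_rfl)).trans
      (iInf₂_le γ (Set.mem_Ici.mpr hγ0))) ?_
    rw [EReal.coe_lt_coe_iff]
    simp only [sub_self, mul_zero, zero_mul, add_zero, inv_one, zero_sub]
    have h1 : (|y| + 1) / c ≤ Real.log (1 + γ * R) := by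
      rw [Real.le_log_iff_exp_le (by positivity), hγ, div_mul_cancel₀ _ hR0.ne']
      linarith
    have h2 := mul_le_mul_of_nonneg_left h1 hc0.le
    have h3 : c * ((|y| + 1) / c) = |y| + 1 := by field_simp
    have h4 := neg_abs_le y
    have h5 := mul_le_mul_of_nonneg_left (le_integral_log_one_add_mul h0 hR hR0 hγ0)
      (show 0 ≤ betaDim 𝕜 / 2 by positivity)
    have h6 : betaDim 𝕜 / 2 * ((∫ l, l ∂ν) / R * Real.log (1 + γ * R))
        = c * Real.log (1 + γ * R) := by rw [hc]; ring
    simp only [mul_comm _ γ]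
    linarith
  rw [Iint, h]
  simp

theorem Iint_eq {ν : Measure ℝ} (ht : 0 < t) (hqx : qx < 1) :
    Iint 𝕜 1 α Q ν qx (Q - t) = (⨅ γx ∈ Set.Ici (0 : ℝ), ⨅ γz ∈ Set.Ici (0 : ℝ),
      ((betaDim 𝕜 / 2 * ((1 - qx) * γx + α * t * γz
          - ∫ l, Real.log (1 + γx + γz * l) ∂ν) : ℝ) : EReal))
      + ((betaDim 𝕜 / 2 * (-Real.log (1 - qx) - qx
          - α * Real.log t - α * (Q - t) / Q) : ℝ) : EReal) := by
  rw [Iint, elog_of_pos (by linarith), sub_sub_cancel, elog_of_pos ht]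
  simp only [← EReal.coe_mul, sub_eq_add_neg, ← EReal.coe_neg, add_assoc, ← EReal.coe_add]
  congr 1
  · refine iInf_congr fun γx => iInf_congr fun _ => iInf_congr fun γz => iInf_congr fun _ => ?_
    congr 1
    simp only [inv_one, mul_comm _ γz]
    ring
  · congr 1
    ring

theorem Iint_le {ν : Measure ℝ} (ht : 0 < t) (hqx : qx < 1) {γ : ℝ} (hγ : 0 ≤ γ) :
    Iint 𝕜 1 α Q ν qx (Q - t) ≤ ((betaDim 𝕜 / 2 * (α * t * γ - ∫ l, Real.log (1 + γ * l) ∂ν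
      - Real.log (1 - qx) - qx - α * Real.log t - α * (Q - t) / Q) : ℝ) : EReal) := by
  rw [Iint_eq ht hqx]
  refine (add_le_add_left ((iInf₂_le 0 (Set.mem_Ici.mpr le_rfl)).trans
    (iInf₂_le γ (Set.mem_Ici.mpr hγ))) _).trans (le_of_eq ?_)
  rw [← EReal.coe_add]
  congr 1
  simp only [mul_zero, zero_add, add_zero]
  ring

/-- At `q_x = 0` the linear term in `γ_x` has coefficient one, and `ln(1 + γ_x + γ_z λ) ≤ ln(1 + γ_z
λ) + γ_x`, so `γ_x = 0` is optimal. -/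
theorem le_Iint_zero (h0 : ∀ᵐ x ∂ν, 0 ≤ x) (hR : ∀ᵐ x ∂ν, x ≤ R) (ht : 0 < t) {j : ℝ}
    (hj : ∀ γ, 0 ≤ γ → j ≤ α * t * γ - ∫ l, Real.log (1 + γ * l) ∂ν) :
    ((betaDim 𝕜 / 2 * (j - α * Real.log t - α * (Q - t) / Q) : ℝ) : EReal)
      ≤ Iint 𝕜 1 α Q ν 0 (Q - t) := by
  have hβ := betaDim_pos 𝕜
  rw [Iint_eq ht zero_lt_one]
  have key : ((betaDim 𝕜 / 2 * j : ℝ) : EReal) ≤ ⨅ γx ∈ Set.Ici (0 : ℝ), ⨅ γz ∈ Set.Ici (0 : ℝ),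
      ((betaDim 𝕜 / 2 * ((1 - 0) * γx + α * t * γz
          - ∫ l, Real.log (1 + γx + γz * l) ∂ν) : ℝ) : EReal) := by
    refine le_iInf₂ fun γx hx => le_iInf₂ fun γz hz => ?_
    have hx0 : (0 : ℝ) ≤ γx := hx
    have hz0 : (0 : ℝ) ≤ γz := hz
    rw [EReal.coe_le_coe_iff]
    refine mul_le_mul_of_nonneg_left ?_ (by positivity)
    have h1 := hj γz hz0
    have hi1 : Integrable (fun l => Real.log (1 + γx + γz * l)) ν := by
      refine integrable_of_continuousOn h0 hR (ContinuousOn.log (by fun_prop) fun x hx => ?_)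
      have := mul_nonneg hz0 (Set.mem_Ici.mp hx)
      linarith
    have hi2 := integrable_of_continuousOn h0 hR (continuousOn_log_one_add_mul hz0)
    have h2 : ∫ l, Real.log (1 + γx + γz * l) ∂ν ≤ ∫ l, (Real.log (1 + γz * l) + γx) ∂ν := by
      refine integral_mono_ae hi1 (hi2.add (integrable_const _)) ?_
      filter_upwards [h0] with l hl
      have hp : 0 < 1 + γz * l := by positivity
      have h3 : 1 + γx + γz * l ≤ (1 + γz * l) * Real.exp γx := by
        have := Real.add_one_le_exp γx
        nlinarith [mul_nonneg hz0 hl]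
      have h4 := Real.log_le_log (by positivity) h3
      rwa [Real.log_mul hp.ne' (Real.exp_pos _).ne', Real.log_exp] at h4
    rw [integral_add hi2 (integrable_const _)] at h2
    simp only [integral_const, probReal_univ, one_smul] at h2
    linarith
  refine le_trans (le_of_eq ?_) (add_le_add_left key _)
  rw [← EReal.coe_add]
  congr 1
  simp
  ring

end Interaction

/-! ### Reduction of the replica formula -/

section Formula

variable {𝕜 : Type*} [RCLike 𝕜] {Pout : ℝ → 𝕜 → ℝ} {Q α δ R : ℝ} {μ ν : Measure ℝ}
  [IsProbabilityMeasure μ] [IsProbabilityMeasure ν] {ψ : ℝ → ℝ}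

theorem channelEntropy_eq_of_potential (hα : 0 < α)
    (hψ : ∀ u, 0 < u → u ≤ Q →
      (α : EReal) * channelEntropy Pout (Q - u) u = ((betaDim 𝕜 / 2 * ψ u : ℝ) : EReal))
    {u : ℝ} (hu : 0 < u) (huQ : u ≤ Q) :
    channelEntropy Pout (Q - u) u = ((betaDim 𝕜 / 2 * ψ u / α : ℝ) : EReal) := by
  have h := hψ u hu huQ
  have h1 : ((α⁻¹ : ℝ) : EReal) * ((α : EReal) * channelEntropy Pout (Q - u) u)
      = channelEntropy Pout (Q - u) u := by
    rw [← mul_assoc, ← EReal.coe_mul, inv_mul_cancel₀ hα.ne', EReal.coe_one, one_mul]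
  rw [← h1, h, ← EReal.coe_mul]
  congr 1
  ring

/-- Every admissible pair of overlaps with `q_x < 1` and `q_z = Q - t` is dominated by the reduced
functional. -/
theorem replicaTerm_le {ν : Measure ℝ} (hα : 0 < α) (hQ : 0 < Q)
    (hψ : ∀ u, 0 < u → u ≤ Q →
      (α : EReal) * channelEntropy Pout (Q - u) u = ((betaDim 𝕜 / 2 * ψ u : ℝ) : EReal))
    {qx t u γ : ℝ} (hqx : 0 ≤ qx) (hqx1 : qx < 1) (ht : 0 < t) (hu : 0 < u) (huQ : u ≤ Q)
    (hγ : 0 ≤ γ) :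
    I0 (betaGaussian 𝕜) qx + (α : EReal) * Iout Pout Q (Q - t) + Iint 𝕜 1 α Q ν qx (Q - t)
      ≤ ((betaDim 𝕜 / 2 * (α * logGap (t / u) + ψ u
          + (α * t * γ - ∫ l, Real.log (1 + γ * l) ∂ν)) : ℝ) : EReal) := by
  have h1 := Iout_le (Pout := Pout) (t := t) hQ hu huQ
  rw [channelEntropy_eq_of_potential hα hψ hu huQ, ← EReal.coe_add] at h1
  have h2 := mul_le_mul_of_nonneg_left h1 (show (0 : EReal) ≤ (α : EReal) by exact_mod_cast hα.le)
  rw [← EReal.coe_mul] at h2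
  refine (add_le_add (add_le_add (I0_betaGaussian_le hqx hqx1) h2)
    (Iint_le ht hqx1 hγ)).trans (le_of_eq ?_)
  rw [← EReal.coe_add, ← EReal.coe_add]
  congr 1
  rw [logGap, Real.log_div ht.ne' hu.ne']
  field_simp
  ring

theorem le_replicaTerm (hα : 0 < α) (hQ : 0 < Q) (hν0 : ∀ᵐ x ∂ν, 0 ≤ x)
    (hνR : ∀ᵐ x ∂ν, x ≤ R)
    (hψ : ∀ u, 0 < u → u ≤ Q →
      (α : EReal) * channelEntropy Pout (Q - u) u = ((betaDim 𝕜 / 2 * ψ u : ℝ) : EReal))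
    {t a j : ℝ} (ht : 0 < t) (ha : ∀ u, 0 < u → u ≤ Q → a ≤ α * logGap (t / u) + ψ u)
    (hj : ∀ γ, 0 ≤ γ → j ≤ α * t * γ - ∫ l, Real.log (1 + γ * l) ∂ν) :
    ((betaDim 𝕜 / 2 * (a + j) : ℝ) : EReal)
      ≤ I0 (betaGaussian 𝕜) 0 + (α : EReal) * Iout Pout Q (Q - t) + Iint 𝕜 1 α Q ν 0 (Q - t) := by
  have hβ := betaDim_pos 𝕜
  have h1 : ((betaDim 𝕜 / 2 * (a + α * Real.log t + α - α * t / Q) / α : ℝ) : EReal)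
      ≤ Iout Pout Q (Q - t) := by
    refine le_Iout hQ fun u hu huQ => ?_
    rw [channelEntropy_eq_of_potential hα hψ hu huQ, ← EReal.coe_add, EReal.coe_le_coe_iff]
    have h2 := ha u hu huQ
    rw [logGap, Real.log_div ht.ne' hu.ne'] at h2
    have h3 : betaDim 𝕜 / 2 * ((1 / u - 1 / Q) * t + Real.log u) + betaDim 𝕜 / 2 * ψ u / α
        = betaDim 𝕜 / 2 * (α * ((1 / u - 1 / Q) * t + Real.log u) + ψ u) / α := by
      field_simp
    rw [h3]
    refine div_le_div_of_nonneg_right (mul_le_mul_of_nonneg_left ?_ (by positivity)) hα.le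
    have h4 : α * ((1 / u - 1 / Q) * t + Real.log u)
        = α * (t / u - 1 - (Real.log t - Real.log u)) + α * Real.log t + α - α * t / Q := by ring
    linarith
  have h2 := mul_le_mul_of_nonneg_left h1 (show (0 : EReal) ≤ (α : EReal) by exact_mod_cast hα.le)
  rw [← EReal.coe_mul] at h2
  refine le_trans (le_of_eq ?_) (add_le_add (add_le_add I0_betaGaussian_zero_nonneg h2)
    (le_Iint_zero hν0 hνR ht hj))
  rw [zero_add, ← EReal.coe_add]
  congr 1
  field_simp
  ring

/-- Handles the endpoint `q = Q`, where the potential has no real value, by letting the variance `u`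
tend to zero. -/
theorem coe_le_add_of_forall_sub_le {x : EReal} {v b c : ℝ}
    (h : ∀ u, 0 < u → u ≤ Q → ((v - c * u : ℝ) : EReal) ≤ (b : EReal) + x) (hQ : 0 < Q) :
    (v : EReal) ≤ (b : EReal) + x := by
  have h1 := h Q hQ le_rfl
  generalize (b : EReal) + x = y at h h1
  induction y with
  | bot => exact absurd (le_bot_iff.mp h1) (EReal.coe_ne_bot _)
  | top => exact le_top
  | coe y =>
    rw [EReal.coe_le_coe_iff]
    have hlim : Tendsto (fun u : ℝ => v - c * u) (𝓝[>] 0) (𝓝 (v - c * 0)) :=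
      (Continuous.tendsto (by fun_prop) 0).mono_left nhdsWithin_le_nhds
    rw [mul_zero, sub_zero] at hlim
    refine le_of_tendsto hlim ?_
    filter_upwards [Ioc_mem_nhdsGT hQ] with u hu
    exact_mod_cast h u hu.1 hu.2

/-- The reduction of the replica-symmetric formula to two scalar variables. -/
theorem replicaFormula_eq_supInfFormula {φ : 𝕜 → 𝕜 → ℝ} {PA : Measure 𝕜} [IsProbabilityMeasure PA]
    (h : IsChannelDensity φ PA Pout) (hφ : ChannelRegular φ) (hα : 0 < α) (hδ : 0 < δ)
    (hR : 0 < R) (hμ0 : ∀ᵐ x ∂μ, 0 ≤ x) (hμR : ∀ᵐ x ∂μ, x ≤ R) (hμ : μ ≠ Measure.dirac 0)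
    (hν0 : ∀ᵐ x ∂ν, 0 ≤ x) (hνR : ∀ᵐ x ∂ν, x ≤ R)
    (hU : ∀ γ k : ℝ, 0 < γ → 0 < k → ∫ l, Real.log (1 + γ * l) ∂ν
      ≤ ∫ x, Real.log (1 + k * x) ∂μ + α * logGap (k * δ / (α * γ)))
    (hL : ∀ γ k : ℝ, 0 < γ → 0 < k → k * ∫ x, x / (1 + k * x) ∂μ + k * δ / γ = α →
      ∫ x, Real.log (1 + k * x) ∂μ + α * logGap (k * δ / (α * γ))
        ≤ ∫ l, Real.log (1 + γ * l) ∂ν)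
    (hQν : replicaQz 1 α ν = productQz δ μ) :
    replicaFormula (betaGaussian 𝕜) Pout α ν = supInfFormula Pout α δ μ := by
  have hβ := betaDim_pos 𝕜
  have hμpos : 0 < ∫ x, x ∂μ := by
    have := integral_pos_of_ne_dirac hμ0 hμR hμ (le_refl (0 : ℝ))
    simpa using this
  rw [replicaFormula, supInfFormula, secondMoment_betaGaussian, hQν]
  set Q := productQz δ μ with hQdef
  have hQ : 0 < Q := div_pos hμpos hδ
  have hQ' : Q = (∫ x, x ∂μ) / δ := rfl
  have hEX : ∫ x, x ∂μ = δ * Q := by rw [hQdef, productQz]; field_simp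
  have hνpos : 0 < ∫ l, l ∂ν := by
    have h1 : 0 < replicaQz 1 α ν := by rw [hQν]; exact hQ
    rw [replicaQz, one_mul] at h1
    exact (div_pos_iff_of_pos_right hα).mp h1
  have hνQ : ∫ l, l ∂ν = α * Q := by
    rw [← hQν, replicaQz]; field_simp
  rcases exists_channel_potential h hφ hα hQ with htop | ⟨ψ, hψ, hψ0, hsub, hsup⟩
  · have hr : (⨆ qh ∈ Set.Ici (0 : ℝ), ⨅ q ∈ Set.Icc (0 : ℝ) Q,
        ((betaDim 𝕜 * qh / 2 * ((∫ x, x ∂μ) - δ * q)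
          - betaDim 𝕜 / 2 * ∫ x, Real.log (1 + qh * x) ∂μ : ℝ) : EReal)
        + (α : EReal) * PsiOut Pout Q q) = ⊤ := by
      refine top_le_iff.mp (le_trans ?_ (le_iSup₂_of_le 0 (Set.mem_Ici.mpr le_rfl) le_rfl))
      refine le_iInf₂ fun q hq => ?_
      rw [PsiOut, htop q hq, EReal.coe_mul_top_of_pos hα, EReal.coe_add_top]
    rw [hr]
    -- In the infinite case `q_x = q_z = 0` already gives `+∞`: the prior and interaction terms
    -- there are bounded below by real numbers.
    refine top_le_iff.mp (le_trans ?_ (le_iSup₂_of_le 0 (Set.left_mem_Icc.mpr zero_le_one)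
      (le_iSup₂_of_le 0 (Set.left_mem_Icc.mpr hQ.le) le_rfl)))
    have h1 : Iout Pout Q 0 = ⊤ := by
      rw [← sub_self Q]
      refine top_le_iff.mp (le_Iout hQ fun u hu huQ => ?_)
      have := htop (Q - u) ⟨by linarith, by linarith⟩
      rw [sub_sub_cancel] at this
      rw [this, EReal.coe_add_top]
    have h2 := le_Iint_zero (𝕜 := 𝕜) (α := α) (Q := Q) hν0 hνR hQ (j := 0) fun γ hγ => by
      have hi : Integrable (fun l : ℝ => l) ν :=
        integrable_of_continuousOn hν0 hνR continuousOn_id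
      have h3 : ∫ l, Real.log (1 + γ * l) ∂ν ≤ ∫ l, γ * l ∂ν := by
        refine integral_mono_ae
          (integrable_of_continuousOn hν0 hνR (continuousOn_log_one_add_mul hγ))
          (hi.const_mul _) ?_
        filter_upwards [hν0] with l hl
        have := Real.log_le_sub_one_of_pos (x := 1 + γ * l) (by positivity)
        linarith
      rw [integral_const_mul, hνQ] at h3
      linarith
    rw [sub_self] at h2
    rw [h1, EReal.coe_mul_top_of_pos hα]
    refine le_trans ?_ (add_le_add (add_le_add I0_betaGaussian_zero_nonneg le_rfl) h2)
    rw [zero_add, EReal.top_add_coe]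
  apply le_antisymm
  · refine iSup₂_le fun qx hqx => iSup₂_le fun qz hqz => ?_
    rcases hqx.2.eq_or_lt with rfl | hqx1
    · rw [Iint_eq_bot_of_fst, EReal.add_bot]
      exact bot_le
    rcases hqz.2.eq_or_lt with hz | hqz1
    · rw [hz, Iint_eq_bot_of_snd hν0 hνR hR hνpos, EReal.add_bot]
      exact bot_le
    obtain ⟨t, rfl⟩ : ∃ t, qz = Q - t := ⟨Q - qz, by ring⟩
    have ht : 0 < t := by linarith
    have htQ : t ≤ Q := by linarith [hqz.1]
    obtain ⟨k, u, γ, hk, hu, huQ, hγ, hmain⟩ :=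
      exists_nested_le hα hδ hμ0 hμR hμ hL hQ' hsub ht htQ
    refine (replicaTerm_le hα hQ hψ hqx.1 hqx1 ht hu huQ hγ).trans ?_
    refine le_iSup₂_of_le k (Set.mem_Ici.mpr hk) (le_iInf₂ fun q hq => ?_)
    rcases hq.2.eq_or_lt with rfl | hqQ
    · refine coe_le_add_of_forall_sub_le (c := betaDim 𝕜 / 2 * (k * δ)) (fun u' hu' hu'Q => ?_) hQ
      rw [PsiOut, sub_self]
      refine le_trans ?_ (add_le_add_right (hψ0 u' hu' hu'Q) _)
      rw [← EReal.coe_add, EReal.coe_le_coe_iff, hEX]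
      have := mul_le_mul_of_nonneg_left (hmain u' hu' hu'Q) (show 0 ≤ betaDim 𝕜 / 2 by positivity)
      linear_combination this
    · have hu' : 0 < Q - q := by linarith
      have hu'Q : Q - q ≤ Q := by linarith [hq.1]
      have hval := hψ (Q - q) hu' hu'Q
      rw [sub_sub_cancel] at hval
      rw [PsiOut, hval, ← EReal.coe_add, EReal.coe_le_coe_iff, hEX]
      have := mul_le_mul_of_nonneg_left (hmain _ hu' hu'Q) (show 0 ≤ betaDim 𝕜 / 2 by positivity)
      linear_combination this
  · refine iSup₂_le fun k hk => ?_
    by_contra! hlt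
    -- Two reals are placed between the supposedly unequal values; their distance fixes the error
    -- allowed in `exists_le_nested`.
    obtain ⟨x, hx1, hx2⟩ := EReal.lt_iff_exists_real_btwn.mp hlt
    obtain ⟨y, hy1, hy2⟩ := EReal.lt_iff_exists_real_btwn.mp hx2
    rw [EReal.coe_lt_coe_iff] at hy1
    obtain ⟨t, u, a, j, ht, htQ, hu, huQ, ha, hj, hmain⟩ :=
      exists_le_nested hα hδ hμ0 hμR hμ hU hQ' hsup hk
        (show 0 < 2 / betaDim 𝕜 * (y - x) from mul_pos (by positivity) (by linarith))
    have h1 := (le_replicaTerm hα hQ hν0 hνR hψ ht ha hj).trans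
      (le_iSup₂_of_le (f := fun qx (_ : qx ∈ Set.Icc (0 : ℝ) 1) => ⨆ qz ∈ Set.Icc (0 : ℝ) Q,
        I0 (betaGaussian 𝕜) qx + (α : EReal) * Iout Pout Q qz + Iint 𝕜 1 α Q ν qx qz)
        0 (Set.left_mem_Icc.mpr zero_le_one)
        (le_iSup₂_of_le (Q - t) ⟨by linarith, by linarith⟩ le_rfl))
    have h2 := (h1.trans_lt hx1)
    rw [EReal.coe_lt_coe_iff] at h2
    -- The infimum over `q` is bounded by its value at `q = Q - u`, with `u` the conjugate point of
    -- `k`.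
    have h3 := hy2.trans_le (iInf₂_le (Q - u) ⟨by linarith, by linarith⟩)
    rw [PsiOut, sub_sub_cancel, hψ u hu huQ, ← EReal.coe_add, EReal.coe_lt_coe_iff, hEX] at h3
    have h4 := mul_le_mul_of_nonneg_left hmain (show 0 ≤ betaDim 𝕜 / 2 by positivity)
    have h5 : betaDim 𝕜 / 2 * (2 / betaDim 𝕜 * (y - x)) = y - x := by field_simp
    have h6 : betaDim 𝕜 * k / 2 * (δ * Q - δ * (Q - u))
        = betaDim 𝕜 / 2 * (k * δ * u) := by ring
    linarith

end Formula

end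

end ReplicaGLM

/-! ### Main theorem -/

theorem mainTheorem2
    {𝕜 : Type*} [RCLike 𝕜]
    {Ω : Type*} [MeasurableSpace Ω] (P : Measure Ω) [IsProbabilityMeasure P]
    (α δ : ℝ) (hα : 0 < α) (hδ : 0 < δ)
    (φ : 𝕜 → 𝕜 → ℝ) (PA : Measure 𝕜) [IsProbabilityMeasure PA] (Pout : ℝ → 𝕜 → ℝ)
    (hφ : ReplicaGLM.ChannelRegular φ) (hPout : ReplicaGLM.IsChannelDensity φ PA Pout)
    (m p : ℕ → ℕ)
    (Φ : (n : ℕ) → Ω → Matrix (Fin (m n)) (Fin n) 𝕜)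
    (W : (n : ℕ) → Ω → Matrix (Fin (m n)) (Fin (p n)) 𝕜)
    (B : (n : ℕ) → Ω → Matrix (Fin (p n)) (Fin n) 𝕜)
    (hprod : ReplicaGLM.ProductStructure P α δ m p Φ W B)
    (νB : Measure ℝ) [IsProbabilityMeasure νB]
    (hB : ReplicaGLM.SpectrumConvergence P B νB)
    (ν : Measure ℝ) [IsProbabilityMeasure ν]
    (hν : ReplicaGLM.HasLimitingSpectrum P Φ ν)
    (hνc : ∃ K : Set ℝ, IsCompact K ∧ K ⊆ Set.Ici 0 ∧ ν Kᶜ = 0) :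
    ReplicaGLM.replicaQz (ReplicaGLM.secondMoment (ReplicaGLM.betaGaussian 𝕜)) α ν
        = ReplicaGLM.productQz δ νB ∧
    ReplicaGLM.replicaFormula (ReplicaGLM.betaGaussian 𝕜) Pout α ν
        = ReplicaGLM.supInfFormula Pout α δ νB ∧
    (Tendsto
        (fun n => ReplicaGLM.freeEntropy P (ReplicaGLM.betaGaussian 𝕜) PA φ Pout (Φ n)) atTop
        (𝓝 (ReplicaGLM.replicaFormula (ReplicaGLM.betaGaussian 𝕜) Pout α ν)) ↔
      Tendsto
        (fun n => ReplicaGLM.freeEntropy P (ReplicaGLM.betaGaussian 𝕜) PA φ Pout (Φ n)) atTop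
        (𝓝 (ReplicaGLM.supInfFormula Pout α δ νB))) := by
  obtain ⟨RB, hRB, hB0, hBR, -⟩ := hB.exists_bound
  have hν0 := ReplicaGLM.ae_nonneg_of_hasLimitingSpectrum hν
  obtain ⟨Rν, hRν, hνR⟩ := ReplicaGLM.ae_le_of_compact (ν := ν)
    (hνc.imp fun K hK => ⟨hK.1, hK.2.2⟩)
  have hνR' : ∀ᵐ x ∂ν, x ≤ max RB Rν := hνR.mono fun x hx => hx.trans (le_max_right _ _)
  have hBR' : ∀ᵐ x ∂νB, x ≤ max RB Rν := hBR.mono fun x hx => hx.trans (le_max_left _ _)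
  have hU : ∀ γ k : ℝ, 0 < γ → 0 < k → ∫ l, Real.log (1 + γ * l) ∂ν
      ≤ ∫ x, Real.log (1 + k * x) ∂νB + α * ReplicaGLM.logGap (k * δ / (α * γ)) :=
    fun γ k hγ hk => ReplicaGLM.integral_log_one_add_le hα hδ hprod hB hν hν0 hνR hγ hk
  have hL : ∀ γ k : ℝ, 0 < γ → 0 < k → k * ∫ x, x / (1 + k * x) ∂νB + k * δ / γ = α →
      ∫ x, Real.log (1 + k * x) ∂νB + α * ReplicaGLM.logGap (k * δ / (α * γ))
        ≤ ∫ l, Real.log (1 + γ * l) ∂ν := fun γ k hγ hk hkγ =>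
    ReplicaGLM.le_integral_log_one_add hα hδ hprod hB hν hν0 hνR hγ hk
      (by rw [ReplicaGLM.integral_mul_div_one_add]; exact hkγ)
  have hQ : ReplicaGLM.replicaQz 1 α ν = ReplicaGLM.productQz δ νB := by
    rw [ReplicaGLM.replicaQz, ReplicaGLM.productQz,
      ReplicaGLM.integral_id_eq_of_log_moments hα hδ hB0 hBR' hν0 hνR' hU hL]
    field_simp
  have hmain : ReplicaGLM.replicaFormula (ReplicaGLM.betaGaussian 𝕜) Pout α ν
      = ReplicaGLM.supInfFormula Pout α δ νB :=
    ReplicaGLM.replicaFormula_eq_supInfFormula hPout hφ hα hδ (hRB.trans_le (le_max_left _ _))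
      hB0 hBR' hB.ne_dirac hν0 hνR' hU hL hQ
  exact ⟨by rw [ReplicaGLM.secondMoment_betaGaussian, hQ], hmain, by rw [hmain]⟩
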